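/- **Setting.** Let $d\ge 1$, let $Q_1,\dots,Q_k$ be nonzero complex polynomials in $d$ variables, $s_1,\dots,s_k\in\mathbb R$, and $F=\prod_{j} Q_j^{s_j}$. Let $G$ be the product of those $Q_j$ for which $s_j$ is not a positive integer, $g:=G\circ\exp$ and $f:=F\circ\exp$ (coordinatewise exponential, $f$ multivalued in general). For an analytic germ $h\not\equiv 0$ at $z$ let $\deg(h,z)$ be its degree of vanishing and $\hom(h,z)$ the sum of the lowest-degree terms of $h(z+\cdot)$; put $\deg(f,z):=\sum_j s_j\deg(Q_j\circ\exp,z)$. Let $B$ be the component of $\mathbb R^d\setminus\mathrm{amoeba}(G)$ containing a translate of the negative orthant, where $\mathrm{amoeba}(G)=\{(\log|Z_i|)_i: Z\in(\mathbb C^*)^d,\ G(Z)=0\}$. Let $r$ be interior to $-B^*:=\{r:\sup_B r\cdot x<\infty\}$ and proper: on $\overline B$, $r\cdot x$ is maximized at a unique point $x_{\max}$. Let $\tan(B)$ be the open tangent cone of $B$ at $x_{\max}$. **Cones.** A homogeneous $A$ is hyperbolic in a real direction $v$ if $A(v)\ne0$ and $t\mapsto A(y+tv)$ has only real roots for all real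 $y$; cones of hyperbolicity are the components of the set of such $v$. For $y\in\mathbb R^d$ let $K(y)$ be the cone of hyperbolicity of $\hom(g,x_{\max}+iy)$ containing $\tan(B)$ if $g(x_{\max}+iy)=0$, and $\mathbb R^d$ otherwise. Let $W\subset(\mathbb R/2\pi\mathbb Z)^d$ be the set of $w$ with $g(x_{\max}+iw)=0$ and $r\cdot v\le 0$ for all $v\in K(w)$; assume that $W$ is finite. For $w\in W$ put $z_w:=x_{\max}+iw$, $A_w:=\hom(g,z_w)$ and, for $0\neq y\in\mathbb R^d$, let $K_w(y)$ be the cone of hyperbolicity of $\hom(A_w,y)$ containing $K(w)$ if $A_w(y)=0$, and $\mathbb R^d$ otherwise. Assume that $r$ is non-obstructed: it is interior to $\{r:r\cdot v\le0\ \forall v\in\tan(B)\}$, and for all $w\in W$ and all real $y\ne0$ with $A_w(y)=0$ there is $v\in K_w(y)$ with $r\cdot v>0$. **Homotopies and chains.** Let $(U_w)_{w\in W}$ be disjoint open neighborhoods of the points of $W$ (lifted to bounded subsets of $\mathbb R^d$). A locally projective field is a field $\eta$ on the torus with values in $\mathbb R^d$ that is smooth off $W$; satisfies $\eta(y)\in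 K(y)$ and $r\cdot\eta(y)>0$ for $y\notin W$, and $r\cdot\eta=|r|$ off $\bigcup_w U_w$; and, for each $w\in W$, coincides near $w$ with $\eta_w(y-w)$, where $\eta_w$ is homogeneous of degree $1$, smooth off $0$, $\eta_w(y)\in K_w(y)$ for $y\neq0$, and $r'\cdot\eta_w(y)\ge|r'||y|$ for all $y$ and all $r'$ in a neighborhood of $r$. For $u\in\tan(B)$ and $\varepsilon>0$ let $\Phi_t(y)=x_{\max}+iy+\varepsilon[(1-t)u+t\eta(y)]$, and let $\mathcal C_w$ be the chain $\Phi_1|_{\overline{U_w}}$. **Lemma (big-O estimate).** For every family $(U_w)$ as above, locally projective fields exist. For each such field $\eta$ and each $u\in\tan(B)$ there is $\varepsilon_0>0$ such that, for $0<\varepsilon<\varepsilon_0$, one has $g(\Phi_t(y))\neq0$ for all $t\in[0,1]$ and all $y$, except possibly when $t=1$ and $y\in W$, and there is a conical neighborhood $\mathcal N$ of $r$ such that the following hold for all $w\in W$, uniformly for $0\ne r'\in\mathcal N$. 1. If $\beta+d>0$ and $\varphi$ is a measurable function on $\mathcal C_w$ with $\varphi(z)=O(|z-z_w|^\beta)$,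 then $\int_{\mathcal C_w}e^{-r'\cdot z}\varphi(z)\,dz$ converges absolutely and $$e^{r'\cdot x_{\max}}\left|\int_{\mathcal C_w}e^{-r'\cdot z}\varphi(z)\,dz\right|=O\left(|r'|^{-d-\beta}\right).$$ 2. If $\deg(f,z_w)+d>0$, then for every bounded measurable function $\psi$ and every measurable branch of $f$ on $\mathcal C_w$ the following integral converges absolutely and $$e^{r'\cdot x_{\max}}\left|\int_{\mathcal C_w}e^{-r'\cdot z}\psi(z)f(z)\,dz\right|=O\left(|r'|^{-(d+\deg(f,z_w))}\right).$$ The constants in 1 and 2 depend on $\varphi$ and $\psi$ only through $\beta$ and, linearly, through the constant in the bound on $\varphi$, respectively $\sup|\psi|$. 3. If $W\ne\emptyset$ and $a_n$ are the Taylor coefficients at the origin of a branch of $F$ that is analytic there (with $Q_j(0)\ne0$ whenever $s_j$ is not a positive integer), then, for $n\in\mathbb N^d$ in some conical neighborhood of $r$, $$a_n=O\left(e^{-n\cdot x_{\max}}|n|^{-\alpha}\right),\qquad \alpha=d+\min_{w\in W}\deg(f,z_w).$$ -/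

import Mathlib

open Set Filter Topology MeasureTheory
open scoped ContDiff

noncomputable section

namespace LocProj

/-- Real space `ℝ^d` (Euclidean norm). Covectors `r` are identified with vectors through the
standard pairing `r · x = inner ℝ r x`. -/
abbrev RSp (d : ℕ) : Type := EuclideanSpace ℝ (Fin d)

/-- Complex space `ℂ^d` (Hermitian norm). -/
abbrev CSp (d : ℕ) : Type := EuclideanSpace ℂ (Fin d)

variable {d k : ℕ}

/-- The inclusion `ℝ^d ⊆ ℂ^d`. -/
def cx (x : RSp d) : CSp d := WithLp.toLp 2 fun i => (x i : ℂ)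

/-- The point `x + i y` of `ℂ^d`. -/
def pt (x y : RSp d) : CSp d := cx x + Complex.I • cx y

/-- The complex bilinear pairing `r · z` of a real covector with a point of `ℂ^d`. -/
def pair (r : RSp d) (z : CSp d) : ℂ := ∑ i, (r i : ℂ) * z i

/-- The lattice vector `2 π n`. -/
def lat (n : Fin d → ℤ) : RSp d := WithLp.toLp 2 fun i => 2 * Real.pi * (n i : ℝ)

/-- A multi-index as a vector. -/
def natVec (n : Fin d → ℕ) : RSp d := WithLp.toLp 2 fun i => (n i : ℝ)

/-- The function `Q ∘ exp`, with the coordinatewise exponential. -/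
def expPull (Q : MvPolynomial (Fin d) ℂ) (z : CSp d) : ℂ :=
  MvPolynomial.eval (fun i => Complex.exp (z i)) Q

/-! ### Products of real powers of polynomials -/

open Classical in
/-- `G`, the product of those `Q j` whose exponent `s j` is not a positive integer. -/
def singularPart (Q : Fin k → MvPolynomial (Fin d) ℂ) (s : Fin k → ℝ) :
    MvPolynomial (Fin d) ℂ :=
  ∏ j ∈ Finset.univ.filter (fun j => ¬ ∃ n : ℕ, 0 < n ∧ s j = n), Q j

/-- `v` is a value of the (in general multivalued) power `q ^ s`: the ordinary power when `s` is a
positive integer, and otherwise `exp (s ℓ)` for some logarithm `ℓ` of `q` (so `q ≠ 0`). -/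
def IsPowValue (q : ℂ) (s : ℝ) (v : ℂ) : Prop :=
  (∃ n : ℕ, 0 < n ∧ s = n ∧ v = q ^ n) ∨
    ∃ l : ℂ, Complex.exp l = q ∧ v = Complex.exp ((s : ℂ) * l)

/-- `v` is a value at `Z` of the multivalued function `F = ∏ j, Q j ^ s j`. -/
def IsValue (Q : Fin k → MvPolynomial (Fin d) ℂ) (s : Fin k → ℝ) (Z : Fin d → ℂ) (v : ℂ) : Prop :=
  ∃ p : Fin k → ℂ, (∀ j, IsPowValue (MvPolynomial.eval Z (Q j)) (s j) (p j)) ∧ v = ∏ j, p j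

/-- `a` is the family of Taylor coefficients at the origin of a branch of `F = ∏ j, Q j ^ s j`:
near the origin, the power series converges to a value of `F`. (In particular the `Q j` whose
exponents are not positive integers do not vanish at the origin.) -/
def IsTaylorCoeff (Q : Fin k → MvPolynomial (Fin d) ℂ) (s : Fin k → ℝ)
    (a : (Fin d → ℕ) → ℂ) : Prop :=
  ∀ᶠ Z : Fin d → ℂ in 𝓝 0, ∃ v : ℂ, IsValue Q s Z v ∧
    HasSum (fun n : Fin d → ℕ => a n * ∏ i, Z i ^ n i) v

/-! ### Homogeneous parts -/

/-- The degree of vanishing `deg (f, z)` of an analytic germ which is not identically zero: the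
least degree of a nonzero term of the Taylor expansion of `f` at `z`. -/
def degAt (f : CSp d → ℂ) (z : CSp d) : ℕ := sInf {n : ℕ | iteratedFDeriv ℂ n f z ≠ 0}

/-- The homogeneous part `hom (f, z)`: the sum of the terms of least degree of the Taylor expansion
of `w ↦ f (z + w)` at `0`. -/
def homPart (f : CSp d → ℂ) (z : CSp d) (w : CSp d) : ℂ :=
  ((degAt f z).factorial : ℂ)⁻¹ * iteratedFDeriv ℂ (degAt f z) f z (fun _ => w)

/-- The homogeneous degree `∑ j, s j * deg (Q j ∘ exp, z)` of `F ∘ exp` at `z`. -/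
def degF (Q : Fin k → MvPolynomial (Fin d) ℂ) (s : Fin k → ℝ) (z : CSp d) : ℝ :=
  ∑ j, s j * (degAt (expPull (Q j)) z : ℝ)

/-! ### Amoebas, tangent cones, dual cones -/

/-- The amoeba: the image of the zeros of `G` in the complex torus under `Z ↦ (log |Z i|)_i`. -/
def amoeba (G : MvPolynomial (Fin d) ℂ) : Set (RSp d) :=
  {x | ∃ Z : Fin d → ℂ, (∀ i, Z i ≠ 0) ∧ MvPolynomial.eval Z G = 0 ∧
    ∀ i, x i = Real.log ‖Z i‖}

/-- `B` is the component of the complement of the amoeba of `G` that contains a translate of the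
negative orthant. -/
def IsPowerSeriesComponent (G : MvPolynomial (Fin d) ℂ) (B : Set (RSp d)) : Prop :=
  (∃ b ∈ (amoeba G)ᶜ, B = connectedComponentIn (amoeba G)ᶜ b) ∧
    ∃ c : RSp d, ∀ x : RSp d, (∀ i, x i < c i) → x ∈ B

/-- The (open) tangent cone of the open convex set `B` at `x`. -/
def tanCone (B : Set (RSp d)) (x : RSp d) : Set (RSp d) :=
  {v | ∀ᶠ t : ℝ in 𝓝[>] 0, x + t • v ∈ B}

/-- The negative dual `-K^*` of a cone `K`: the covectors that are nonpositive on `K`. -/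
def negDual (K : Set (RSp d)) : Set (RSp d) := {r | ∀ v ∈ K, inner ℝ r v ≤ 0}

/-- The negative dual `-B^*` of the (not necessarily conical) convex set `B`: the covectors bounded
above on `B`. -/
def barrier (B : Set (RSp d)) : Set (RSp d) := {r | BddAbove ((fun x => inner ℝ r x) '' B)}

/-- The direction `r` is proper for `B` with dual point `x`: on the closure of `B`, `r` is
maximized at `x` and only there. -/
def IsDualPoint (B : Set (RSp d)) (r x : RSp d) : Prop :=
  x ∈ closure B ∧ ∀ y ∈ closure B, y ≠ x → inner ℝ r y < inner ℝ r x

/-! ### Hyperbolicity -/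

/-- The real directions `v` in which the homogeneous polynomial `A` is hyperbolic: `A v ≠ 0`, and
`t ↦ A (y + t v)` has only real roots for every real `y`. -/
def hypDirs (A : CSp d → ℂ) : Set (RSp d) :=
  {v | A (cx v) ≠ 0 ∧ ∀ (y : RSp d) (t : ℂ), A (cx y + t • cx v) = 0 → t.im = 0}

/-- The cone of hyperbolicity of `A` that contains `C`, for a connected set `C` of directions of
hyperbolicity: the component of the set of these directions through the points of `C`. -/
def hypCone (A : CSp d → ℂ) (C : Set (RSp d)) : Set (RSp d) :=
  {v | ∃ u ∈ C, v ∈ connectedComponentIn (hypDirs A) u}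

/-- The family of cones `K (z)`: where `f z = 0`, it is the cone of hyperbolicity of `hom (f, z)`
that contains `C`; where `f z ≠ 0`, it is all of `ℝ^d`. -/
def coneFam (f : CSp d → ℂ) (C : Set (RSp d)) (z : CSp d) : Set (RSp d) :=
  {v | f z = 0 → v ∈ hypCone (homPart f z) C}

/-- The cone `K^{g,B} (exp (x + i y))` for `x` on the boundary of `B`. -/
def logCone (g : CSp d → ℂ) (B : Set (RSp d)) (x y : RSp d) : Set (RSp d) :=
  coneFam g (tanCone B x) (pt x y)

/-- The set `W (r)` of logarithmic minimal critical points, lifted to a `2 π ℤ^d`-periodic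
subset of `ℝ^d`; `x` is the dual point of `r`. -/
def critSet (g : CSp d → ℂ) (B : Set (RSp d)) (r x : RSp d) : Set (RSp d) :=
  {y | g (pt x y) = 0 ∧ r ∈ negDual (logCone g B x y)}

/-- The homogeneous part of `g` at `x + i w`. -/
def tangentPoly (g : CSp d → ℂ) (x w : RSp d) : CSp d → ℂ := homPart g (pt x w)

/-- The cone `K^{A,K} (y)` attached to the homogeneous polynomial `A = hom (g, x + i w)`, to its
cone of hyperbolicity `K = K^{g,B} (exp (x + i w))` and to a real vector `y`. -/
def projCone (g : CSp d → ℂ) (B : Set (RSp d)) (x w y : RSp d) : Set (RSp d) :=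
  coneFam (tangentPoly g x w) (logCone g B x w) (cx y)

/-- The direction `r` with dual point `x` is non-obstructed: it is interior to the normal cone of
`B` at `x` and, for every critical point `w` and every nonzero real zero `y` of
`A = hom (g, x + i w)`, the cone `K^{A,K} (y)` contains a vector on which `r` is positive. -/
def NonObstructed (g : CSp d → ℂ) (B : Set (RSp d)) (r x : RSp d) : Prop :=
  r ∈ interior (negDual (tanCone B x)) ∧
    ∀ w ∈ critSet g B r x, ∀ y : RSp d, y ≠ 0 → tangentPoly g x w (cx y) = 0 →
      ∃ v ∈ projCone g B x w y, 0 < inner ℝ r v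

/-! ### Locally projective vector fields, homotopies and chains -/

/-- A projective vector field at the critical point `w`: homogeneous of degree one, smooth away
from the origin, a section of the cones `K^{A,K}`, and with `r' · η ≥ |r'| |y|` for all `r'` in a
neighborhood of `r`. -/
structure IsProjectiveField (g : CSp d → ℂ) (B : Set (RSp d)) (r x w : RSp d)
    (η : RSp d → RSp d) : Prop where
  homog : ∀ (c : ℝ) (y : RSp d), 0 ≤ c → η (c • y) = c • η y
  smooth : ContDiffOn ℝ ∞ η {0}ᶜ
  mem_cone : ∀ y, y ≠ 0 → η y ∈ projCone g B x w y
  growth : ∀ᶠ r' in 𝓝 r, ∀ y, ‖r'‖ * ‖y‖ ≤ inner ℝ r' (η y)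

/-- Disjoint open neighborhoods `U w` of the points of a subset `W` of the torus
`(ℝ / 2 π ℤ)^d`, all lifted to `ℝ^d`. -/
structure IsNhdFamily (W : Set (RSp d)) (U : RSp d → Set (RSp d)) : Prop where
  isOpen : ∀ w ∈ W, IsOpen (U w)
  mem : ∀ w ∈ W, w ∈ U w
  bounded : ∀ w ∈ W, Bornology.IsBounded (U w)
  disjoint : ∀ w ∈ W, ∀ w' ∈ W, w ≠ w' → Disjoint (U w) (U w')
  periodic : ∀ w ∈ W, ∀ (n : Fin d → ℤ) (y : RSp d), y + lat n ∈ U (w + lat n) ↔ y ∈ U w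

/-- A locally projective vector field on the torus, lifted to `ℝ^d`: it is smooth off the critical
set `W`, is a section of the cones `K^{g,B}` there, satisfies `r · η > 0` there with the
normalization `r · η = |r|` outside the neighborhoods `U w`, and near every `w` in `W` it is a
projective vector field centered at `w`. -/
structure IsLocProjField (g : CSp d → ℂ) (B : Set (RSp d)) (r x : RSp d)
    (U : RSp d → Set (RSp d)) (η : RSp d → RSp d) : Prop where
  periodic : ∀ (n : Fin d → ℤ) (y : RSp d), η (y + lat n) = η y
  smooth : ContDiffOn ℝ ∞ η (critSet g B r x)ᶜ
  mem_cone : ∀ y ∉ critSet g B r x, η y ∈ logCone g B x y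
  pos : ∀ y ∉ critSet g B r x, 0 < inner ℝ r (η y)
  normalized : ∀ y, (∀ w ∈ critSet g B r x, y ∉ U w) → inner ℝ r (η y) = ‖r‖
  projective : ∀ w ∈ critSet g B r x, ∃ ηw : RSp d → RSp d, IsProjectiveField g B r x w ηw ∧
    ∀ᶠ y in 𝓝 w, η y = ηw (y - w)

/-- The homotopy `Φ_t (y) = x + i y + ε ((1 - t) u + t η (y))`. -/
def homotopy (x u : RSp d) (η : RSp d → RSp d) (ε t : ℝ) (y : RSp d) : CSp d :=
  pt x y + (ε : ℂ) • cx ((1 - t) • u + t • η y)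

/-- The pullback of the holomorphic volume form `dz = dz_1 ∧ ⋯ ∧ dz_d` by the parametrization `c`
of a `d`-chain, relative to Lebesgue measure: the determinant of the Jacobian `∂ z_i / ∂ y_j`. -/
def jac (c : RSp d → CSp d) (y : RSp d) : ℂ :=
  Matrix.det (Matrix.of fun i j : Fin d => (fderiv ℝ c y (EuclideanSpace.single j 1)) i)

/-- Absolute convergence of the integral of `h dz` over the chain `c` restricted to `S`. -/
def ChainIntegrable (c : RSp d → CSp d) (S : Set (RSp d)) (h : CSp d → ℂ) : Prop :=
  IntegrableOn (fun y => h (c y) * jac c y) S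

/-- The integral of `h dz` over the chain `c` restricted to `S`. -/
def chainIntegral (c : RSp d → CSp d) (S : Set (RSp d)) (h : CSp d → ℂ) : ℂ :=
  ∫ y in S, h (c y) * jac c y

/-- The `δ`-conical neighborhood of the direction of `r`. -/
def conicNhd (r : RSp d) (δ : ℝ) : Set (RSp d) :=
  {r' | r' ≠ 0 ∧ ‖‖r'‖⁻¹ • r' - ‖r‖⁻¹ • r‖ < δ}

end LocProj

end

open LocProj

/-!
The linear forms `r · x` attain their maximum over `closure B` at `x`, so `exp (- n · z)` grows at
the rate `exp (- n · x)` along the torus over `x`, and decays relative to this rate on every chain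
which is displaced from this torus in directions `v` with `r · v > 0`. Displacements avoiding the
zeros of `g` are available off the critical set `W` because of the hyperbolicity of the homogeneous
parts of `g`; at the points of `W` the displacement has to vanish, but the non-obstruction hypothesis
allows it to vanish only to first order.

*Cones.* The basic tool is Hurwitz's theorem. It yields the local propagation of zero-free tubes
(`localFree_family`): if `g` has no zeros over small multiples of a direction `u`, and the
homogeneous part of `g` at `z` does not vanish on the cone spanned by `u` and a second direction `v`,
then `g` has no zeros at points displaced from a neighborhood of `z` by small nonnegative
combinations of `u` and `v`. Three consequences are the openness and convexity of the cones of
hyperbolicity (`isOpen_hypDirs`, `convex_tube_component`), the freeness of displacements along the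
cones (`TubeData.localFree`), and the lower semicontinuity of the cones
(`TubeData.eventually_mem_logCone`). As the propagation holds uniformly in families, it applies to
the germs of `g` rescaled to their homogeneous part, and the same facts follow for the second-level
cones, together with the comparison of both kinds of cones near a critical point
(`TubeData.localFree_proj`, `TubeData.exists_mem_logCone_of_mem_projCone`).

*Vector fields.* Lower semicontinuity and convexity of the cones allow partitions of unity: on a
sphere around the origin they give projective fields (`TubeData.exists_isProjectiveField`), and on
the torus they give locally projective fields (`TubeData.exists_isLocProjField`). These fields are
Lipschitz, the displacements along them avoid the zeros of `g` (`IsLocProjField.exists_free`), and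
`r' · η (y)` is at least a multiple of `|r'| |y - w|` on `U w` (`IsLocProjField.exists_inner_ge`).

*Estimates on the chains.* On the chain near `w` the integrand is dominated by
`exp (- c |r'| |y - w|) |y - w| ^ β`, and the substitution `y - w = y' / |r'|` gives the power
`|r'| ^ (- d - β)` (`IsLocProjField.exists_chainIntegral_bound`). For the values of `F` the exponent
`β` is the degree of `f` at `w`, because every factor is bounded above by the power of `|y - w|` given
by its degree, and `g` is bounded below by the power given by its degree: its homogeneous part does
not vanish on the compact set of directions of the chain (`IsLocProjField.exists_lower_bound_near`,
`IsLocProjField.exists_isValue_bound`).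

*Taylor coefficients.* By Cauchy's formula, `a n` is the integral of a branch of `F ∘ exp` against
`exp (- n · z)` over the torus above a point `b` of the negative orthant. The torus is deformed to
`x + i y + σ u + ε η (y)` with `u = b - x` and `σ > 0` (`TubeBranch.exists_deformed_integral`). Stokes'
theorem is not needed for this: the integrals over the chains `b + i y + τ v (y)` are holomorphic in
`τ`, and for small imaginary `τ` they arise from the original one by a change of variables of the
torus, hence they are constant. The term `σ u` keeps the chain away from the singularities of `F`
whatever the integrability there, and with `σ = σ₀ / |n|` it contributes bounded factors only, so that
the estimate at the critical points has the same form as before, with `|y - w| + σ` in place of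
`|y - w|` and without restriction on the exponent (`IsLocProjField.exists_lintegral_le_near`,
`IsLocProjField.exists_coeff_bound`).
-/

open Set Filter Topology MeasureTheory
open scoped ContDiff

noncomputable section

namespace LocProj

variable {d k : ℕ}

/-! ### Lowest-degree Taylor terms -/

/-- A power series converging to an everywhere analytic function whose `n`-th term vanishes on the
diagonal can be modified to have vanishing `n`-th term; hence the full derivative vanishes. -/
theorem iteratedFDeriv_eq_zero_of_diag {f : CSp d → ℂ} (hf : AnalyticOnNhd ℂ f univ) (z : CSp d)
    (n : ℕ) (h : ∀ y, iteratedFDeriv ℂ n f z (fun _ => y) = 0) : iteratedFDeriv ℂ n f z = 0 := by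
  obtain ⟨p, R, hp⟩ := hf z (mem_univ z)
  have hdiag : ∀ y, p n (fun _ => y) = 0 := by
    intro y
    have h1 := hp.factorial_smul y n
    rw [h y] at h1
    exact (smul_eq_zero.mp h1).resolve_left n.factorial_ne_zero
  let p' : FormalMultilinearSeries ℂ (CSp d) ℂ := Function.update p n 0
  have hp' : HasFPowerSeriesOnBall f p' z R := by
    refine ⟨?_, hp.r_pos, ?_⟩
    · refine hp.r_le.trans ?_
      refine ENNReal.le_of_forall_nnreal_lt fun r hr => ?_
      obtain ⟨C, -, hC⟩ := p.norm_mul_pow_le_of_lt_radius hr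
      refine p'.le_radius_of_bound C fun m => ?_
      by_cases hm : m = n
      · subst hm
        have : p' m = 0 := Function.update_self ..
        rw [this]
        simpa using (by positivity : (0:ℝ) ≤ ‖p m‖ * (r:ℝ) ^ m).trans (hC m)
      · have : p' m = p m := Function.update_of_ne hm ..
        rw [this]; exact hC m
    · intro y hy
      convert hp.hasSum hy using 1
      funext m
      by_cases hm : m = n
      · subst hm
        have : p' m = 0 := Function.update_self ..
        rw [this, hdiag y]; rfl
      · have : p' m = p m := Function.update_of_ne hm ..
        rw [this]
  ext v
  rw [hp'.iteratedFDeriv_eq_sum hf.analyticOn v]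
  have : p' n = 0 := Function.update_self ..
  simp [this]

theorem exists_iteratedFDeriv_ne_zero {f : CSp d → ℂ} (hf : AnalyticOnNhd ℂ f univ)
    (h0 : ∃ z, f z ≠ 0) (z : CSp d) : ∃ n, iteratedFDeriv ℂ n f z ≠ 0 := by
  by_contra! h
  obtain ⟨p, R, hp⟩ := hf z (mem_univ z)
  have hev : f =ᶠ[𝓝 z] 0 := by
    have : ∀ᶠ y in 𝓝 z, y ∈ Metric.eball z R := Metric.eball_mem_nhds z hp.r_pos
    filter_upwards [this] with y hy
    have h1 := hp.hasSum_iteratedFDeriv (y := y - z) (by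
      simpa [Metric.mem_eball, edist_eq_enorm_sub] using hy)
    simp only [h, add_sub_cancel] at h1
    simpa using h1.unique (by simp)
  obtain ⟨z', hz'⟩ := h0
  exact hz' (congrFun (hf.eq_of_eventuallyEq (g := 0) (fun _ _ => analyticAt_const) hev) z')

theorem iteratedFDeriv_of_lt_degAt {f : CSp d → ℂ} {z : CSp d} {n : ℕ} (hn : n < degAt f z) :
    iteratedFDeriv ℂ n f z = 0 := by
  by_contra h
  exact Nat.notMem_of_lt_sInf hn h

theorem homPart_smul (f : CSp d → ℂ) (z : CSp d) (c : ℂ) (w : CSp d) :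
    homPart f z (c • w) = c ^ degAt f z * homPart f z w := by
  unfold homPart
  have := (iteratedFDeriv ℂ (degAt f z) f z).map_smul_univ (fun _ => c) (fun _ => w)
  rw [this]
  simp
  ring

theorem analyticOnNhd_homPart (f : CSp d → ℂ) (z : CSp d) :
    AnalyticOnNhd ℂ (homPart f z) univ := by
  intro w _
  unfold homPart
  refine analyticAt_const.mul ?_
  have h1 : AnalyticAt ℂ (fun v => iteratedFDeriv ℂ (degAt f z) f z v)
      ((fun (w : CSp d) (_ : Fin (degAt f z)) => w) w) :=
    (iteratedFDeriv ℂ (degAt f z) f z).analyticAt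
  refine h1.comp (f := fun (w : CSp d) (_ : Fin (degAt f z)) => w) ?_
  exact AnalyticAt.pi fun _ => analyticAt_id

theorem continuous_homPart (f : CSp d → ℂ) (z : CSp d) : Continuous (homPart f z) :=
  continuous_iff_continuousAt.2 fun w => (analyticOnNhd_homPart f z w (mem_univ w)).continuousAt

theorem exists_homPart_ne_zero {f : CSp d → ℂ} (hf : AnalyticOnNhd ℂ f univ)
    (h0 : ∃ z, f z ≠ 0) (z : CSp d) : ∃ w, homPart f z w ≠ 0 := by
  by_contra! h
  have hm : iteratedFDeriv ℂ (degAt f z) f z ≠ 0 :=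
    Nat.sInf_mem (exists_iteratedFDeriv_ne_zero hf h0 z)
  refine hm (iteratedFDeriv_eq_zero_of_diag hf z _ fun y => ?_)
  have := h y
  unfold homPart at this
  exact (mul_eq_zero.mp this).resolve_left
    (inv_ne_zero (by exact_mod_cast Nat.factorial_ne_zero _))

theorem degAt_of_ne {f : CSp d → ℂ} {z : CSp d} (h : f z ≠ 0) : degAt f z = 0 := by
  refine Nat.sInf_eq_zero.2 (Or.inl ?_)
  intro h0
  have : iteratedFDeriv ℂ 0 f z (fun _ => 0) = f z := iteratedFDeriv_zero_apply _
  rw [h0] at this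
  exact h (by simpa using this.symm)

theorem homPart_of_ne {f : CSp d → ℂ} {z : CSp d} (h : f z ≠ 0) (w : CSp d) :
    homPart f z w = f z := by
  unfold homPart
  rw [degAt_of_ne h]
  simp

/-- Taylor's formula with remainder: all terms below the degree of vanishing vanish. -/
theorem exists_taylor_bound {f : CSp d → ℂ} (hf : AnalyticOnNhd ℂ f univ) (z : CSp d) :
    ∃ R > 0, ∃ C > 0, ∀ h : CSp d, ‖h‖ ≤ R →
      ‖f (z + h) - homPart f z h‖ ≤ C * ‖h‖ ^ (degAt f z + 1) := by
  obtain ⟨p, ρ, hp⟩ := hf z (mem_univ z)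
  have h1 := hp.hasFPowerSeriesAt.isBigO_sub_partialSum_pow (degAt f z + 1)
  have hsum : ∀ y, p.partialSum (degAt f z + 1) y = homPart f z y := by
    intro y
    have hterm : ∀ n, p n (fun _ => y) =
        ((n.factorial : ℂ)⁻¹) * iteratedFDeriv ℂ n f z (fun _ => y) := by
      intro n
      rw [← hp.factorial_smul y n, nsmul_eq_mul, ← mul_assoc, inv_mul_cancel₀, one_mul]
      exact_mod_cast n.factorial_ne_zero
    unfold FormalMultilinearSeries.partialSum
    rw [Finset.sum_range_succ, Finset.sum_eq_zero, zero_add, hterm, homPart]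
    intro n hn
    rw [hterm, iteratedFDeriv_of_lt_degAt (Finset.mem_range.1 hn)]
    simp
  obtain ⟨C, hC, h2⟩ := h1.exists_pos
  rw [Asymptotics.isBigOWith_iff] at h2
  obtain ⟨R, hR, h3⟩ := Metric.eventually_nhds_iff.1 h2
  refine ⟨R / 2, by positivity, C, hC, fun h hh => ?_⟩
  have := h3 (y := h) (by rw [dist_zero_right]; linarith)
  rw [hsum] at this
  simpa using this

/-- Rescaled Taylor expansion: the rescaled germs converge to the homogeneous part. -/
theorem exists_scaled_taylor_bound {f : CSp d → ℂ} (hf : AnalyticOnNhd ℂ f univ) (z : CSp d) :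
    ∃ R > 0, ∃ C > 0, ∀ (c : ℂ) (h : CSp d), c ≠ 0 → ‖c‖ * ‖h‖ ≤ R →
      ‖f (z + c • h) / c ^ degAt f z - homPart f z h‖ ≤ C * ‖c‖ * ‖h‖ ^ (degAt f z + 1) := by
  obtain ⟨R, hR, C, hC, H⟩ := exists_taylor_bound hf z
  refine ⟨R, hR, C, hC, fun c h hc hh => ?_⟩
  have h1 := H (c • h) (by rwa [norm_smul])
  rw [homPart_smul] at h1
  have hcn : 0 < ‖c‖ := norm_pos_iff.2 hc
  have h2 : f (z + c • h) / c ^ degAt f z - homPart f z h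
      = (f (z + c • h) - c ^ degAt f z * homPart f z h) / c ^ degAt f z := by
    field_simp
  rw [h2, norm_div, norm_pow, div_le_iff₀ (by positivity)]
  refine h1.trans (le_of_eq ?_)
  rw [norm_smul]
  ring

theorem tendsto_scaled {f : CSp d → ℂ} (hf : AnalyticOnNhd ℂ f univ) (z h : CSp d) :
    Tendsto (fun ρ : ℝ => f (z + (ρ : ℂ) • h) / (ρ : ℂ) ^ degAt f z) (𝓝[>] 0)
      (𝓝 (homPart f z h)) := by
  obtain ⟨R, hR, C, hC, H⟩ := exists_scaled_taylor_bound hf z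
  rw [tendsto_iff_norm_sub_tendsto_zero]
  have hlim : Tendsto (fun ρ : ℝ => C * |ρ| * ‖h‖ ^ (degAt f z + 1)) (𝓝[>] 0) (𝓝 0) := by
    have : Continuous (fun ρ : ℝ => C * |ρ| * ‖h‖ ^ (degAt f z + 1)) := by fun_prop
    simpa using (this.tendsto 0).mono_left nhdsWithin_le_nhds
  refine squeeze_zero' (Eventually.of_forall fun _ => norm_nonneg _) ?_ hlim
  have hsm : ∀ᶠ ρ : ℝ in 𝓝[>] 0, |ρ| * ‖h‖ ≤ R := by
    have : Continuous (fun ρ : ℝ => |ρ| * ‖h‖) := by fun_prop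
    have h2 := this.tendsto 0
    simp only [abs_zero, zero_mul] at h2
    exact (h2.eventually (eventually_le_nhds hR)).filter_mono nhdsWithin_le_nhds
  filter_upwards [hsm, self_mem_nhdsWithin] with ρ h1 h2
  have h2 : (0:ℝ) < ρ := h2
  have := H (ρ : ℂ) h (by exact_mod_cast h2.ne') (by simpa using h1)
  simpa using this

/-- The degree and the homogeneous part are characterized by the limit of the rescaled germs. -/
theorem degAt_homPart_unique {f : CSp d → ℂ} (hf : AnalyticOnNhd ℂ f univ) {z : CSp d} {n : ℕ}
    {a : CSp d → ℂ} (ha : ∃ w, a w ≠ 0)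
    (h : ∀ w, Tendsto (fun ρ : ℝ => f (z + (ρ : ℂ) • w) / (ρ : ℂ) ^ n) (𝓝[>] 0) (𝓝 (a w))) :
    degAt f z = n ∧ homPart f z = a := by
  have h0 : ∃ z, f z ≠ 0 := by
    by_contra! hc
    obtain ⟨w, hw⟩ := ha
    have := h w
    simp only [hc, zero_div] at this
    exact hw (tendsto_nhds_unique this tendsto_const_nhds)
  have key : ∀ (p q : ℕ) (b c : CSp d → ℂ), (∃ w, c w ≠ 0) →
      (∀ w, Tendsto (fun ρ : ℝ => f (z + (ρ : ℂ) • w) / (ρ : ℂ) ^ p) (𝓝[>] 0) (𝓝 (b w))) →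
      (∀ w, Tendsto (fun ρ : ℝ => f (z + (ρ : ℂ) • w) / (ρ : ℂ) ^ q) (𝓝[>] 0) (𝓝 (c w))) →
      p ≤ q := by
    intro p q b c hc hp hq
    by_contra! hlt
    obtain ⟨w, hw⟩ := hc
    have h1 : Tendsto (fun ρ : ℝ => f (z + (ρ : ℂ) • w) / (ρ : ℂ) ^ p * (ρ : ℂ) ^ (p - q))
        (𝓝[>] 0) (𝓝 (b w * 0)) := by
      refine (hp w).mul ?_
      have : Continuous (fun ρ : ℝ => (ρ : ℂ) ^ (p - q)) := by fun_prop
      have h2 := (this.tendsto 0).mono_left (nhdsWithin_le_nhds (s := Ioi 0))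
      simpa [zero_pow (Nat.sub_ne_zero_of_lt hlt)] using h2
    rw [mul_zero] at h1
    refine hw (tendsto_nhds_unique (hq w) (h1.congr' ?_))
    filter_upwards [self_mem_nhdsWithin] with ρ hρ
    have hρ : (ρ : ℂ) ≠ 0 := by exact_mod_cast (ne_of_gt hρ : ρ ≠ 0)
    rw [div_mul_eq_mul_div, div_eq_div_iff (pow_ne_zero _ hρ) (pow_ne_zero _ hρ), mul_assoc,
      ← pow_add, Nat.sub_add_cancel hlt.le]
  have hd : degAt f z = n :=
    le_antisymm (key _ _ _ _ ha (tendsto_scaled hf z) h)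
      (key _ _ _ _ (exists_homPart_ne_zero hf h0 z) h (tendsto_scaled hf z))
  refine ⟨hd, funext fun w => ?_⟩
  have h1 := tendsto_scaled hf z w
  rw [hd] at h1
  exact tendsto_nhds_unique h1 (h w)

/-- The ring of everywhere analytic functions on `ℂ^d` has no zero divisors. -/
theorem exists_mul_ne_zero {a b : CSp d → ℂ} (ha : AnalyticOnNhd ℂ a univ)
    (hb : AnalyticOnNhd ℂ b univ) (ha0 : ∃ w, a w ≠ 0) (hb0 : ∃ w, b w ≠ 0) :
    ∃ w, a w * b w ≠ 0 := by
  by_contra! h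
  obtain ⟨w, hw⟩ := ha0
  obtain ⟨w', hw'⟩ := hb0
  have hev : b =ᶠ[𝓝 w] 0 := by
    filter_upwards [(ha w (mem_univ w)).continuousAt.eventually_ne hw] with y hy
    exact (mul_eq_zero.mp (h y)).resolve_left hy
  exact hw' (congrFun (hb.eq_of_eventuallyEq (g := 0) (fun _ _ => analyticAt_const) hev) w')

theorem degAt_mul {f g : CSp d → ℂ} (hf : AnalyticOnNhd ℂ f univ) (hg : AnalyticOnNhd ℂ g univ)
    (hf0 : ∃ w, f w ≠ 0) (hg0 : ∃ w, g w ≠ 0) (z : CSp d) :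
    degAt (fun w => f w * g w) z = degAt f z + degAt g z := by
  have hmul : AnalyticOnNhd ℂ (fun w => f w * g w) univ := fun w hw => (hf w hw).mul (hg w hw)
  refine (degAt_homPart_unique (a := fun w => homPart f z w * homPart g z w) hmul
    (exists_mul_ne_zero (analyticOnNhd_homPart f z) (analyticOnNhd_homPart g z)
      (exists_homPart_ne_zero hf hf0 z) (exists_homPart_ne_zero hg hg0 z)) fun w => ?_).1
  refine ((tendsto_scaled hf z w).mul (tendsto_scaled hg z w)).congr fun ρ => ?_
  rw [div_mul_div_comm, pow_add]

theorem exists_prod_ne_zero_and_degAt_prod {ι : Type*} (S : Finset ι) {f : ι → CSp d → ℂ}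
    (hf : ∀ i ∈ S, AnalyticOnNhd ℂ (f i) univ) (hf0 : ∀ i ∈ S, ∃ w, f i w ≠ 0) :
    AnalyticOnNhd ℂ (fun w => ∏ i ∈ S, f i w) univ ∧ (∃ w, ∏ i ∈ S, f i w ≠ 0) ∧
      ∀ z, degAt (fun w => ∏ i ∈ S, f i w) z = ∑ i ∈ S, degAt (f i) z := by
  classical
  induction S using Finset.induction_on with
  | empty =>
    refine ⟨by simpa using analyticOnNhd_const, ⟨0, by simp⟩, fun z => ?_⟩
    simpa using degAt_of_ne (f := fun _ : CSp d => (1:ℂ)) (z := z) one_ne_zero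
  | insert i S hi ih =>
    obtain ⟨h1, h2, h3⟩ := ih (fun j hj => hf j (Finset.mem_insert_of_mem hj))
      (fun j hj => hf0 j (Finset.mem_insert_of_mem hj))
    have hfi := hf i (Finset.mem_insert_self i S)
    have hfi0 := hf0 i (Finset.mem_insert_self i S)
    simp only [Finset.prod_insert hi, Finset.sum_insert hi]
    refine ⟨fun w hw => (hfi w hw).mul (h1 w hw), exists_mul_ne_zero hfi h1 hfi0 h2, fun z => ?_⟩
    rw [degAt_mul hfi h1 hfi0 h2, h3]

/-- Behaviour of degree and homogeneous part under rescaling of the germ. -/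
theorem degAt_homPart_of_scaling {f : CSp d → ℂ} (hf : AnalyticOnNhd ℂ f univ)
    (h0 : ∃ w, f w ≠ 0) {z z' : CSp d} {a b : ℂ} (ha : a ≠ 0) (hb : b ≠ 0)
    (h : ∀ w, f (z' + w) = a * f (z + b • w)) :
    degAt f z' = degAt f z ∧
      homPart f z' = fun w => a * homPart f z (b • w) := by
  refine degAt_homPart_unique hf ?_ fun w => ?_
  · obtain ⟨w, hw⟩ := exists_homPart_ne_zero hf h0 z
    refine ⟨b⁻¹ • w, mul_ne_zero ha ?_⟩
    rwa [smul_inv_smul₀ hb]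
  · refine ((tendsto_scaled hf z (b • w)).const_mul a).congr fun ρ => ?_
    rw [h, smul_comm, mul_div_assoc]

/-! ### Real and imaginary parts in `ℂ^d` -/

@[simp] theorem cx_apply (x : RSp d) (i : Fin d) : cx x i = (x i : ℂ) := rfl

theorem cx_smul (c : ℝ) (x : RSp d) : cx (c • x) = (c : ℂ) • cx x := by
  ext i; simp

@[simp] theorem cx_zero : cx (0 : RSp d) = 0 := by
  ext i; simp

theorem continuous_cx : Continuous (cx : RSp d → CSp d) := by
  unfold cx
  refine (PiLp.continuous_toLp 2 _).comp (continuous_pi fun i => ?_)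
  fun_prop

@[fun_prop] theorem Continuous.cx {X : Type*} [TopologicalSpace X] {f : X → RSp d}
    (hf : Continuous f) : Continuous fun x => LocProj.cx (f x) := continuous_cx.comp hf

@[simp] theorem pt_apply (x y : RSp d) (i : Fin d) : pt x y i = (x i : ℂ) + Complex.I * y i := by
  simp [pt]

theorem pt_add (a b a' b' : RSp d) : pt (a + a') (b + b') = pt a b + pt a' b' := by
  ext i; simp; ring

theorem smul_pt (c : ℝ) (a b : RSp d) : (c : ℂ) • pt a b = pt (c • a) (c • b) := by
  ext i; simp; ring

theorem smul_cx (t : ℂ) (v : RSp d) : t • cx v = pt (t.re • v) (t.im • v) := by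
  ext i
  simp only [PiLp.smul_apply, cx_apply, smul_eq_mul, pt_apply, Complex.ofReal_mul]
  conv_lhs => rw [← Complex.re_add_im t]
  ring

@[simp] theorem pt_zero_right (a : RSp d) : pt a 0 = cx a := by
  ext i; simp

@[simp] theorem pt_zero_left (b : RSp d) : pt 0 b = Complex.I • cx b := by
  ext i; simp

theorem continuous_pt : Continuous fun p : RSp d × RSp d => pt p.1 p.2 := by
  unfold pt
  fun_prop

@[fun_prop] theorem Continuous.pt {X : Type*} [TopologicalSpace X] {f g : X → RSp d}
    (hf : Continuous f) (hg : Continuous g) : Continuous fun x => LocProj.pt (f x) (g x) :=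
  continuous_pt.comp (hf.prodMk hg)

theorem le_of_sq_le {a b : ℝ} (h : a ^ 2 ≤ b ^ 2) (hb : 0 ≤ b) : a ≤ b :=
  (abs_le_of_sq_le_sq' h hb).2

theorem norm_pt_sq (a b : RSp d) : ‖pt a b‖ ^ 2 = ‖a‖ ^ 2 + ‖b‖ ^ 2 := by
  rw [EuclideanSpace.norm_sq_eq, EuclideanSpace.norm_sq_eq, EuclideanSpace.norm_sq_eq,
    ← Finset.sum_add_distrib]
  refine Finset.sum_congr rfl fun i _ => ?_
  rw [pt_apply, Complex.sq_norm, Complex.normSq_apply]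
  simp [sq_abs]
  ring

theorem norm_le_norm_pt_left (a b : RSp d) : ‖a‖ ≤ ‖pt a b‖ := by
  refine le_of_sq_le ?_ (norm_nonneg _)
  rw [norm_pt_sq]; nlinarith [sq_nonneg ‖b‖]

theorem norm_le_norm_pt_right (a b : RSp d) : ‖b‖ ≤ ‖pt a b‖ := by
  refine le_of_sq_le ?_ (norm_nonneg _)
  rw [norm_pt_sq]; nlinarith [sq_nonneg ‖a‖]

theorem norm_pt_le (a b : RSp d) : ‖pt a b‖ ≤ ‖a‖ + ‖b‖ := by
  refine le_of_sq_le ?_ (by positivity)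
  rw [norm_pt_sq]; nlinarith [norm_nonneg a, norm_nonneg b]

/-- Every point of `ℂ^d` splits into real and imaginary parts, continuously. -/
theorem exists_pt_eq (ξ : CSp d) : ∃ a b : RSp d, ξ = pt a b := by
  refine ⟨WithLp.toLp 2 fun i => (ξ i).re, WithLp.toLp 2 fun i => (ξ i).im, ?_⟩
  ext i
  simp only [pt_apply]
  rw [mul_comm]
  exact (Complex.re_add_im _).symm

/-! ### Hurwitz's theorem and zeros in half-discs -/

/-- Hurwitz's theorem: zeros of a nonzero holomorphic function persist under small perturbation. -/
theorem eventually_exists_zero {P : Type*} [TopologicalSpace P] {h : P → ℂ → ℂ}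
    (hc : Continuous fun q : P × ℂ => h q.1 q.2) (hol : ∀ p, Differentiable ℂ (h p)) {p₀ : P}
    {t₀ : ℂ} (h0 : h p₀ t₀ = 0) (hne : ∃ t, h p₀ t ≠ 0) {U : Set ℂ} (hU : U ∈ 𝓝 t₀) :
    ∀ᶠ p in 𝓝 p₀, ∃ t ∈ U, h p t = 0 := by
  have han : AnalyticOnNhd ℂ (h p₀) univ := fun t _ => (hol p₀).analyticAt t
  have hiso : ∀ᶠ t in 𝓝[≠] t₀, h p₀ t ≠ 0 := by
    rcases (han t₀ (mem_univ _)).eventually_eq_zero_or_eventually_ne_zero with h1 | h1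
    · obtain ⟨t, ht⟩ := hne
      exact absurd (congrFun (han.eq_of_eventuallyEq (g := 0) (fun _ _ => analyticAt_const) h1) t)
        ht
    · exact h1
  rw [eventually_nhdsWithin_iff] at hiso
  obtain ⟨δ, hδ, hδU⟩ := Metric.eventually_nhds_iff.1 (hiso.and hU)
  have hsph : ∀ t ∈ Metric.sphere t₀ (δ / 2), h p₀ t ≠ 0 := by
    intro t ht
    rw [Metric.mem_sphere] at ht
    refine (hδU (by linarith)).1 ?_
    rintro rfl
    rw [dist_self] at ht
    linarith
  have hcpt : IsCompact (Metric.sphere t₀ (δ / 2)) := isCompact_sphere _ _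
  have hcont : Continuous (h p₀) := (hol p₀).continuous
  obtain ⟨c, hcpos, hcmin⟩ : ∃ c > 0, ∀ t ∈ Metric.sphere t₀ (δ / 2), c ≤ ‖h p₀ t‖ := by
    obtain ⟨t₁, ht₁, hmin⟩ := hcpt.exists_isMinOn
      (NormedSpace.sphere_nonempty.2 (by positivity)) hcont.norm.continuousOn
    exact ⟨‖h p₀ t₁‖, norm_pos_iff.2 (hsph t₁ ht₁), fun t ht => hmin ht⟩
  have e1 : ∀ᶠ p in 𝓝 p₀, ∀ t ∈ Metric.sphere t₀ (δ / 2), c / 2 < ‖h p t‖ := by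
    refine hcpt.eventually_forall_of_forall_eventually fun t ht => ?_
    refine (hc.norm.tendsto (p₀, t)).eventually (lt_mem_nhds ?_)
    have := hcmin t ht
    simp only
    linarith
  have e2 : ∀ᶠ p in 𝓝 p₀, ‖h p t₀‖ < c / 2 := by
    have : Continuous fun p => ‖h p t₀‖ := (hc.comp (by fun_prop : Continuous fun p => (p, t₀))).norm
    refine (this.tendsto p₀).eventually (gt_mem_nhds ?_)
    rw [h0, norm_zero]
    positivity
  -- without zeros in the disc, the maximum principle for `1 / h p` bounds `1 / |h p t₀|` by `2 / c`
  filter_upwards [e1, e2] with p h1 h2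
  by_contra! hno
  have hball : ∀ t ∈ Metric.closedBall t₀ (δ / 2), h p t ≠ 0 := by
    intro t ht
    rw [Metric.mem_closedBall] at ht
    exact hno t (hδU (by linarith)).2
  have hδ2 : δ / 2 ≠ 0 := by positivity
  have hd : DiffContOnCl ℂ (fun t => (h p t)⁻¹) (Metric.ball t₀ (δ / 2)) := by
    refine (hol p).diffContOnCl.inv fun t ht => hball t ?_
    rwa [closure_ball _ hδ2] at ht
  have hle := Complex.norm_le_of_forall_mem_frontier_norm_le Metric.isBounded_ball hd
    (C := (c / 2)⁻¹) (fun t ht => by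
      rw [frontier_ball _ hδ2] at ht
      rw [norm_inv]
      exact inv_anti₀ (by positivity) (h1 t ht).le)
    (subset_closure (Metric.mem_ball_self (by positivity : 0 < δ / 2)))
  rw [norm_inv, inv_le_inv₀ (norm_pos_iff.2 (hball t₀ (Metric.mem_closedBall_self (by positivity))))
    (by positivity)] at hle
  linarith

/-- If a connected family of entire functions has no zeros on the boundary of a half-disc, and some
member has none inside it, then no member has a zero inside it: the zeros cannot enter. -/
theorem no_zero_halfDisc {P : Type*} [TopologicalSpace P] [PreconnectedSpace P] {h : P → ℂ → ℂ}
    (hc : Continuous fun q : P × ℂ => h q.1 q.2) (hol : ∀ p, Differentiable ℂ (h p)) {R : ℝ}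
    (hR : 0 < R)
    (ha : ∀ p t, ‖t‖ ≤ R → t.re = 0 → h p t ≠ 0) (hb : ∀ p t, ‖t‖ = R → 0 ≤ t.re → h p t ≠ 0)
    (p₀ : P) (h0 : ∀ t, ‖t‖ ≤ R → 0 ≤ t.re → h p₀ t ≠ 0) :
    ∀ p t, ‖t‖ ≤ R → 0 ≤ t.re → h p t ≠ 0 := by
  let S : Set P := {p | ∃ t, ‖t‖ ≤ R ∧ 0 ≤ t.re ∧ h p t = 0}
  have hK : IsCompact {t : ℂ | ‖t‖ ≤ R ∧ 0 ≤ t.re} := by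
    have : {t : ℂ | ‖t‖ ≤ R ∧ 0 ≤ t.re} = Metric.closedBall 0 R ∩ {t | 0 ≤ t.re} := by
      ext t; simp
    rw [this]
    exact (isCompact_closedBall _ _).inter_right (isClosed_le continuous_const Complex.continuous_re)
  -- the set `S` of parameters with a zero in the half-disc is closed by compactness and open by
  -- Hurwitz's theorem
  have hclosed : IsClosed S := by
    rw [← isOpen_compl_iff, isOpen_iff_mem_nhds]
    intro p hp
    have hp' : ∀ t ∈ {t : ℂ | ‖t‖ ≤ R ∧ 0 ≤ t.re}, ∀ᶠ q : P × ℂ in 𝓝 p ×ˢ 𝓝 t, h q.1 q.2 ≠ 0 := by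
      intro t ht
      rw [← nhds_prod_eq]
      refine (hc.tendsto (p, t)).eventually_ne fun h1 => hp ⟨t, ht.1, ht.2, h1⟩
    have := hK.eventually_forall_of_forall_eventually (P := fun q t => h q t ≠ 0) (x₀ := p)
      (fun t ht => by simpa [nhds_prod_eq] using hp' t ht)
    filter_upwards [this] with q hq
    rintro ⟨t, h1, h2, h3⟩
    exact hq t ⟨h1, h2⟩ h3
  have hopen : IsOpen S := by
    rw [isOpen_iff_mem_nhds]
    rintro p ⟨t, h1, h2, h3⟩
    have h1' : ‖t‖ < R := lt_of_le_of_ne h1 fun h => hb p t h h2 h3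
    have h2' : 0 < t.re := lt_of_le_of_ne h2 fun h => ha p t h1 h.symm h3
    have hU : {t : ℂ | ‖t‖ < R ∧ 0 < t.re} ∈ 𝓝 t :=
      ((isOpen_lt continuous_norm continuous_const).inter
        (isOpen_lt continuous_const Complex.continuous_re)).mem_nhds ⟨h1', h2'⟩
    filter_upwards [eventually_exists_zero hc hol h3 ⟨0, ha p 0 (by simpa using hR.le) rfl⟩ hU]
      with q hq
    obtain ⟨t, ⟨h4, h5⟩, h6⟩ := hq
    exact ⟨t, h4.le, h5.le, h6⟩
  intro p t h1 h2 h3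
  rcases isClopen_iff.1 ⟨hclosed, hopen⟩ with h | h
  · have : p ∈ S := ⟨t, h1, h2, h3⟩
    rw [h] at this
    exact this
  · have : p₀ ∈ S := h ▸ mem_univ p₀
    obtain ⟨t, h4, h5, h6⟩ := this
    exact h0 t h4 h5 h6

theorem differentiable_line {f : CSp d → ℂ} (hf : AnalyticOnNhd ℂ f univ) (a b : CSp d) :
    Differentiable ℂ fun t : ℂ => f (a + t • b) := by
  intro t
  have h1 : DifferentiableAt ℂ f (a + t • b) := (hf _ (mem_univ _)).differentiableAt
  exact h1.comp t (f := fun t : ℂ => a + t • b) (by fun_prop)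

/-! ### Local propagation of zero-free tubes -/

/-- If the homogeneous part of `f` at `z` does not vanish on the cone spanned by `u` and `v`, with
complex weights in the closed right half-plane on `v`, then all small such displacements of `z` avoid
the zeros of `f`. -/
theorem exists_free_sector {f : CSp d → ℂ} (hf : AnalyticOnNhd ℂ f univ) {z : CSp d} {u v : RSp d}
    (hA : ∀ (s : ℝ) (t : ℂ), 0 ≤ s → 0 ≤ t.re → (s ≠ 0 ∨ t ≠ 0) →
      homPart f z (cx (s • u) + t • cx v) ≠ 0) :
    ∃ δ > 0, ∀ (s : ℝ) (t : ℂ), 0 ≤ s → 0 ≤ t.re → (s ≠ 0 ∨ t ≠ 0) → s ≤ δ → ‖t‖ ≤ δ →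
      f (z + (cx (s • u) + t • cx v)) ≠ 0 := by
  let Ξ : ℝ × ℂ → CSp d := fun p => cx (p.1 • u) + p.2 • cx v
  have hΞ : Continuous Ξ := by
    have : Continuous fun p : ℝ × ℂ => p.1 • u := by fun_prop
    fun_prop
  let K : Set (ℝ × ℂ) := Metric.sphere 0 1 ∩ {p | 0 ≤ p.1 ∧ 0 ≤ p.2.re}
  have hK : IsCompact K := by
    refine (isCompact_sphere _ _).inter_right ?_
    exact (isClosed_le continuous_const continuous_fst).inter
      (isClosed_le continuous_const (Complex.continuous_re.comp continuous_snd))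
  have hKne : K.Nonempty := ⟨(1, 0), by simp [K]⟩
  obtain ⟨p₁, hp₁, hmin⟩ := hK.exists_isMinOn hKne
    ((continuous_homPart f z).comp hΞ).norm.continuousOn
  obtain ⟨p₂, hp₂, hmax⟩ := hK.exists_isMaxOn hKne hΞ.norm.continuousOn
  have hne : ∀ p : ℝ × ℂ, ‖p‖ = 1 → p.1 ≠ 0 ∨ p.2 ≠ 0 := by
    intro p hp
    by_contra! h
    have : p = 0 := Prod.ext h.1 h.2
    rw [this, norm_zero] at hp
    exact zero_ne_one hp
  -- `c` and `M` bound the homogeneous part from below, and the displacements from above, on the unit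
  -- sphere of weights; homogeneity and the Taylor estimate extend this to all small weights
  set c := ‖homPart f z (Ξ p₁)‖ with hcdef
  have hc : 0 < c := norm_pos_iff.2
    (hA p₁.1 p₁.2 hp₁.2.1 hp₁.2.2 (hne p₁ (by simpa using hp₁.1)))
  set M := ‖Ξ p₂‖ + 1 with hMdef
  have hM : 0 < M := by positivity
  obtain ⟨R, hR, C, hC, H⟩ := exists_scaled_taylor_bound hf z
  have hMp : 0 < M ^ (degAt f z + 1) := by positivity
  set δ := min (R / M) (c / (2 * (C * M ^ (degAt f z + 1))))
  refine ⟨δ, by positivity, fun s t hs ht hst hsδ htδ h0 => ?_⟩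
  let l : ℝ := ‖((s, t) : ℝ × ℂ)‖
  have hl : 0 < l := norm_pos_iff.2 fun h => by
    rw [Prod.mk_eq_zero] at h
    tauto
  have hlδ : l ≤ δ := by
    refine max_le ?_ htδ
    rwa [Real.norm_of_nonneg hs]
  let p : ℝ × ℂ := l⁻¹ • ((s, t) : ℝ × ℂ)
  have hp : p ∈ K := by
    refine ⟨?_, ?_, ?_⟩
    · rw [mem_sphere_zero_iff_norm, norm_smul, norm_inv, Real.norm_of_nonneg hl.le]
      exact inv_mul_cancel₀ hl.ne'
    · exact mul_nonneg (by positivity) hs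
    · simp only [p, Prod.smul_mk, Complex.smul_re, smul_eq_mul]
      positivity
  have hpΞ : cx (s • u) + t • cx v = (l : ℂ) • Ξ p := by
    have hl' : (l : ℂ) ≠ 0 := by exact_mod_cast hl.ne'
    simp only [Ξ, p, Prod.smul_mk, smul_add, cx_smul, smul_eq_mul, Complex.ofReal_mul,
      Complex.ofReal_inv, Complex.real_smul, ← mul_smul]
    rw [mul_inv_cancel_left₀ hl', mul_inv_cancel_left₀ hl']
  have hpM : ‖Ξ p‖ ≤ M := (hmax hp).trans (by simp [hMdef])
  have h1 := H (l : ℂ) (Ξ p) (by exact_mod_cast hl.ne') (by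
    rw [Complex.norm_real, Real.norm_of_nonneg hl.le]
    calc l * ‖Ξ p‖ ≤ (R / M) * M := by gcongr; exact hlδ.trans (min_le_left _ _)
      _ = R := by field_simp)
  rw [← hpΞ, h0, zero_div, zero_sub, norm_neg, Complex.norm_real, Real.norm_of_nonneg hl.le] at h1
  have h2 : c ≤ ‖homPart f z (Ξ p)‖ := hmin hp
  have h3 : C * l * ‖Ξ p‖ ^ (degAt f z + 1) ≤ c / 2 := by
    calc C * l * ‖Ξ p‖ ^ (degAt f z + 1)
        ≤ C * (c / (2 * (C * M ^ (degAt f z + 1)))) * M ^ (degAt f z + 1) := by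
          gcongr
          exact hlδ.trans (min_le_right _ _)
      _ = c / 2 := by field_simp
  linarith

/-- Local propagation of zero-free tubes, for a family `F ρ` with `ρ ≥ 0`. In the parameters `ρ`, `y`,
`s` and `v'`, which form a connected set, the functions `t ↦ F ρ (z + s u + i y + t v')` have no zeros
on the boundary of a fixed half-disc: on the diameter, `t` is imaginary and the point stays in the
tube over `s u`; on the half-circle, the function is close to its limit for `s = y = 0`. For small
`s` and `y = 0` there is no zero inside either, so zeros never enter. -/
theorem localFree_family {F : ℝ → CSp d → ℂ}
    (hFc : ContinuousOn (fun q : ℝ × CSp d => F q.1 q.2) (Ici 0 ×ˢ univ))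
    (hFa : ∀ ρ, 0 ≤ ρ → AnalyticOnNhd ℂ (F ρ) univ) {z : CSp d} {u v : RSp d} {δ : ℝ} (hδ : 0 < δ)
    (htube : ∀ ρ ∈ Ico 0 δ, ∀ s ∈ Ioo 0 δ, ∀ y : RSp d, ‖y‖ < δ → F ρ (z + pt (s • u) y) ≠ 0)
    (hA : ∀ (s : ℝ) (t : ℂ), 0 ≤ s → 0 ≤ t.re → (s ≠ 0 ∨ t ≠ 0) →
      homPart (F 0) z (cx (s • u) + t • cx v) ≠ 0) :
    ∃ δ' > 0, ∀ ρ ∈ Ico 0 δ', ∀ y : RSp d, ‖y‖ < δ' → ∀ v' ∈ Metric.ball v δ', ∀ s ∈ Ioo 0 δ',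
      ∀ t : ℂ, ‖t‖ ≤ δ' → 0 ≤ t.re → F ρ (z + pt (s • u) y + t • cx v') ≠ 0 := by
  obtain ⟨δ₁, hδ₁, hsec⟩ := exists_free_sector (hFa 0 le_rfl) hA
  set R := min δ₁ (δ / (2 * (‖v‖ + 1))) with hRdef
  have hR : 0 < R := by positivity
  let Θ : (ℝ × RSp d × ℝ × RSp d) × ℂ → ℝ × CSp d := fun q =>
    (q.1.1, z + pt (q.1.2.2.1 • u) q.1.2.1 + q.2 • cx q.1.2.2.2)
  have hΘ : Continuous Θ := by
    have : Continuous fun q : (ℝ × RSp d × ℝ × RSp d) × ℂ => q.1.2.2.1 • u := by fun_prop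
    fun_prop
  let S : Set (ℝ × RSp d × ℝ × RSp d) := Ici (0 : ℝ) ×ˢ univ
  have hcontS : ContinuousOn (fun q : (ℝ × RSp d × ℝ × RSp d) × ℂ => F (Θ q).1 (Θ q).2) (S ×ˢ univ) :=
    hFc.comp hΘ.continuousOn fun q hq => ⟨hq.1.1, mem_univ _⟩
  -- on the boundary half-circle, parameters near `(0, 0, 0, v)` give no zeros
  let p₁ : ℝ × RSp d × ℝ × RSp d := (0, 0, 0, v)
  have hK : IsCompact {t : ℂ | ‖t‖ = R ∧ 0 ≤ t.re} := by
    have : {t : ℂ | ‖t‖ = R ∧ 0 ≤ t.re} = Metric.sphere 0 R ∩ {t | 0 ≤ t.re} := by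
      ext t; simp
    rw [this]
    exact (isCompact_sphere _ _).inter_right (isClosed_le continuous_const Complex.continuous_re)
  have hp₁S : p₁ ∈ S := ⟨by simp [p₁], mem_univ _⟩
  have hbd : ∀ᶠ p in 𝓝 p₁, ∀ t ∈ {t : ℂ | ‖t‖ = R ∧ 0 ≤ t.re}, p ∈ S → F (Θ (p, t)).1 (Θ (p, t)).2 ≠ 0 := by
    refine hK.eventually_forall_of_forall_eventually fun t ht => ?_
    have h1 : ContinuousWithinAt (fun q : (ℝ × RSp d × ℝ × RSp d) × ℂ => F (Θ q).1 (Θ q).2) (S ×ˢ univ) (p₁, t) :=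
      hcontS _ ⟨hp₁S, mem_univ _⟩
    have h2 : F (Θ (p₁, t)).1 (Θ (p₁, t)).2 ≠ 0 := by
      have ht0 : t ≠ 0 := by
        rintro rfl
        have := ht.1
        rw [norm_zero] at this
        exact hR.ne this
      have := hsec 0 t le_rfl ht.2 (Or.inr ht0) hδ₁.le (ht.1.le.trans (min_le_left _ _))
      simpa [Θ, p₁] using this
    have h3 := h1.eventually_ne h2
    rw [eventually_nhdsWithin_iff] at h3
    filter_upwards [h3] with q hq hqS
    exact hq ⟨hqS, mem_univ _⟩
  obtain ⟨δ₂, hδ₂, hbd⟩ := Metric.eventually_nhds_iff.1 hbd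
  set η := min (min (δ / 2) δ₂) (min δ₁ (min R 1)) with hηdef
  have hη : 0 < η := by positivity
  have hη1 : η ≤ δ / 2 := (min_le_left _ _).trans (min_le_left _ _)
  have hη2 : η ≤ δ₂ := (min_le_left _ _).trans (min_le_right _ _)
  have hη3 : η ≤ δ₁ := (min_le_right _ _).trans (min_le_left _ _)
  have hη4 : η ≤ R := (min_le_right _ _).trans ((min_le_right _ _).trans (min_le_left _ _))
  have hη5 : η ≤ 1 := (min_le_right _ _).trans ((min_le_right _ _).trans (min_le_right _ _))
  let T : Set (ℝ × RSp d × ℝ × RSp d) := Ico 0 η ×ˢ Metric.ball 0 η ×ˢ Ioo 0 η ×ˢ Metric.ball v η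
  have hT : IsPreconnected T :=
    ((convex_Ico 0 η).prod ((convex_ball 0 η).prod
      ((convex_Ioo 0 η).prod (convex_ball v η)))).isPreconnected
  have : PreconnectedSpace T := isPreconnected_iff_preconnectedSpace.1 hT
  let h : T → ℂ → ℂ := fun p t => F (Θ (p, t)).1 (Θ (p, t)).2
  -- the goals: continuity, holomorphy, the diameter, the half-circle, and one zero-free parameter
  have key := no_zero_halfDisc (h := h) ?_ ?_ hR ?_ ?_
    ⟨(0, 0, η / 2, v), ⟨⟨le_rfl, hη⟩, Metric.mem_ball_self hη, ⟨by positivity, by linarith⟩,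
      Metric.mem_ball_self hη⟩⟩ ?_
  · refine ⟨η, hη, fun ρ hρ y hy v' hv' s hs t ht htre => ?_⟩
    exact key ⟨(ρ, y, s, v'), ⟨hρ, by simpa using hy, hs, hv'⟩⟩ t (ht.trans hη4) htre
  · have hmap : Continuous fun q : T × ℂ => ((q.1 : ℝ × RSp d × ℝ × RSp d), q.2) := by fun_prop
    exact hcontS.comp_continuous hmap fun q => ⟨⟨q.1.2.1.1, mem_univ _⟩, mem_univ _⟩
  · intro p
    exact differentiable_line (hFa _ p.2.1.1) (z + pt (p.1.2.2.1 • u) p.1.2.1) (cx p.1.2.2.2)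
  · rintro ⟨⟨ρ, y, s, v'⟩, hρ, hy, hs, hv'⟩ t ht htre
    have hv'n : ‖v'‖ ≤ ‖v‖ + 1 := by
      have h1 : dist v' v < η := hv'
      rw [dist_eq_norm] at h1
      have h2 := norm_sub_norm_le v' v
      linarith
    have hy' : ‖y + t.im • v'‖ < δ := by
      have h1 : ‖y‖ < η := by simpa using hy
      have h2 : ‖t.im • v'‖ ≤ δ / 2 := by
        rw [norm_smul]
        calc ‖t.im‖ * ‖v'‖ ≤ R * (‖v‖ + 1) := by
              gcongr
              exact (Complex.abs_im_le_norm t).trans ht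
          _ ≤ (δ / (2 * (‖v‖ + 1))) * (‖v‖ + 1) := by gcongr; exact min_le_right _ _
          _ = δ / 2 := by field_simp
      have := norm_add_le y (t.im • v')
      linarith
    have := htube ρ ⟨hρ.1, by linarith [hρ.2]⟩ s ⟨hs.1, by linarith [hs.2]⟩ _ hy'
    have e : z + pt (s • u) y + t • cx v' = z + pt (s • u) (y + t.im • v') := by
      rw [smul_cx, htre, zero_smul, add_assoc, ← pt_add, add_zero]
    simpa only [h, Θ, e] using this
  · rintro ⟨⟨ρ, y, s, v'⟩, hρ, hy, hs, hv'⟩ t ht htre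
    refine hbd (y := (ρ, y, s, v')) ?_ t ⟨ht, htre⟩ ⟨hρ.1, mem_univ _⟩
    simp only [p₁]
    have h2 : dist y 0 < η := hy
    have h3 : dist v' v < η := hv'
    have h1 : dist ρ 0 < η := by rw [Real.dist_0_eq_abs, abs_of_nonneg hρ.1]; exact hρ.2
    have h4 : dist s 0 < η := by rw [Real.dist_0_eq_abs, abs_of_nonneg hs.1.le]; exact hs.2
    exact max_lt (by linarith) (max_lt (by linarith) (max_lt (by linarith) (by linarith)))
  · intro t ht htre
    have := hsec (η / 2) t (by positivity) htre (Or.inl (by positivity)) (by linarith)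
      (ht.trans (min_le_left _ _))
    simpa only [h, Θ, pt_zero_right, add_assoc] using this

/-! ### Directions and cones of hyperbolicity -/

/-- Hyperbolicity in the direction `v` means that the tube over `v` contains no zeros: multiplication
by `i` exchanges both conditions. -/
theorem hypDirs_iff {A : CSp d → ℂ} {m : ℕ} (hA : ∀ (c : ℂ) w, A (c • w) = c ^ m * A w)
    (v : RSp d) : v ∈ hypDirs A ↔ ∀ y, A (pt v y) ≠ 0 := by
  constructor
  · rintro ⟨-, h2⟩ y h0
    have h3 : A (cx y + (-Complex.I) • cx v) = 0 := by
      have : cx y + (-Complex.I) • cx v = (-Complex.I) • pt v y := by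
        ext i; simp; ring_nf; simp
      rw [this, hA, h0, mul_zero]
    simpa using h2 y _ h3
  · intro h
    refine ⟨by simpa using h 0, fun y t ht => ?_⟩
    by_contra hb
    have hb' : (t.im : ℂ) ≠ 0 := by exact_mod_cast hb
    have e : cx y + t • cx v
        = (Complex.I * t.im) • pt v ((-(t.im)⁻¹) • (y + t.re • v)) := by
      ext i
      simp only [PiLp.add_apply, PiLp.smul_apply, cx_apply, smul_eq_mul, pt_apply,
        Complex.ofReal_mul, Complex.ofReal_add, Complex.ofReal_neg, Complex.ofReal_inv]
      have := Complex.re_add_im t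
      field_simp
      ring_nf
      rw [Complex.I_sq]
      conv_lhs => rw [← this]
      ring
    rw [e, hA] at ht
    exact (mul_ne_zero (pow_ne_zero _ (mul_ne_zero Complex.I_ne_zero hb')) (h _)) ht

theorem hypDirs_const_mul {A : CSp d → ℂ} {a : ℂ} (ha : a ≠ 0) :
    hypDirs (fun w => a * A w) = hypDirs A := by
  simp [hypDirs, ha]

theorem hypDirs_smul_mem {A : CSp d → ℂ} {m : ℕ} (hA : ∀ (c : ℂ) w, A (c • w) = c ^ m * A w)
    {v : RSp d} (hv : v ∈ hypDirs A) {c : ℝ} (hc : 0 < c) : c • v ∈ hypDirs A := by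
  rw [hypDirs_iff hA] at hv ⊢
  intro y
  have e : pt (c • v) y = (c : ℂ) • pt v (c⁻¹ • y) := by
    rw [smul_pt, smul_inv_smul₀ hc.ne']
  rw [e, hA]
  exact mul_ne_zero (pow_ne_zero _ (by exact_mod_cast hc.ne')) (hv _)

/-- The components of the real parts of zero-free vertical tubes of an entire function are convex
(a case of Bochner's tube theorem): the points whose segment to `v₀` stays in the component form a
relatively closed set by Hurwitz's theorem. -/
theorem convex_tube_component {f : CSp d → ℂ} (hf : AnalyticOnNhd ℂ f univ) {D : Set (RSp d)}
    (hD : ∀ a, a ∈ D ↔ ∀ b, f (pt a b) ≠ 0) (hDo : IsOpen D) (x : RSp d) :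
    Convex ℝ (connectedComponentIn D x) := by
  set C := connectedComponentIn D x with hC
  have hCo : IsOpen C := hDo.connectedComponentIn
  have hCD : C ⊆ D := connectedComponentIn_subset _ _
  rw [convex_iff_segment_subset]
  intro v₀ h₀
  let S : Set (RSp d) := {v | segment ℝ v₀ v ⊆ C}
  have hseg : ∀ v, segment ℝ v₀ v ⊆ D → segment ℝ v₀ v ⊆ C := by
    intro v hv
    have h1 := (convex_segment v₀ v).isPreconnected.subset_connectedComponentIn
      (left_mem_segment ℝ v₀ v) hv
    rwa [← connectedComponentIn_eq h₀] at h1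
  have hSo : IsOpen S := by
    rw [isOpen_iff_mem_nhds]
    intro v hv
    have h1 : ∀ᶠ w in 𝓝 v, ∀ τ ∈ Icc (0 : ℝ) 1, (1 - τ) • v₀ + τ • w ∈ C := by
      refine isCompact_Icc.eventually_forall_of_forall_eventually fun τ hτ => ?_
      have hc : Continuous fun q : RSp d × ℝ => (1 - q.2) • v₀ + q.2 • q.1 := by fun_prop
      refine (hc.tendsto (v, τ)).eventually (hCo.mem_nhds (hv ?_))
      exact ⟨1 - τ, τ, by linarith [hτ.2], hτ.1, by ring, rfl⟩
    filter_upwards [h1] with w hw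
    rintro p ⟨a, b, ha, hb, hab, rfl⟩
    have := hw b ⟨hb, by linarith⟩
    rwa [← hab, add_sub_cancel_right] at this
  have hpre : IsPreconnected C := isPreconnected_connectedComponentIn
  have hsub : C ⊆ S := by
    refine hpre.subset_of_closure_inter_subset hSo ⟨v₀, h₀, ?_⟩ ?_
    · change segment ℝ v₀ v₀ ⊆ C
      simpa [segment_same] using h₀
    rintro v₁ ⟨hcl, h₁⟩
    refine hseg v₁ ?_
    rintro p ⟨a, τ, ha, hτ, haτ, rfl⟩
    by_contra hp
    rw [hD] at hp
    push Not at hp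
    obtain ⟨b, hb⟩ := hp
    have ha' : a = 1 - τ := by linarith
    subst ha'
    have hτ0 : τ ≠ 0 := by
      rintro rfl
      simp only [sub_zero, one_smul, zero_smul, add_zero] at hb
      exact (hD _).1 (hCD h₀) b hb
    have hτ1 : τ ≠ 1 := by
      rintro rfl
      simp only [sub_self, one_smul, zero_smul, zero_add] at hb
      exact (hD _).1 (hCD h₁) b hb
    -- a zero over an interior point of the segment from `v₀` to `v₁` persists, as a zero over an interior
    -- point of the segment from `v₀` to `w`, for `w` near `v₁`; this contradicts `w ∈ S`
    let h : RSp d → ℂ → ℂ := fun w t => f (pt v₀ b + t • cx (w - v₀))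
    have hpt : ∀ w (t : ℂ), pt v₀ b + t • cx (w - v₀)
        = pt ((1 - t.re) • v₀ + t.re • w) (b + t.im • (w - v₀)) := by
      intro w t
      rw [smul_cx, ← pt_add]
      congr 1
      module
    have hc : Continuous fun q : RSp d × ℂ => h q.1 q.2 := by
      have hfc : Continuous f :=
        continuous_iff_continuousAt.2 fun w => (hf w (mem_univ w)).continuousAt
      exact hfc.comp (by fun_prop)
    have h0 : h v₁ (τ : ℂ) = 0 := by
      simp only [h, hpt]
      simpa using hb
    have hne : ∃ t, h v₁ t ≠ 0 := ⟨0, by simpa [h] using (hD _).1 (hCD h₀) b⟩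
    have hU : {t : ℂ | 0 < t.re ∧ t.re < 1} ∈ 𝓝 (τ : ℂ) :=
      ((isOpen_lt continuous_const Complex.continuous_re).inter
        (isOpen_lt Complex.continuous_re continuous_const)).mem_nhds
        ⟨by simpa using lt_of_le_of_ne hτ (Ne.symm hτ0),
          by simpa using lt_of_le_of_ne (by linarith) hτ1⟩
    have hev := eventually_exists_zero hc (fun w => differentiable_line hf _ _) h0 hne hU
    obtain ⟨w, hwS, t, ⟨ht0, ht1⟩, hz⟩ :=
      ((mem_closure_iff_frequently.1 hcl).and_eventually hev).exists
    simp only [h, hpt] at hz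
    exact (hD _).1 (hCD (hwS ⟨1 - t.re, t.re, by linarith, by linarith, by ring, rfl⟩)) _ hz
  exact fun v₁ h₁ => hsub h₁

/-- The homogeneous function `A` is its own homogeneous part at the origin. -/
theorem homPart_zero_of_homogeneous {A : CSp d → ℂ} {m : ℕ} (hAa : AnalyticOnNhd ℂ A univ)
    (hA : ∀ (c : ℂ) w, A (c • w) = c ^ m * A w) (h0 : ∃ w, A w ≠ 0) : homPart A 0 = A := by
  refine (degAt_homPart_unique (n := m) hAa h0 fun w => ?_).2
  refine tendsto_const_nhds.congr' ?_
  filter_upwards [self_mem_nhdsWithin] with ρ hρ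
  have : (ρ : ℂ) ≠ 0 := by exact_mod_cast (ne_of_gt hρ : ρ ≠ 0)
  rw [zero_add, hA, mul_div_cancel_left₀ _ (pow_ne_zero _ this)]

/-- Gårding: the directions of hyperbolicity of a homogeneous function form an open set. -/
theorem isOpen_hypDirs {A : CSp d → ℂ} {m : ℕ} (hAa : AnalyticOnNhd ℂ A univ)
    (hA : ∀ (c : ℂ) w, A (c • w) = c ^ m * A w) : IsOpen (hypDirs A) := by
  rw [isOpen_iff_mem_nhds]
  intro u hu
  have hu' := (hypDirs_iff hA u).1 hu
  have h0 : ∃ w, A w ≠ 0 := ⟨_, hu' 0⟩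
  have hcont : Continuous A :=
    continuous_iff_continuousAt.2 fun w => (hAa w (mem_univ w)).continuousAt
  obtain ⟨δ, hδ, H⟩ := localFree_family (F := fun _ => A) (z := 0) (u := u) (v := u)
    (hcont.comp continuous_snd).continuousOn (fun _ _ => hAa) one_pos
    (fun _ _ s hs y _ => by
      rw [zero_add]
      exact (hypDirs_iff hA _).1 (hypDirs_smul_mem hA hu hs.1) y)
    (fun s t hs ht hst => by
      rw [homPart_zero_of_homogeneous hAa hA h0, cx_smul, ← add_smul, hA]
      refine mul_ne_zero (pow_ne_zero _ fun h => ?_) (by simpa using hu' 0)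
      have hre := congrArg Complex.re h
      have him := congrArg Complex.im h
      simp only [Complex.add_re, Complex.ofReal_re, Complex.zero_re, Complex.add_im,
        Complex.ofReal_im, Complex.zero_im, zero_add] at hre him
      have h1 : s = 0 := by linarith
      have h2 : t = 0 := Complex.ext (by rw [Complex.zero_re]; linarith) (by simpa using him)
      tauto)
  filter_upwards [Metric.ball_mem_nhds u (half_pos hδ)] with u' hu''
  -- the direction `u'` is half of `u + (2 u' - u)`, and `2 u' - u` is close to `u`; by homogeneity it
  -- suffices to consider small multiples of `u' + i y`
  rw [hypDirs_iff hA]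
  intro y
  set s := δ / (4 * (‖y‖ + 1)) with hs
  have hs0 : 0 < s := by positivity
  have hs1 : s * (‖y‖ + 1) = δ / 4 := by rw [hs]; field_simp
  have hs2 : s ≤ δ / 4 := by
    rw [← hs1]
    exact le_mul_of_one_le_right hs0.le (by linarith [norm_nonneg y])
  have := H 0 ⟨le_rfl, hδ⟩ ((2 * s) • y) (by
      rw [norm_smul, Real.norm_of_nonneg (by positivity)]
      nlinarith) ((2 : ℝ) • u' - u) (by
      rw [Metric.mem_ball, dist_eq_norm] at hu'' ⊢
      have e : (2 : ℝ) • u' - u - u = (2 : ℝ) • (u' - u) := by module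
      rw [e, norm_smul, Real.norm_of_nonneg zero_le_two]
      linarith) s ⟨hs0, by linarith⟩ (s : ℂ) (by
      rw [Complex.norm_real, Real.norm_of_nonneg hs0.le]; linarith) (by simpa using hs0.le)
  have e : 0 + pt (s • u) ((2 * s) • y) + (s : ℂ) • cx ((2 : ℝ) • u' - u)
      = ((2 * s : ℝ) : ℂ) • pt u' y := by
    rw [smul_pt, zero_add, ← cx_smul, ← pt_zero_right, ← pt_add]
    congr 1
    · module
    · simp
  simp only [e, hA] at this
  exact (mul_ne_zero_iff.1 this).2

theorem connectedComponentIn_hypDirs_smul_mem {A : CSp d → ℂ} {m : ℕ}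
    (hA : ∀ (c : ℂ) w, A (c • w) = c ^ m * A w) {u v : RSp d}
    (hv : v ∈ connectedComponentIn (hypDirs A) u) {c : ℝ} (hc : 0 < c) :
    c • v ∈ connectedComponentIn (hypDirs A) u := by
  have hvD := connectedComponentIn_subset _ _ hv
  have h1 : segment ℝ v (c • v) ⊆ hypDirs A := by
    rintro p ⟨a, b, ha, hb, hab, rfl⟩
    have e : a • v + b • c • v = (a + b * c) • v := by module
    rw [e]
    refine hypDirs_smul_mem hA hvD ?_
    rcases ha.eq_or_lt with h | h
    · have : b = 1 := by linarith
      rw [← h, this]; linarith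
    · positivity
  have h2 := (convex_segment v (c • v)).isPreconnected.subset_connectedComponentIn
    (left_mem_segment ℝ v _) h1
  rw [← connectedComponentIn_eq hv] at h2
  exact h2 (right_mem_segment ℝ v _)

section HypCone

variable {A : CSp d → ℂ} {m : ℕ} {C : Set (RSp d)}

theorem hypCone_eq (hC : Convex ℝ C) (hCA : C ⊆ hypDirs A) {u : RSp d} (hu : u ∈ C) :
    hypCone A C = connectedComponentIn (hypDirs A) u := by
  ext v
  constructor
  · rintro ⟨u', hu', hv⟩
    have : u' ∈ connectedComponentIn (hypDirs A) u :=
      hC.isPreconnected.subset_connectedComponentIn hu hCA hu'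
    rwa [connectedComponentIn_eq this]
  · exact fun hv => ⟨u, hu, hv⟩

theorem hypCone_subset : hypCone A C ⊆ hypDirs A := by
  rintro v ⟨u, -, hv⟩
  exact connectedComponentIn_subset _ _ hv

end HypCone

/-! ### The cones attached to a zero of an entire function -/

section ConeFam

variable {f : CSp d → ℂ} {C : Set (RSp d)} {z : CSp d}

theorem isOpen_coneFam (C : Set (RSp d)) (z : CSp d) :
    IsOpen (coneFam f C z) := by
  by_cases h : f z = 0
  · have e : coneFam f C z = ⋃ u ∈ C, connectedComponentIn (hypDirs (homPart f z)) u := by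
      ext v; simp [coneFam, h, hypCone]
    rw [e]
    exact isOpen_biUnion fun u _ =>
      (isOpen_hypDirs (analyticOnNhd_homPart f z) (homPart_smul f z)).connectedComponentIn
  · simp [coneFam, h]

theorem convex_coneFam (hC : Convex ℝ C)
    (hCne : C.Nonempty) (hCA : f z = 0 → C ⊆ hypDirs (homPart f z)) :
    Convex ℝ (coneFam f C z) := by
  by_cases h : f z = 0
  · obtain ⟨u, hu⟩ := hCne
    have e : coneFam f C z = connectedComponentIn (hypDirs (homPart f z)) u := by
      rw [← hypCone_eq hC (hCA h) hu]
      ext v; simp [coneFam, h]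
    rw [e]
    exact convex_tube_component (analyticOnNhd_homPart f z)
      (hypDirs_iff (homPart_smul f z))
      (isOpen_hypDirs (analyticOnNhd_homPart f z) (homPart_smul f z)) u
  · simpa [coneFam, h] using convex_univ

theorem smul_mem_coneFam {v : RSp d} (hv : v ∈ coneFam f C z) {c : ℝ} (hc : 0 < c) :
    c • v ∈ coneFam f C z := by
  intro h
  obtain ⟨u, hu, hv⟩ := hv h
  exact ⟨u, hu, connectedComponentIn_hypDirs_smul_mem (homPart_smul f z) hv hc⟩

theorem add_mem_coneFam (hC : Convex ℝ C)
    (hCne : C.Nonempty) (hCA : f z = 0 → C ⊆ hypDirs (homPart f z)) {v w : RSp d}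
    (hv : v ∈ coneFam f C z) (hw : w ∈ coneFam f C z) : v + w ∈ coneFam f C z := by
  have h1 := convex_coneFam hC hCne hCA hv hw (by norm_num : (0:ℝ) ≤ 1 / 2)
    (by norm_num : (0:ℝ) ≤ 1 / 2) (by norm_num)
  have h2 := smul_mem_coneFam h1 (zero_lt_two (α := ℝ))
  convert h2 using 1
  module

theorem subset_coneFam (hCA : f z = 0 → C ⊆ hypDirs (homPart f z)) : C ⊆ coneFam f C z :=
  fun u hu h => ⟨u, hu, mem_connectedComponentIn (hCA h hu)⟩

theorem homPart_ne_zero_of_mem_coneFam {v : RSp d} (hv : v ∈ coneFam f C z) (y : RSp d) :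
    homPart f z (pt v y) ≠ 0 := by
  by_cases h : f z = 0
  · exact (hypDirs_iff (homPart_smul f z) v).1 (hypCone_subset (hv h)) y
  · rwa [homPart_of_ne h]

/-- The homogeneous part does not vanish on the sector spanned by `u` and `v`, as the real parts of
its points are in the cone, except on the complex line of `v`. -/
theorem homPart_sector_ne_zero (hC : Convex ℝ C)
    (hCA : f z = 0 → C ⊆ hypDirs (homPart f z)) {u v : RSp d} (hu : u ∈ C)
    (hv : v ∈ coneFam f C z) (s : ℝ) (t : ℂ) (hs : 0 ≤ s) (ht : 0 ≤ t.re)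
    (hst : s ≠ 0 ∨ t ≠ 0) : homPart f z (cx (s • u) + t • cx v) ≠ 0 := by
  have huK : u ∈ coneFam f C z := subset_coneFam hCA hu
  rcases hs.eq_or_lt with h1 | h1
  · subst h1
    have ht0 : t ≠ 0 := by simpa using hst
    rw [zero_smul, cx_zero, zero_add, homPart_smul]
    exact mul_ne_zero (pow_ne_zero _ ht0) (by simpa using homPart_ne_zero_of_mem_coneFam hv 0)
  · have e : cx (s • u) + t • cx v = pt (s • u + t.re • v) (t.im • v) := by
      rw [smul_cx, ← pt_zero_right, ← pt_add, zero_add]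
    rw [e]
    refine homPart_ne_zero_of_mem_coneFam (C := C) ?_ _
    have h2 := smul_mem_coneFam huK h1
    rcases ht.eq_or_lt with h3 | h3
    · rw [← h3, zero_smul, add_zero]
      exact h2
    · exact add_mem_coneFam hC ⟨u, hu⟩ hCA h2 (smul_mem_coneFam hv h3)

/-- Local propagation of zero-free tubes along a direction `v` of the cone at `z`, including
displacements by positive multiples of `v` alone. -/
theorem localFree_coneFam {F : ℝ → CSp d → ℂ}
    (hFc : ContinuousOn (fun q : ℝ × CSp d => F q.1 q.2) (Ici 0 ×ˢ univ))
    (hFa : ∀ ρ, 0 ≤ ρ → AnalyticOnNhd ℂ (F ρ) univ) (hC : Convex ℝ C)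
    (hCA : F 0 z = 0 → C ⊆ hypDirs (homPart (F 0) z)) {u v : RSp d} (hu : u ∈ C)
    (hv : v ∈ coneFam (F 0) C z) {δ : ℝ} (hδ : 0 < δ)
    (htube : ∀ ρ ∈ Ico 0 δ, ∀ s ∈ Ioo 0 δ, ∀ y : RSp d, ‖y‖ < δ → F ρ (z + pt (s • u) y) ≠ 0) :
    ∃ δ' > 0, ∀ ρ ∈ Ico 0 δ', ∀ y : RSp d, ‖y‖ < δ' → ∀ v' ∈ Metric.ball v δ', ∀ s ∈ Ico 0 δ',
      ∀ t ∈ Ico 0 δ', 0 < s ∨ 0 < t → F ρ (z + pt (s • u + t • v') y) ≠ 0 := by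
  -- as the cone is open it contains `v - κ u`, and `s u + t v = (s + κ t) u + t (v - κ u)` has positive
  -- weight on `u` even if `s = 0`
  obtain ⟨κ, hκ0, hκ⟩ : ∃ κ : ℝ, 0 < κ ∧ v - κ • u ∈ coneFam (F 0) C z := by
    have hc : Continuous fun κ : ℝ => v - κ • u := by fun_prop
    have h1 : ∀ᶠ κ : ℝ in 𝓝 0, v - κ • u ∈ coneFam (F 0) C z := by
      refine (hc.tendsto 0).eventually ((isOpen_coneFam C z).mem_nhds ?_)
      simpa using hv
    obtain ⟨κ, h2, h3⟩ := ((h1.filter_mono (nhdsWithin_le_nhds (s := Ioi 0))).and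
      self_mem_nhdsWithin).exists
    exact ⟨κ, h3, h2⟩
  obtain ⟨δ₁, hδ₁, H⟩ := localFree_family hFc hFa hδ htube
    (homPart_sector_ne_zero hC hCA hu hκ)
  refine ⟨δ₁ / (1 + κ), by positivity, fun ρ hρ y hy v' hv' s hs t ht hst => ?_⟩
  have hle : δ₁ / (1 + κ) ≤ δ₁ := div_le_self hδ₁.le (by linarith)
  have hbd : s + κ * t < δ₁ := by
    calc s + κ * t < δ₁ / (1 + κ) + κ * (δ₁ / (1 + κ)) := by
          have := mul_le_mul_of_nonneg_left ht.2.le hκ0.le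
          linarith [hs.2]
      _ = δ₁ := by field_simp
  have hpos : 0 < s + κ * t := by
    rcases hst with h | h
    · have := mul_nonneg hκ0.le ht.1
      linarith
    · have := mul_pos hκ0 h
      linarith [hs.1]
  have := H ρ ⟨hρ.1, hρ.2.trans_le hle⟩ y (hy.trans_le hle) (v' - κ • u) (by
      rw [Metric.mem_ball, dist_eq_norm] at hv' ⊢
      rw [sub_sub_sub_cancel_right]
      exact hv'.trans_le hle) (s + κ * t) ⟨hpos, hbd⟩ (t : ℂ) (by
      rw [Complex.norm_real, Real.norm_of_nonneg ht.1]
      exact (ht.2.trans_le hle).le) (by simpa using ht.1)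
  have e : z + pt ((s + κ * t) • u) y + (t : ℂ) • cx (v' - κ • u)
      = z + pt (s • u + t • v') y := by
    rw [← cx_smul, ← pt_zero_right, add_assoc, ← pt_add, add_zero]
    congr 2
    module
  rwa [e] at this

end ConeFam

/-! ### Rescaled germs -/

open Classical in
/-- The rescaled germs `w ↦ ρ ^ (-m) f (z + ρ w)`, completed at `ρ = 0` by the homogeneous part. -/
def scaledGerm (f : CSp d → ℂ) (z : CSp d) (ρ : ℝ) (w : CSp d) : ℂ :=
  if ρ = 0 then homPart f z w else f (z + (ρ : ℂ) • w) / (ρ : ℂ) ^ degAt f z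

theorem scaledGerm_zero (f : CSp d → ℂ) (z : CSp d) : scaledGerm f z 0 = homPart f z := by
  funext w; simp [scaledGerm]

theorem scaledGerm_ne_zero_iff {f : CSp d → ℂ} {z : CSp d} {ρ : ℝ} (hρ : ρ ≠ 0) (w : CSp d) :
    scaledGerm f z ρ w ≠ 0 ↔ f (z + (ρ : ℂ) • w) ≠ 0 := by
  have : (ρ : ℂ) ≠ 0 := by exact_mod_cast hρ
  simp [scaledGerm, hρ]

theorem continuous_scaledGerm {f : CSp d → ℂ} (hf : AnalyticOnNhd ℂ f univ) (z : CSp d) :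
    Continuous fun q : ℝ × CSp d => scaledGerm f z q.1 q.2 := by
  have hfc : Continuous f := continuous_iff_continuousAt.2 fun w => (hf w (mem_univ w)).continuousAt
  rw [continuous_iff_continuousAt]
  rintro ⟨ρ, w⟩
  by_cases hρ : ρ = 0
  · subst hρ
    obtain ⟨R, hR, K, hK, H⟩ := exists_scaled_taylor_bound hf z
    have hb : ∀ᶠ q : ℝ × CSp d in 𝓝 (0, w), |q.1| * ‖q.2‖ ≤ R := by
      have hc : Continuous fun q : ℝ × CSp d => |q.1| * ‖q.2‖ := by fun_prop
      refine (hc.tendsto (0, w)).eventually (eventually_le_nhds ?_)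
      simpa using hR
    have h1 : Tendsto (fun q : ℝ × CSp d => scaledGerm f z q.1 q.2 - homPart f z q.2)
        (𝓝 (0, w)) (𝓝 0) := by
      have hc : Continuous fun q : ℝ × CSp d => K * |q.1| * ‖q.2‖ ^ (degAt f z + 1) := by
        fun_prop
      have hlim := hc.tendsto (0, w)
      simp only [abs_zero, mul_zero, zero_mul] at hlim
      refine squeeze_zero_norm' ?_ hlim
      filter_upwards [hb] with q hq
      by_cases h0 : q.1 = 0
      · simp [h0, scaledGerm_zero]
      · have := H (q.1 : ℂ) q.2 (by exact_mod_cast h0) (by simpa using hq)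
        simpa [scaledGerm, h0] using this
    have h2 : Tendsto (fun q : ℝ × CSp d => homPart f z q.2) (𝓝 (0, w)) (𝓝 (homPart f z w)) :=
      ((continuous_homPart f z).comp continuous_snd).tendsto (0, w)
    have h3 := h1.add h2
    rw [zero_add] at h3
    unfold ContinuousAt
    simp only [scaledGerm_zero]
    exact h3.congr fun q => by ring
  · have h1 : ∀ᶠ q : ℝ × CSp d in 𝓝 (ρ, w), q.1 ≠ 0 :=
      (continuous_fst.tendsto (ρ, w)).eventually_ne hρ
    have h2 : ContinuousAt (fun q : ℝ × CSp d =>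
        f (z + (q.1 : ℂ) • q.2) / (q.1 : ℂ) ^ degAt f z) (ρ, w) := by
      refine ContinuousAt.div ?_ ?_ ?_
      · exact (hfc.comp (by fun_prop)).continuousAt
      · exact Continuous.continuousAt (by fun_prop)
      · exact pow_ne_zero _ (by exact_mod_cast hρ)
    refine h2.congr ?_
    filter_upwards [h1] with q hq
    simp [scaledGerm, hq]

theorem analyticOnNhd_scaledGerm {f : CSp d → ℂ} (hf : AnalyticOnNhd ℂ f univ) (z : CSp d)
    (ρ : ℝ) : AnalyticOnNhd ℂ (scaledGerm f z ρ) univ := by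
  by_cases hρ : ρ = 0
  · rw [hρ, scaledGerm_zero]
    exact analyticOnNhd_homPart f z
  · have e : scaledGerm f z ρ = fun w => f (z + (ρ : ℂ) • w) / (ρ : ℂ) ^ degAt f z := by
      funext w; simp [scaledGerm, hρ]
    rw [e]
    intro w _
    refine AnalyticAt.div ?_ analyticAt_const (pow_ne_zero _ (by exact_mod_cast hρ))
    have h1 : AnalyticAt ℂ (fun w : CSp d => (ρ : ℂ) • w) w :=
      ((ρ : ℂ) • ContinuousLinearMap.id ℂ (CSp d)).analyticAt w
    exact (hf _ (mem_univ _)).comp (f := fun w : CSp d => z + (ρ : ℂ) • w)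
      (analyticAt_const.add h1)

/-- If all small rescalings of a neighborhood of `ξ` avoid the zeros of `f` near `z`, then the
homogeneous part does not vanish at `ξ`. -/
theorem homPart_ne_zero_of_free {f : CSp d → ℂ} (hf : AnalyticOnNhd ℂ f univ) (h0 : ∃ w, f w ≠ 0)
    {z ξ : CSp d} {O : Set (CSp d)} (hO : O ∈ 𝓝 ξ) {ρ₀ : ℝ} (hρ₀ : 0 < ρ₀)
    (h : ∀ w ∈ O, ∀ ρ ∈ Ioo 0 ρ₀, f (z + (ρ : ℂ) • w) ≠ 0) : homPart f z ξ ≠ 0 := by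
  intro hz
  obtain ⟨w, hw⟩ := exists_homPart_ne_zero hf h0 z
  have hc : Continuous fun q : ℝ × ℂ => scaledGerm f z q.1 (ξ + q.2 • (w - ξ)) :=
    (continuous_scaledGerm hf z).comp
      (by fun_prop : Continuous fun q : ℝ × ℂ => (q.1, ξ + q.2 • (w - ξ)))
  have hU : {t : ℂ | ξ + t • (w - ξ) ∈ O} ∈ 𝓝 (0 : ℂ) := by
    have h1 : Continuous fun t : ℂ => ξ + t • (w - ξ) := by fun_prop
    refine h1.tendsto 0 ?_
    simpa using hO
  have hev := eventually_exists_zero (h := fun ρ t => scaledGerm f z ρ (ξ + t • (w - ξ))) hc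
    (fun ρ => differentiable_line (analyticOnNhd_scaledGerm hf z ρ) _ _) (p₀ := 0) (t₀ := 0)
    (by simpa [scaledGerm_zero] using hz) ⟨1, by simpa [scaledGerm_zero] using hw⟩ hU
  obtain ⟨ρ, ⟨t, ht, hzero⟩, hρ⟩ := ((hev.filter_mono (nhdsWithin_le_nhds (s := Ioi 0))).and
    (Ioo_mem_nhdsGT hρ₀)).exists
  exact (scaledGerm_ne_zero_iff hρ.1.ne' _).2 (h _ ht ρ hρ) hzero

/-- The germ of `f` at `z` has no zeros on the small tubes over the directions of `C`. -/
def TubeFree (f : CSp d → ℂ) (z : CSp d) (C : Set (RSp d)) : Prop :=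
  ∀ v ∈ C, ∃ δ > 0, ∀ v' ∈ Metric.ball v δ, ∀ s ∈ Ioo 0 δ, ∀ y : RSp d, ‖y‖ < δ →
    f (z + pt (s • v') y) ≠ 0

/-- Directions of zero-free tubes are directions of hyperbolicity of the homogeneous part, the limit
of the rescaled germs. -/
theorem TubeFree.subset_hypDirs {f : CSp d → ℂ} (hf : AnalyticOnNhd ℂ f univ) {z : CSp d}
    (h0 : ∃ w, f w ≠ 0) {C : Set (RSp d)} (h : TubeFree f z C) : C ⊆ hypDirs (homPart f z) := by
  intro v hv
  rw [hypDirs_iff (homPart_smul f z)]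
  intro y
  obtain ⟨δ, hδ, H⟩ := h v hv
  refine homPart_ne_zero_of_free hf h0 (O := Metric.ball (pt v y) (min δ 1))
    (Metric.ball_mem_nhds _ (by positivity)) (ρ₀ := min δ (δ / (‖y‖ + 1))) (by positivity)
    fun w hw ρ hρ => ?_
  obtain ⟨a, b, rfl⟩ := exists_pt_eq w
  have e : pt a b - pt v y = pt (a - v) (b - y) := by ext i; simp; ring
  rw [Metric.mem_ball, dist_eq_norm, e] at hw
  have h1 := norm_le_norm_pt_left (a - v) (b - y)
  have h2 := norm_le_norm_pt_right (a - v) (b - y)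
  have h3 : ‖b‖ < ‖y‖ + 1 := by
    have := norm_sub_norm_le b y
    have := min_le_right δ 1
    linarith
  rw [smul_pt]
  refine H a (by rw [Metric.mem_ball, dist_eq_norm]; exact (h1.trans_lt hw).trans_le (min_le_left _ _))
    ρ ⟨hρ.1, hρ.2.trans_le (min_le_left _ _)⟩ _ ?_
  rw [norm_smul, Real.norm_of_nonneg hρ.1.le]
  calc ρ * ‖b‖ < δ / (‖y‖ + 1) * (‖y‖ + 1) :=
        mul_lt_mul' (hρ.2.le.trans (min_le_right _ _)) h3 (norm_nonneg _) (by positivity)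
    _ = δ := by field_simp

/-- A direction whose small multiples, combined with those of `u`, avoid the zeros of `f` near `z`
belongs to the cone at `z`. -/
theorem mem_coneFam_of_free {f : CSp d → ℂ} (hf : AnalyticOnNhd ℂ f univ) (h0 : ∃ w, f w ≠ 0)
    {z : CSp d} {C : Set (RSp d)} {u v : RSp d} (hu : u ∈ C)
    (hCA : f z = 0 → C ⊆ hypDirs (homPart f z)) {δ : ℝ} (hδ : 0 < δ)
    (h : ∀ y : RSp d, ‖y‖ < δ → ∀ v' ∈ Metric.ball v δ, ∀ s ∈ Ico 0 δ, ∀ t ∈ Ioo 0 δ,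
      f (z + pt (s • u + t • v') y) ≠ 0) : v ∈ coneFam f C z := by
  intro hz
  refine ⟨u, hu, ?_⟩
  -- it suffices that the segment from `u` to `v` consists of directions of hyperbolicity
  have hseg : segment ℝ u v ⊆ hypDirs (homPart f z) := by
    rintro p ⟨a, τ, ha, hτ, haτ, rfl⟩
    rcases hτ.eq_or_lt with h1 | h1
    · subst h1
      have : a = 1 := by linarith
      simpa [this] using hCA hz hu
    rw [hypDirs_iff (homPart_smul f z)]
    intro y
    refine homPart_ne_zero_of_free hf h0 (O := Metric.ball (pt (a • u + τ • v) y) (min (τ * δ) 1))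
      (Metric.ball_mem_nhds _ (by positivity)) (ρ₀ := min δ (δ / (‖y‖ + 1))) (by positivity)
      fun w hw ρ hρ => ?_
    obtain ⟨a', b, rfl⟩ := exists_pt_eq w
    set e := a' - (a • u + τ • v) with he
    have e1 : pt a' b - pt (a • u + τ • v) y = pt e (b - y) := by
      ext i; simp [he]; ring
    rw [Metric.mem_ball, dist_eq_norm, e1] at hw
    have h2 := norm_le_norm_pt_left e (b - y)
    have h3 := norm_le_norm_pt_right e (b - y)
    have h4 : ‖b‖ < ‖y‖ + 1 := by
      have := norm_sub_norm_le b y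
      have := min_le_right (τ * δ) 1
      linarith
    have hρδ := hρ.2.trans_le (min_le_left _ _)
    have e2 : ρ • a' = (ρ * a) • u + (ρ * τ) • (v + τ⁻¹ • e) := by
      have : (ρ * τ) • τ⁻¹ • e = ρ • e := by
        rw [smul_smul]; congr 1; field_simp
      rw [smul_add, this, he]
      module
    rw [smul_pt, e2]
    refine h _ ?_ _ ?_ _ ⟨mul_nonneg hρ.1.le ha, ?_⟩ _ ⟨mul_pos hρ.1 h1, ?_⟩
    · rw [norm_smul, Real.norm_of_nonneg hρ.1.le]
      calc ρ * ‖b‖ < δ / (‖y‖ + 1) * (‖y‖ + 1) :=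
            mul_lt_mul' (hρ.2.le.trans (min_le_right _ _)) h4 (norm_nonneg _) (by positivity)
        _ = δ := by field_simp
    · rw [Metric.mem_ball, dist_eq_norm, add_sub_cancel_left, norm_smul, norm_inv,
        Real.norm_of_nonneg hτ, inv_mul_lt_iff₀ h1]
      exact (h2.trans_lt hw).trans_le (min_le_left _ _)
    · calc ρ * a ≤ ρ * 1 := mul_le_mul_of_nonneg_left (by linarith) hρ.1.le
        _ < δ := by linarith
    · calc ρ * τ ≤ ρ * 1 := mul_le_mul_of_nonneg_left (by linarith) hρ.1.le
        _ < δ := by linarith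
  exact (convex_segment u v).isPreconnected.subset_connectedComponentIn
    (left_mem_segment ℝ u v) hseg (right_mem_segment ℝ u v)

/-- The cones attached to a homogeneous function are constant along complex lines. -/
theorem coneFam_smul {A : CSp d → ℂ} {m : ℕ} (hAa : AnalyticOnNhd ℂ A univ)
    (hA : ∀ (c : ℂ) w, A (c • w) = c ^ m * A w) (h0 : ∃ w, A w ≠ 0) {c : ℂ} (hc : c ≠ 0)
    (C : Set (RSp d)) (z : CSp d) : coneFam A C (c • z) = coneFam A C z := by
  have h1 := (degAt_homPart_of_scaling (z := z) (z' := c • z) (a := c ^ m) (b := c⁻¹) hAa h0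
    (pow_ne_zero _ hc) (inv_ne_zero hc) fun w => by
      rw [← hA, smul_add, smul_inv_smul₀ hc]).2
  have h2 : homPart A (c • z) = fun w => (c ^ m * c⁻¹ ^ degAt A z) * homPart A z w := by
    rw [h1]; funext w; rw [homPart_smul]; ring
  ext v
  simp only [coneFam, mem_ofPred_eq, hypCone, h2]
  rw [hypDirs_const_mul (mul_ne_zero (pow_ne_zero _ hc) (pow_ne_zero _ (inv_ne_zero hc))), hA]
  simp [hc]

/-! ### Periodic functions and the amoeba -/

theorem analyticOnNhd_expPull (Q : MvPolynomial (Fin d) ℂ) :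
    AnalyticOnNhd ℂ (expPull Q) univ := by
  have h := AnalyticOnNhd.aeval_mvPolynomial (𝕜 := ℂ) (A := ℂ) (s := (univ : Set (CSp d)))
    (f := fun z i => Complex.exp (z i)) (fun i z _ =>
      ((EuclideanSpace.proj (𝕜 := ℂ) i).analyticAt z).cexp) Q
  have e : expPull Q = fun z => MvPolynomial.aeval (fun i => Complex.exp (z i)) Q := by
    funext z
    rw [MvPolynomial.aeval_eq_eval]
    rfl
  rw [e]
  exact h

theorem expPull_add_lat (Q : MvPolynomial (Fin d) ℂ) (n : Fin d → ℤ) (a b : RSp d) :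
    expPull Q (pt a (b + lat n)) = expPull Q (pt a b) := by
  unfold expPull
  congr 2
  funext i
  rw [Complex.exp_eq_exp_iff_exists_int]
  refine ⟨n i, ?_⟩
  simp [lat]
  ring

theorem exists_expPull_ne_zero {Q : MvPolynomial (Fin d) ℂ} (hQ : Q ≠ 0) :
    ∃ z, expPull Q z ≠ 0 := by
  have hP : Q * ∏ i, MvPolynomial.X i ≠ 0 :=
    mul_ne_zero hQ (Finset.prod_ne_zero_iff.2 fun i _ => MvPolynomial.X_ne_zero i)
  obtain ⟨Z, hZ⟩ : ∃ Z, MvPolynomial.eval Z (Q * ∏ i, MvPolynomial.X i) ≠ 0 := by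
    by_contra! h
    exact hP (MvPolynomial.funext fun Z => by rw [h, map_zero])
  rw [map_mul, map_prod, mul_ne_zero_iff, Finset.prod_ne_zero_iff] at hZ
  refine ⟨WithLp.toLp 2 fun i => Complex.log (Z i), ?_⟩
  unfold expPull
  convert hZ.1 using 3
  funext i
  exact Complex.exp_log (by simpa using hZ.2 i (Finset.mem_univ i))

theorem notMem_amoeba_iff (G : MvPolynomial (Fin d) ℂ) (a : RSp d) :
    a ∈ (amoeba G)ᶜ ↔ ∀ b, expPull G (pt a b) ≠ 0 := by
  constructor
  · intro h b h0
    refine h ⟨fun i => Complex.exp (pt a b i), fun i => Complex.exp_ne_zero _, h0, fun i => ?_⟩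
    rw [Complex.norm_exp, Real.log_exp]
    simp
  · rintro h ⟨Z, hZ, h0, ha⟩
    refine h (WithLp.toLp 2 fun i => Complex.arg (Z i)) ?_
    unfold expPull
    convert h0 using 3
    funext i
    rw [pt_apply, ha i, mul_comm]
    have h1 := (congrArg Complex.exp (Complex.re_add_im (Complex.log (Z i)))).trans
      (Complex.exp_log (hZ i))
    rwa [Complex.log_re, Complex.log_im] at h1

/-- The half-open fundamental cube of the lattice `2 π ℤ^d`. -/
def cube (d : ℕ) : Set (RSp d) := {y | ∀ i, y i ∈ Ico 0 (2 * Real.pi)}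

/-- The closed fundamental cube of the lattice `2 π ℤ^d`. -/
def closedCube (d : ℕ) : Set (RSp d) := {y | ∀ i, y i ∈ Icc 0 (2 * Real.pi)}

theorem cube_subset_closedCube : cube d ⊆ closedCube d :=
  fun _ hy i => Ico_subset_Icc_self (hy i)

theorem isCompact_closedCube : IsCompact (closedCube d) := by
  have h : closedCube d = (WithLp.toLp 2) '' (univ.pi fun _ : Fin d => Icc 0 (2 * Real.pi)) := by
    ext y
    constructor
    · intro hy
      exact ⟨y.ofLp, fun i _ => hy i, rfl⟩
    · rintro ⟨w, hw, rfl⟩ i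
      exact hw i (mem_univ i)
  rw [h]
  exact (isCompact_univ_pi fun _ => isCompact_Icc).image (PiLp.continuous_toLp 2 _)

theorem exists_add_lat_mem_cube (y : RSp d) : ∃ n : Fin d → ℤ, y + lat n ∈ cube d := by
  refine ⟨fun i => -⌊y i / (2 * Real.pi)⌋, fun i => ?_⟩
  have hpi : 0 < 2 * Real.pi := by positivity
  have h1 := Int.floor_le (y i / (2 * Real.pi))
  have h2 := Int.lt_floor_add_one (y i / (2 * Real.pi))
  rw [le_div_iff₀ hpi] at h1
  rw [div_lt_iff₀ hpi] at h2
  simp only [lat, PiLp.add_apply, Int.cast_neg]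
  constructor <;> nlinarith

theorem lat_neg (n : Fin d → ℤ) : lat (-n) = -lat n := by
  ext i; simp [lat]

theorem lat_add (n m : Fin d → ℤ) : lat (n + m) = lat n + lat m := by
  ext i; simp [lat]; ring

@[simp] theorem lat_zero : lat (0 : Fin d → ℤ) = 0 := by
  ext i; simp [lat]

/-- An open condition that holds at every point of `ℝ^d` near the torus and is invariant under the
lattice holds uniformly. -/
theorem eventually_forall_of_periodic {X : Type*} [TopologicalSpace X] {x₀ : X}
    {p : X → RSp d → Prop} (hper : ∀ x n y, p x (y + lat n) → p x y)
    (h : ∀ y ∈ closedCube d, ∀ᶠ q : X × RSp d in 𝓝 (x₀, y), p q.1 q.2) :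
    ∀ᶠ x in 𝓝 x₀, ∀ y, p x y := by
  have h1 := isCompact_closedCube.eventually_forall_of_forall_eventually h
  filter_upwards [h1] with x hx y
  obtain ⟨n, hn⟩ := exists_add_lat_mem_cube y
  exact hper x n y (hx _ (cube_subset_closedCube hn))

theorem isOpen_zeroFree {f : CSp d → ℂ} (hf : Continuous f)
    (hper : ∀ n a b, f (pt a (b + lat n)) = f (pt a b)) :
    IsOpen {a : RSp d | ∀ b, f (pt a b) ≠ 0} := by
  rw [isOpen_iff_mem_nhds]
  intro a ha
  refine eventually_forall_of_periodic (p := fun a b => f (pt a b) ≠ 0)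
    (fun a n b h => by rwa [hper] at h) fun y _ => ?_
  have hc : Continuous fun q : RSp d × RSp d => f (pt q.1 q.2) := hf.comp (by fun_prop)
  exact (hc.tendsto (a, y)).eventually_ne (ha y)

/-! ### Zero-free tubes over convex sets, and their boundary points -/

/-- A periodic entire function `g` without zeros over an open convex set `B`, and a point `x` of
the closure of `B`. -/
structure TubeData (g : CSp d → ℂ) (B : Set (RSp d)) (x : RSp d) : Prop where
  analytic : AnalyticOnNhd ℂ g univ
  periodic : ∀ (n : Fin d → ℤ) (a b : RSp d), g (pt a (b + lat n)) = g (pt a b)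
  isOpen : IsOpen B
  convex : Convex ℝ B
  nonempty : B.Nonempty
  ne_zero : ∀ a ∈ B, ∀ b, g (pt a b) ≠ 0
  mem_closure : x ∈ closure B

/-- The component of the complement of the amoeba is convex by Bochner's tube theorem. -/
theorem IsPowerSeriesComponent.tubeData {G : MvPolynomial (Fin d) ℂ} {B : Set (RSp d)}
    (hB : IsPowerSeriesComponent G B) {x : RSp d} (hx : x ∈ closure B) :
    TubeData (expPull G) B x := by
  obtain ⟨⟨b, hb, rfl⟩, -⟩ := hB
  have hcont : Continuous (expPull G) := continuous_iff_continuousAt.2 fun w =>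
    (analyticOnNhd_expPull G w (mem_univ w)).continuousAt
  have ho : IsOpen (amoeba G)ᶜ := by
    have h : (amoeba G)ᶜ = {a : RSp d | ∀ b, expPull G (pt a b) ≠ 0} := by
      ext a; exact notMem_amoeba_iff G a
    rw [h]
    exact isOpen_zeroFree hcont (expPull_add_lat G)
  exact {
    analytic := analyticOnNhd_expPull G
    periodic := expPull_add_lat G
    isOpen := ho.connectedComponentIn
    convex := convex_tube_component (analyticOnNhd_expPull G) (notMem_amoeba_iff G) ho b
    nonempty := ⟨b, mem_connectedComponentIn hb⟩
    ne_zero := fun a ha => (notMem_amoeba_iff G a).1 (connectedComponentIn_subset _ _ ha)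
    mem_closure := hx }

namespace TubeData

variable {g : CSp d → ℂ} {B : Set (RSp d)} {x : RSp d}

theorem exists_ne_zero (T : TubeData g B x) : ∃ z, g z ≠ 0 :=
  let ⟨a, ha⟩ := T.nonempty
  ⟨_, T.ne_zero a ha 0⟩

theorem continuous (T : TubeData g B x) : Continuous g :=
  continuous_iff_continuousAt.2 fun w => (T.analytic w (mem_univ w)).continuousAt

theorem add_smul_mem (T : TubeData g B x) {v : RSp d} {t s : ℝ} (hv : x + t • v ∈ B)
    (hs : 0 < s) (hst : s ≤ t) : x + s • v ∈ B := by
  have ht : 0 < t := hs.trans_le hst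
  have h1 : x + t • v ∈ interior B := by rwa [T.isOpen.interior_eq]
  have h2 := T.convex.combo_closure_interior_mem_interior T.mem_closure h1
    (a := 1 - s / t) (b := s / t) (by rw [sub_nonneg, div_le_one ht]; exact hst) (by positivity)
    (by ring)
  rw [T.isOpen.interior_eq] at h2
  convert h2 using 1
  have : s • v = (s / t) • t • v := by rw [smul_smul, div_mul_cancel₀ _ ht.ne']
  rw [this]
  module

theorem mem_tanCone_iff (T : TubeData g B x) (v : RSp d) :
    v ∈ tanCone B x ↔ ∃ t > (0 : ℝ), x + t • v ∈ B := by
  constructor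
  · intro h
    have h1 : ∀ᶠ t : ℝ in 𝓝[>] 0, x + t • v ∈ B := h
    obtain ⟨t, h1, h2⟩ := (h1.and self_mem_nhdsWithin).exists
    exact ⟨t, h2, h1⟩
  · rintro ⟨t, ht, hv⟩
    change ∀ᶠ t : ℝ in 𝓝[>] 0, x + t • v ∈ B
    filter_upwards [Ioo_mem_nhdsGT ht] with s hs
    exact T.add_smul_mem hv hs.1 hs.2.le

theorem sub_mem_tanCone (T : TubeData g B x) {b : RSp d} (hb : b ∈ B) : b - x ∈ tanCone B x :=
  (T.mem_tanCone_iff _).2 ⟨1, one_pos, by simpa using hb⟩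

theorem exists_ball_tanCone (T : TubeData g B x) {v : RSp d} (hv : v ∈ tanCone B x) :
    ∃ δ > 0, ∀ v' ∈ Metric.ball v δ, ∀ s ∈ Ioo 0 δ, x + s • v' ∈ B := by
  obtain ⟨t, ht, hv⟩ := (T.mem_tanCone_iff v).1 hv
  have hc : Continuous fun v : RSp d => x + t • v := by fun_prop
  obtain ⟨δ, hδ, h⟩ := Metric.isOpen_iff.1 (T.isOpen.preimage hc) v hv
  refine ⟨min δ t, by positivity, fun v' hv' s hs => ?_⟩
  exact T.add_smul_mem (h (Metric.ball_subset_ball (min_le_left _ _) hv')) hs.1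
    (hs.2.le.trans (min_le_right _ _))

theorem convex_tanCone (T : TubeData g B x) : Convex ℝ (tanCone B x) := by
  intro v hv w hw a b ha hb hab
  have h1 : ∀ᶠ t : ℝ in 𝓝[>] 0, x + t • v ∈ B := hv
  have h2 : ∀ᶠ t : ℝ in 𝓝[>] 0, x + t • w ∈ B := hw
  change ∀ᶠ t : ℝ in 𝓝[>] 0, x + t • (a • v + b • w) ∈ B
  filter_upwards [h1, h2] with t h3 h4
  convert T.convex h3 h4 ha hb hab using 1
  have : x = (a + b) • x := by rw [hab, one_smul]
  nth_rw 1 [this]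
  module

theorem nonempty_tanCone (T : TubeData g B x) : (tanCone B x).Nonempty :=
  let ⟨_, hb⟩ := T.nonempty
  ⟨_, T.sub_mem_tanCone hb⟩

theorem tubeFree (T : TubeData g B x) (y : RSp d) : TubeFree g (pt x y) (tanCone B x) := by
  intro v hv
  obtain ⟨δ, hδ, h⟩ := T.exists_ball_tanCone hv
  refine ⟨δ, hδ, fun v' hv' s hs y' _ => ?_⟩
  rw [← pt_add]
  exact T.ne_zero _ (h v' hv' s hs) _

theorem tanCone_subset_hypDirs (T : TubeData g B x) (y : RSp d) :
    tanCone B x ⊆ hypDirs (homPart g (pt x y)) :=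
  (T.tubeFree y).subset_hypDirs T.analytic T.exists_ne_zero

/-! ### The cones at the boundary point -/

theorem tanCone_subset_logCone (T : TubeData g B x) (y : RSp d) :
    tanCone B x ⊆ logCone g B x y :=
  subset_coneFam fun _ => T.tanCone_subset_hypDirs y

theorem isOpen_logCone (g : CSp d → ℂ) (B : Set (RSp d)) (x y : RSp d) :
    IsOpen (logCone g B x y) := isOpen_coneFam _ _

theorem convex_logCone (T : TubeData g B x) (y : RSp d) : Convex ℝ (logCone g B x y) :=
  convex_coneFam T.convex_tanCone T.nonempty_tanCone fun _ => T.tanCone_subset_hypDirs y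

theorem add_mem_logCone (T : TubeData g B x) {y v w : RSp d} (hv : v ∈ logCone g B x y)
    (hw : w ∈ logCone g B x y) : v + w ∈ logCone g B x y :=
  add_mem_coneFam T.convex_tanCone T.nonempty_tanCone (fun _ => T.tanCone_subset_hypDirs y) hv hw

theorem smul_mem_logCone {y v : RSp d} (hv : v ∈ logCone g B x y) {c : ℝ} (hc : 0 < c) :
    c • v ∈ logCone g B x y :=
  smul_mem_coneFam hv hc

theorem homPart_add_lat (T : TubeData g B x) (n : Fin d → ℤ) (y : RSp d) :
    homPart g (pt x (y + lat n)) = homPart g (pt x y) := by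
  have h := (degAt_homPart_of_scaling (z := pt x y) (z' := pt x (y + lat n)) (a := 1) (b := 1)
    T.analytic T.exists_ne_zero one_ne_zero one_ne_zero fun w => by
      obtain ⟨a, b, rfl⟩ := exists_pt_eq w
      rw [one_mul, one_smul, ← pt_add, ← pt_add, ← T.periodic n (x + a) (y + b)]
      congr 2
      abel).2
  rw [h]
  funext w
  rw [one_mul, one_smul]

theorem logCone_add_lat (T : TubeData g B x) (n : Fin d → ℤ) (y : RSp d) :
    logCone g B x (y + lat n) = logCone g B x y := by
  ext v
  simp only [logCone, coneFam, mem_ofPred_eq, T.homPart_add_lat, T.periodic]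

theorem tangentPoly_add_lat (T : TubeData g B x) (n : Fin d → ℤ) (w : RSp d) :
    tangentPoly g x (w + lat n) = tangentPoly g x w := T.homPart_add_lat n w

theorem projCone_add_lat (T : TubeData g B x) (n : Fin d → ℤ) (w y : RSp d) :
    projCone g B x (w + lat n) y = projCone g B x w y := by
  unfold projCone
  rw [T.tangentPoly_add_lat, T.logCone_add_lat]

theorem critSet_add_lat_iff (T : TubeData g B x) (r : RSp d) (n : Fin d → ℤ) (y : RSp d) :
    y + lat n ∈ critSet g B r x ↔ y ∈ critSet g B r x := by
  simp only [critSet, mem_ofPred_eq, T.logCone_add_lat, T.periodic]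

/-- Small displacements of points near `x + i y₀` in real directions near a vector of the cone at
`y₀`, combined with a direction of the tangent cone of `B`, avoid the zeros of `g`. -/
theorem localFree (T : TubeData g B x) {y₀ u v : RSp d} (hu : u ∈ tanCone B x)
    (hv : v ∈ logCone g B x y₀) :
    ∃ δ > 0, ∀ y, ‖y‖ < δ → ∀ v' ∈ Metric.ball v δ, ∀ s ∈ Ico 0 δ, ∀ t ∈ Ico 0 δ,
      0 < s ∨ 0 < t → g (pt (x + (s • u + t • v')) (y₀ + y)) ≠ 0 := by
  obtain ⟨δ, hδ, h⟩ := T.tubeFree y₀ u hu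
  obtain ⟨δ', hδ', H⟩ := localFree_coneFam (F := fun _ => g) (z := pt x y₀)
    (T.continuous.comp continuous_snd).continuousOn (fun _ _ => T.analytic) T.convex_tanCone
    (fun _ => T.tanCone_subset_hypDirs y₀) hu hv hδ
    (fun _ _ s hs y hy => h u (Metric.mem_ball_self hδ) s hs y hy)
  refine ⟨δ', hδ', fun y hy v' hv' s hs t ht hst => ?_⟩
  rw [pt_add]
  exact H 0 ⟨le_rfl, hδ'⟩ y hy v' hv' s hs t ht hst

/-- Lower semicontinuity of the cones. -/
theorem eventually_mem_logCone (T : TubeData g B x) {y₀ v : RSp d} (hv : v ∈ logCone g B x y₀) :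
    ∀ᶠ y in 𝓝 y₀, v ∈ logCone g B x y := by
  obtain ⟨u, hu⟩ := T.nonempty_tanCone
  obtain ⟨δ, hδ, H⟩ := T.localFree hu hv
  filter_upwards [Metric.ball_mem_nhds y₀ (half_pos hδ)] with y hy
  refine mem_coneFam_of_free T.analytic T.exists_ne_zero hu
    (fun _ => T.tanCone_subset_hypDirs y) (half_pos hδ) fun y' hy' v' hv' s hs t ht => ?_
  rw [← pt_add]
  have e : y + y' = y₀ + (y - y₀ + y') := by abel
  rw [e]
  rw [Metric.mem_ball, dist_eq_norm] at hy
  refine H _ ?_ v' (Metric.ball_subset_ball (by linarith) hv') s ⟨hs.1, by linarith [hs.2]⟩ t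
    ⟨ht.1.le, by linarith [ht.2]⟩ (Or.inr ht.1)
  have := norm_add_le (y - y₀) y'
  linarith

/-! ### The second-level cones -/

theorem tangentPoly_smul (g : CSp d → ℂ) (x w : RSp d) (c : ℂ) (ξ : CSp d) :
    tangentPoly g x w (c • ξ) = c ^ degAt g (pt x w) * tangentPoly g x w ξ :=
  homPart_smul _ _ _ _

theorem analyticOnNhd_tangentPoly (g : CSp d → ℂ) (x w : RSp d) :
    AnalyticOnNhd ℂ (tangentPoly g x w) univ := analyticOnNhd_homPart _ _

theorem tangentPoly_ne_zero {w v : RSp d} (hv : v ∈ logCone g B x w) (y : RSp d) :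
    tangentPoly g x w (pt v y) ≠ 0 := homPart_ne_zero_of_mem_coneFam hv y

theorem exists_tangentPoly_ne_zero (T : TubeData g B x) (w : RSp d) :
    ∃ ξ, tangentPoly g x w ξ ≠ 0 :=
  exists_homPart_ne_zero T.analytic T.exists_ne_zero _

/-- By homogeneity, the cones may be computed at the imaginary points `i y`. -/
theorem projCone_eq (T : TubeData g B x) (w y : RSp d) :
    projCone g B x w y = coneFam (tangentPoly g x w) (logCone g B x w) (pt 0 y) := by
  rw [pt_zero_left, coneFam_smul (analyticOnNhd_tangentPoly g x w) (tangentPoly_smul g x w)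
    (T.exists_tangentPoly_ne_zero w) Complex.I_ne_zero]
  rfl

theorem projCone_smul (T : TubeData g B x) (w y : RSp d) {c : ℝ} (hc : c ≠ 0) :
    projCone g B x w (c • y) = projCone g B x w y := by
  unfold projCone
  rw [cx_smul, coneFam_smul (analyticOnNhd_tangentPoly g x w) (tangentPoly_smul g x w)
    (T.exists_tangentPoly_ne_zero w) (by exact_mod_cast hc)]

theorem tubeFree_tangentPoly (w y : RSp d) :
    TubeFree (tangentPoly g x w) (pt 0 y) (logCone g B x w) := by
  intro v hv
  obtain ⟨δ, hδ, h⟩ := Metric.isOpen_iff.1 (isOpen_logCone g B x w) v hv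
  refine ⟨δ, hδ, fun v' hv' s hs y' _ => ?_⟩
  rw [← pt_add, zero_add]
  exact tangentPoly_ne_zero (smul_mem_logCone (h hv') hs.1) _

theorem logCone_subset_hypDirs (T : TubeData g B x) (w y : RSp d) :
    logCone g B x w ⊆ hypDirs (homPart (tangentPoly g x w) (pt 0 y)) :=
  (tubeFree_tangentPoly w y).subset_hypDirs (analyticOnNhd_tangentPoly g x w)
    (T.exists_tangentPoly_ne_zero w)

theorem nonempty_logCone (T : TubeData g B x) (w : RSp d) : (logCone g B x w).Nonempty :=
  T.nonempty_tanCone.mono (T.tanCone_subset_logCone w)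

theorem add_mem_projCone (T : TubeData g B x) {w y v v' : RSp d} (hv : v ∈ projCone g B x w y)
    (hv' : v' ∈ projCone g B x w y) : v + v' ∈ projCone g B x w y := by
  rw [T.projCone_eq] at *
  exact add_mem_coneFam (T.convex_logCone w) (T.nonempty_logCone w)
    (fun _ => T.logCone_subset_hypDirs w y) hv hv'

theorem smul_mem_projCone {w y v : RSp d} (hv : v ∈ projCone g B x w y) {c : ℝ} (hc : 0 < c) :
    c • v ∈ projCone g B x w y := smul_mem_coneFam hv hc

theorem exists_tube_radius (T : TubeData g B x) {u : RSp d} (hu : u ∈ tanCone B x) :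
    ∃ δ > 0, ∀ s ∈ Ioo 0 δ, ∀ v' ∈ Metric.ball u δ, ∀ b, g (pt (x + s • v') b) ≠ 0 := by
  obtain ⟨δ, hδ, h⟩ := T.exists_ball_tanCone hu
  exact ⟨δ, hδ, fun s hs v' hv' b => T.ne_zero _ (h v' hv' s hs) b⟩

/-- Two-scale version of `TubeData.localFree` at a zero `x + i w` of `g`: for small `ρ`, the
displacements by `ρ` times a small multiple of a vector of the second-level cone at `y₀` of the
points near `x + i (w + ρ y₀)` avoid the zeros of `g`, uniformly in `ρ`, and likewise for the
homogeneous part in the limit `ρ = 0`. -/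
theorem localFree_proj (T : TubeData g B x) {w y₀ u v : RSp d} (hu : u ∈ tanCone B x)
    (hv : v ∈ projCone g B x w y₀) :
    ∃ δ > 0, ∀ y, ‖y‖ < δ → ∀ v' ∈ Metric.ball v δ, ∀ s ∈ Ico 0 δ, ∀ t ∈ Ico 0 δ,
      0 < s ∨ 0 < t →
        tangentPoly g x w (pt (s • u + t • v') (y₀ + y)) ≠ 0 ∧
        ∀ ρ ∈ Ioo 0 δ, g (pt (x + ρ • (s • u + t • v')) (w + ρ • (y₀ + y))) ≠ 0 := by
  obtain ⟨δ₁, hδ₁, h1⟩ := T.exists_tube_radius hu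
  have hu' : u ∈ logCone g B x w := T.tanCone_subset_logCone w hu
  rw [T.projCone_eq] at hv
  have hpt : ∀ (ρ : ℝ) (a b : RSp d),
      pt x w + (ρ : ℂ) • (pt 0 y₀ + pt a b) = pt (x + ρ • a) (w + ρ • (y₀ + b)) := by
    intro ρ a b
    rw [← pt_add, smul_pt, ← pt_add, zero_add]
  obtain ⟨δ, hδ, H⟩ := localFree_coneFam (F := scaledGerm g (pt x w)) (z := pt 0 y₀)
    (C := logCone g B x w) (u := u) (v := v) (δ := min δ₁ 1)
    (continuous_scaledGerm T.analytic _).continuousOn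
    (fun ρ _ => analyticOnNhd_scaledGerm T.analytic _ ρ)
    (T.convex_logCone w)
    (by rw [scaledGerm_zero]; exact fun _ => T.logCone_subset_hypDirs w y₀) hu'
    (by rw [scaledGerm_zero]; exact hv) (by positivity)
    (by
      intro ρ hρ s hs y _
      -- the rescaled germs have no zeros over small multiples of `u`, by homogeneity for `ρ = 0` and by the
      -- properties of `B` for `ρ > 0`
      rcases hρ.1.eq_or_lt with h2 | h2
      · rw [← h2, scaledGerm_zero, ← pt_add, zero_add]
        exact tangentPoly_ne_zero (smul_mem_logCone hu' hs.1) _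
      · rw [scaledGerm_ne_zero_iff h2.ne', hpt, smul_smul]
        refine h1 _ ⟨mul_pos h2 hs.1, ?_⟩ u (Metric.mem_ball_self hδ₁) _
        calc ρ * s < 1 * δ₁ := mul_lt_mul'' (hρ.2.trans_le (min_le_right _ _))
              (hs.2.trans_le (min_le_left _ _)) h2.le hs.1.le
          _ = δ₁ := one_mul _)
  refine ⟨δ, hδ, fun y hy v' hv' s hs t ht hst => ⟨?_, fun ρ hρ => ?_⟩⟩
  · have := H 0 ⟨le_rfl, hδ⟩ y hy v' hv' s hs t ht hst
    rwa [scaledGerm_zero, ← pt_add, zero_add] at this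
  · have := H ρ ⟨hρ.1.le, hρ.2⟩ y hy v' hv' s hs t ht hst
    rwa [scaledGerm_ne_zero_iff hρ.1.ne', hpt] at this

/-- Lower semicontinuity of the second-level cones. -/
theorem eventually_mem_projCone (T : TubeData g B x) {w y₀ v : RSp d}
    (hv : v ∈ projCone g B x w y₀) : ∀ᶠ y in 𝓝 y₀, v ∈ projCone g B x w y := by
  obtain ⟨u, hu⟩ := T.nonempty_tanCone
  obtain ⟨δ, hδ, H⟩ := T.localFree_proj hu hv
  filter_upwards [Metric.ball_mem_nhds y₀ (half_pos hδ)] with y hy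
  rw [T.projCone_eq]
  refine mem_coneFam_of_free (analyticOnNhd_tangentPoly g x w) (T.exists_tangentPoly_ne_zero w)
    (T.tanCone_subset_logCone w hu)
    (fun _ => T.logCone_subset_hypDirs w y) (half_pos hδ) fun y' hy' v' hv' s hs t ht => ?_
  rw [← pt_add, zero_add]
  have e : y + y' = y₀ + (y - y₀ + y') := by abel
  rw [e]
  rw [Metric.mem_ball, dist_eq_norm] at hy
  refine (H _ ?_ v' (Metric.ball_subset_ball (by linarith) hv') s ⟨hs.1, by linarith [hs.2]⟩ t
    ⟨ht.1.le, by linarith [ht.2]⟩ (Or.inr ht.1)).1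
  have := norm_add_le (y - y₀) y'
  linarith

/-- Two-scale lower semicontinuity: the cones at points approaching `w` from the direction `y₀`
contain, in the limit, the second-level cone at `y₀`. -/
theorem exists_mem_logCone_of_mem_projCone (T : TubeData g B x) {w y₀ v : RSp d}
    (hv : v ∈ projCone g B x w y₀) :
    ∃ δ > 0, ∀ ρ ∈ Ioo 0 δ, ∀ y ∈ Metric.ball y₀ δ, ∀ v' ∈ Metric.ball v δ,
      v' ∈ logCone g B x (w + ρ • y) := by
  obtain ⟨u, hu⟩ := T.nonempty_tanCone
  obtain ⟨δ, hδ, H⟩ := T.localFree_proj hu hv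
  refine ⟨δ / 2, half_pos hδ, fun ρ hρ y hy v₁ hv₁ => ?_⟩
  have hρ0 := hρ.1
  refine mem_coneFam_of_free T.analytic T.exists_ne_zero hu
    (fun _ => T.tanCone_subset_hypDirs _) (δ := min (δ / 2) (ρ * (δ / 2))) (by positivity)
    fun y' hy' v' hv' s hs t ht => ?_
  rw [Metric.mem_ball, dist_eq_norm] at hy hv₁ hv'
  have e1 : s • u + t • v' = ρ • ((s / ρ) • u + (t / ρ) • v') := by
    rw [smul_add, smul_smul, smul_smul, mul_div_cancel₀ _ hρ0.ne', mul_div_cancel₀ _ hρ0.ne']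
  have e2 : w + ρ • y + y' = w + ρ • (y₀ + (y - y₀ + ρ⁻¹ • y')) := by
    simp only [smul_add, smul_sub, smul_inv_smul₀ hρ0.ne']
    abel
  have hdiv : ∀ a : ℝ, a < min (δ / 2) (ρ * (δ / 2)) → a / ρ < δ := by
    intro a ha
    rw [div_lt_iff₀ hρ0]
    have := ha.trans_le (min_le_right _ _)
    nlinarith
  rw [← pt_add, e1, e2]
  refine (H _ ?_ v' ?_ (s / ρ) ⟨div_nonneg hs.1 hρ0.le, hdiv s hs.2⟩ (t / ρ)
    ⟨div_nonneg ht.1.le hρ0.le, hdiv t ht.2⟩ (Or.inr (div_pos ht.1 hρ0))).2 ρ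
    ⟨hρ0, by linarith [hρ.2]⟩
  · have h1 := norm_add_le (y - y₀) (ρ⁻¹ • y')
    have h2 : ‖ρ⁻¹ • y'‖ < δ / 2 := by
      rw [norm_smul, norm_inv, Real.norm_of_nonneg hρ0.le, inv_mul_lt_iff₀ hρ0]
      exact hy'.trans_le (min_le_right _ _)
    linarith
  · rw [Metric.mem_ball, dist_eq_norm]
    have h1 := norm_add_le (v' - v₁) (v₁ - v)
    rw [sub_add_sub_cancel] at h1
    have := hv'.trans_le (min_le_left _ _)
    linarith

end TubeData

/-! ### Projective vector fields at the critical points -/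

theorem exists_pos_le_of_isCompact {X : Type*} [TopologicalSpace X] {K : Set X} (hK : IsCompact K)
    {f : X → ℝ} (hf : ContinuousOn f K) (hpos : ∀ y ∈ K, 0 < f y) : ∃ c > 0, ∀ y ∈ K, c ≤ f y := by
  rcases K.eq_empty_or_nonempty with rfl | hne
  · exact ⟨1, one_pos, by simp⟩
  · obtain ⟨y, hy, hmin⟩ := hK.exists_isMinOn hne hf
    exact ⟨f y, hpos y hy, fun y' hy' => hmin hy'⟩

theorem exists_pos_bound_of_isCompact {X E : Type*} [TopologicalSpace X] [NormedAddCommGroup E]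
    {K : Set X} (hK : IsCompact K) {f : X → E} (hf : ContinuousOn f K) :
    ∃ M > 0, ∀ y ∈ K, ‖f y‖ ≤ M := by
  obtain ⟨M, hM⟩ := hK.exists_bound_of_continuousOn hf
  exact ⟨max M 1, by positivity, fun y hy => (hM y hy).trans (le_max_left _ _)⟩

/-- A nonnegative combination of vectors of a convex cone, with at least one positive weight, where
only the vectors of positive weight are known to be in the cone. -/
theorem sum_smul_mem_of_cone {E ι : Type*} [AddCommGroup E] [Module ℝ E] {K : Set E}
    (hadd : ∀ v ∈ K, ∀ w ∈ K, v + w ∈ K) (hsmul : ∀ v ∈ K, ∀ c : ℝ, 0 < c → c • v ∈ K)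
    (t : Finset ι) {b : ι → ℝ} {v : ι → E} (hb : ∀ i ∈ t, 0 ≤ b i)
    (hv : ∀ i ∈ t, 0 < b i → v i ∈ K) (hex : ∃ i ∈ t, 0 < b i) : ∑ i ∈ t, b i • v i ∈ K := by
  classical
  have key : ∀ t' ⊆ t, ∑ i ∈ t', b i • v i ∈ K ∨ ∀ i ∈ t', b i = 0 := by
    intro t'
    induction t' using Finset.induction_on with
    | empty => exact fun _ => Or.inr (by simp)
    | insert i t' hi ih =>
      intro hsub
      have hit : i ∈ t := hsub (Finset.mem_insert_self i t')
      rw [Finset.sum_insert hi]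
      rcases (hb i hit).eq_or_lt with h0 | h0
      · rw [← h0, zero_smul, zero_add]
        rcases ih fun j hj => hsub (Finset.mem_insert_of_mem hj) with h | h
        · exact Or.inl h
        · refine Or.inr fun j hj => ?_
          rcases Finset.mem_insert.1 hj with rfl | hj
          · exact h0.symm
          · exact h j hj
      · have h1 := hsmul _ (hv i hit h0) _ h0
        rcases ih fun j hj => hsub (Finset.mem_insert_of_mem hj) with h | h
        · exact Or.inl (hadd _ h1 _ h)
        · rw [Finset.sum_eq_zero fun j hj => by rw [h j hj, zero_smul], add_zero]
          exact Or.inl h1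
  rcases key t subset_rfl with h | h
  · exact h
  · obtain ⟨i, hi, hpos⟩ := hex
    exact absurd (h i hi) hpos.ne'

namespace TubeData

variable {g : CSp d → ℂ} {B : Set (RSp d)} {x : RSp d}

/-- At a critical point where every zero direction is non-obstructed there is a projective field: a
partition of unity on the sphere patches vectors of the cones on which `r` is positive, and the result
is extended homogeneously and scaled. -/
theorem exists_isProjectiveField (T : TubeData g B x) {r w : RSp d} (hr : r ≠ 0)
    (hob : ∀ y : RSp d, y ≠ 0 → tangentPoly g x w (cx y) = 0 →
      ∃ v ∈ projCone g B x w y, 0 < inner ℝ r v) :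
    ∃ η, IsProjectiveField g B r x w η := by
  have hex : ∀ y : RSp d, y ≠ 0 → ∃ v ∈ projCone g B x w y, 0 < inner ℝ r v := by
    intro y hy
    by_cases h : tangentPoly g x w (cx y) = 0
    · exact hob y hy h
    · refine ⟨r, fun h0 => absurd h0 h, ?_⟩
      rw [real_inner_self_eq_norm_sq]
      positivity
  have hloc : ∀ y : RSp d, y ≠ 0 → ∃ v, 0 < inner ℝ r v ∧ ∃ δ > 0,
      ∀ y', ‖y' - y‖ < δ → v ∈ projCone g B x w y' := by
    intro y hy
    obtain ⟨v, hv, hrv⟩ := hex y hy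
    obtain ⟨δ, hδ, h⟩ := Metric.eventually_nhds_iff.1 (T.eventually_mem_projCone hv)
    exact ⟨v, hrv, δ, hδ, fun y' hy' => h (by rwa [dist_eq_norm])⟩
  choose! v hrv δ hδ hvδ using hloc
  have hS : IsCompact (Metric.sphere (0 : RSp d) 1) := isCompact_sphere _ _
  have hS0 : ∀ y ∈ Metric.sphere (0 : RSp d) 1, y ≠ 0 := by
    rintro y hy rfl
    simp at hy
  obtain ⟨t, htS, htcov⟩ := hS.elim_nhds_subcover (fun c => Metric.ball c (δ c))
    fun c hc => Metric.ball_mem_nhds c (hδ c (hS0 c hc))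
  -- bump functions; no normalization is needed, as the cones are stable under positive scaling
  let b : RSp d → RSp d → ℝ := fun c y => Real.smoothTransition (1 - ‖y - c‖ ^ 2 / δ c ^ 2)
  have hb0 : ∀ c y, 0 ≤ b c y := fun c y => Real.smoothTransition.nonneg _
  have hbpos : ∀ c ∈ t, ∀ y, 0 < b c y ↔ ‖y - c‖ < δ c := by
    intro c hc y
    have hδc : 0 < δ c := hδ c (hS0 c (htS c hc))
    constructor
    · intro h
      by_contra! hle
      refine h.ne' (Real.smoothTransition.zero_of_nonpos ?_)
      rw [sub_nonpos, one_le_div (by positivity)]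
      gcongr
    · intro h
      refine Real.smoothTransition.pos_of_pos ?_
      rw [sub_pos, div_lt_one (by positivity)]
      gcongr
  have hbs : ∀ c, ContDiff ℝ ∞ (b c) := fun c =>
    Real.smoothTransition.contDiff.comp (contDiff_const.sub
      (((contDiff_norm_sq ℝ).comp (contDiff_id.sub contDiff_const)).div_const _))
  let ζ : RSp d → RSp d := fun y => ∑ c ∈ t, b c y • v c
  have hζs : ContDiff ℝ ∞ ζ := ContDiff.sum fun c _ => (hbs c).smul contDiff_const
  have hζmem : ∀ y ∈ Metric.sphere (0 : RSp d) 1,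
      ζ y ∈ {v | v ∈ projCone g B x w y ∧ 0 < inner ℝ r v} := by
    intro y hy
    refine sum_smul_mem_of_cone ?_ ?_ t (fun c _ => hb0 c y) ?_ ?_
    · exact fun v hv v' hv' => ⟨T.add_mem_projCone hv.1 hv'.1, by
        rw [inner_add_right]; exact add_pos hv.2 hv'.2⟩
    · exact fun v hv c hc => ⟨smul_mem_projCone hv.1 hc, by
        rw [inner_smul_right]; exact mul_pos hc hv.2⟩
    · intro c hc h
      have hc0 := hS0 c (htS c hc)
      exact ⟨hvδ c hc0 y ((hbpos c hc y).1 h), hrv c hc0⟩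
    · obtain ⟨c, hc, hyc⟩ := mem_iUnion₂.1 (htcov hy)
      exact ⟨c, hc, (hbpos c hc y).2 (by rwa [← dist_eq_norm])⟩
  obtain ⟨m, hm, hmle⟩ := exists_pos_le_of_isCompact hS
    (f := fun y => inner ℝ r (ζ y)) (by have := hζs.continuous; fun_prop)
    fun y hy => (hζmem y hy).2
  obtain ⟨L, hL, hLle⟩ := exists_pos_bound_of_isCompact hS hζs.continuous.continuousOn
  -- `M` is chosen such that `M * (m / 2)` is at least `‖r'‖` for `r'` near `r`
  set M := 2 * (‖r‖ + 1) / m with hM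
  have hM0 : 0 < M := by positivity
  have hunit : ∀ y : RSp d, y ≠ 0 → ‖y‖⁻¹ • y ∈ Metric.sphere (0 : RSp d) 1 := by
    intro y hy
    rw [mem_sphere_zero_iff_norm, norm_smul, norm_inv, norm_norm,
      inv_mul_cancel₀ (norm_ne_zero_iff.2 hy)]
  refine ⟨fun y => (M * ‖y‖) • ζ (‖y‖⁻¹ • y), ⟨?_, ?_, ?_, ?_⟩⟩
  · intro c y hc
    rcases hc.eq_or_lt with rfl | hc
    · simp
    · rw [norm_smul, Real.norm_of_nonneg hc.le, smul_smul, smul_smul]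
      congr 1
      · ring
      · congr 2
        field_simp
  · intro y hy
    have hy0 : y ≠ 0 := hy
    have hn : ContDiffAt ℝ ∞ (fun y : RSp d => ‖y‖) y := contDiffAt_norm ℝ hy0
    refine ContDiffAt.contDiffWithinAt ?_
    refine (contDiffAt_const.mul hn).smul ?_
    exact hζs.contDiffAt.comp y ((hn.inv (norm_ne_zero_iff.2 hy0)).smul contDiffAt_id)
  · intro y hy
    have hy0 : 0 < ‖y‖ := norm_pos_iff.2 hy
    have h1 := (hζmem _ (hunit y hy)).1
    rw [T.projCone_smul w y (inv_ne_zero hy0.ne')] at h1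
    exact smul_mem_projCone h1 (by positivity)
  · have hnear : ∀ᶠ r' in 𝓝 r, ‖r' - r‖ < min 1 (m / (2 * L)) := by
      have : ∀ᶠ r' in 𝓝 r, dist r' r < min 1 (m / (2 * L)) :=
        Metric.ball_mem_nhds r (by positivity)
      simpa only [dist_eq_norm] using this
    filter_upwards [hnear] with r' hr' y
    by_cases hy : y = 0
    · simp [hy]
    have h1 := hmle _ (hunit y hy)
    have h2 := hLle _ (hunit y hy)
    set e := ζ (‖y‖⁻¹ • y)
    have h3 : -(m / 2) ≤ inner ℝ (r' - r) e := by
      have h4 := abs_real_inner_le_norm (r' - r) e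
      have h5 : ‖r' - r‖ * ‖e‖ ≤ m / (2 * L) * L := by
        gcongr
        exact hr'.le.trans (min_le_right _ _)
      have h6 : m / (2 * L) * L = m / 2 := by field_simp
      have := neg_abs_le (inner ℝ (r' - r) e)
      linarith
    have h4 : ‖r'‖ ≤ ‖r‖ + 1 := by
      have := norm_sub_norm_le r' r
      have := hr'.trans_le (min_le_left _ _)
      linarith
    have h5 : inner ℝ r' e = inner ℝ r e + inner ℝ (r' - r) e := by
      rw [← inner_add_left, add_sub_cancel]
    rw [inner_smul_right, h5]
    have h6 : m / 2 ≤ inner ℝ r e + inner ℝ (r' - r) e := by linarith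
    calc ‖r'‖ * ‖y‖ ≤ (‖r‖ + 1) * ‖y‖ := by gcongr
      _ = M * ‖y‖ * (m / 2) := by rw [hM]; field_simp
      _ ≤ _ := by gcongr

end TubeData

namespace IsProjectiveField

variable {g : CSp d → ℂ} {B : Set (RSp d)} {r x w : RSp d} {η : RSp d → RSp d}

theorem map_zero (h : IsProjectiveField g B r x w η) : η 0 = 0 := by
  simpa using h.homog 0 0 le_rfl

theorem inner_ge (h : IsProjectiveField g B r x w η) (y : RSp d) :
    ‖r‖ * ‖y‖ ≤ inner ℝ r (η y) := h.growth.self_of_nhds y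

theorem eq_norm_smul (h : IsProjectiveField g B r x w η) (y : RSp d) :
    η y = ‖y‖ • η (‖y‖⁻¹ • y) := by
  by_cases hy : y = 0
  · simp [hy, h.map_zero]
  · rw [← h.homog _ _ (norm_nonneg y), smul_inv_smul₀ (norm_ne_zero_iff.2 hy)]

theorem continuousOn (h : IsProjectiveField g B r x w η) : ContinuousOn η {0}ᶜ :=
  h.smooth.continuousOn

theorem exists_bound (h : IsProjectiveField g B r x w η) : ∃ L > 0, ∀ y, ‖η y‖ ≤ L * ‖y‖ := by
  obtain ⟨L, hL, hb⟩ := exists_pos_bound_of_isCompact (isCompact_sphere (0 : RSp d) 1)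
    (h.continuousOn.mono fun y hy => by rintro rfl; simp at hy)
  refine ⟨L, hL, fun y => ?_⟩
  by_cases hy : y = 0
  · simp [hy, h.map_zero]
  rw [h.eq_norm_smul, norm_smul, norm_norm, mul_comm]
  gcongr
  refine hb _ ?_
  rw [mem_sphere_zero_iff_norm, norm_smul, norm_inv, norm_norm,
    inv_mul_cancel₀ (norm_ne_zero_iff.2 hy)]

theorem continuous (h : IsProjectiveField g B r x w η) : Continuous η := by
  obtain ⟨L, hL, hb⟩ := h.exists_bound
  rw [continuous_iff_continuousAt]
  intro y
  by_cases hy : y = 0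
  · subst hy
    unfold ContinuousAt
    rw [h.map_zero]
    refine squeeze_zero_norm hb ?_
    have : Continuous fun y : RSp d => L * ‖y‖ := by fun_prop
    simpa using this.tendsto 0
  · exact h.continuousOn.continuousAt (isOpen_compl_singleton.mem_nhds hy)

end IsProjectiveField

theorem isProjectiveField_add_lat {g : CSp d → ℂ} {B : Set (RSp d)} {r x : RSp d}
    (T : TubeData g B x) (n : Fin d → ℤ) (w : RSp d) :
    IsProjectiveField g B r x (w + lat n) = IsProjectiveField g B r x w := by
  funext η
  refine propext ⟨fun h => ⟨h.homog, h.smooth, fun y hy => ?_, h.growth⟩,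
    fun h => ⟨h.homog, h.smooth, fun y hy => ?_, h.growth⟩⟩
  · rw [← T.projCone_add_lat n]; exact h.mem_cone y hy
  · rw [T.projCone_add_lat n]; exact h.mem_cone y hy

/-- Uniformity over the unit sphere of directions at a critical point. -/
theorem eventually_forall_sphere {p : ℝ → RSp d → Prop}
    (h : ∀ y : RSp d, ‖y‖ = 1 → ∃ δ > 0, ∀ ρ ∈ Ioo 0 δ, ∀ y', ‖y' - y‖ < δ → p ρ y') :
    ∃ δ > 0, ∀ ρ ∈ Ioo 0 δ, ∀ y : RSp d, ‖y‖ = 1 → p ρ y := by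
  have hev : ∀ᶠ ρ : ℝ in 𝓝 0, ∀ y ∈ Metric.sphere (0 : RSp d) 1, 0 < ρ → p ρ y := by
    refine (isCompact_sphere (0 : RSp d) 1).eventually_forall_of_forall_eventually fun y hy => ?_
    obtain ⟨δ, hδ, H⟩ := h y (by simpa using hy)
    filter_upwards [Metric.ball_mem_nhds ((0 : ℝ), y) hδ] with q hq hq0
    rw [Metric.mem_ball, Prod.dist_eq, max_lt_iff, Real.dist_0_eq_abs, dist_eq_norm] at hq
    exact H q.1 ⟨hq0, (le_abs_self _).trans_lt hq.1⟩ q.2 hq.2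
  obtain ⟨δ, hδ, H⟩ := Metric.eventually_nhds_iff.1 hev
  refine ⟨δ, hδ, fun ρ hρ y hy => H ?_ y (by simpa using hy) hρ.1⟩
  rw [Real.dist_0_eq_abs, abs_of_pos hρ.1]
  exact hρ.2

/-- Near a critical point, a projective field centered there is a section of the first-level cones. -/
theorem IsProjectiveField.exists_mem_logCone {g : CSp d → ℂ} {B : Set (RSp d)} {r x w : RSp d}
    {η : RSp d → RSp d} (T : TubeData g B x) (h : IsProjectiveField g B r x w η) :
    ∃ δ > 0, ∀ y, y ≠ w → ‖y - w‖ < δ → η (y - w) ∈ logCone g B x y := by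
  obtain ⟨δ, hδ, H⟩ := eventually_forall_sphere
    (p := fun ρ y => η y ∈ logCone g B x (w + ρ • y)) fun y hy => by
      have hy0 : y ≠ 0 := by rintro rfl; simp at hy
      obtain ⟨δ, hδ, H⟩ := T.exists_mem_logCone_of_mem_projCone (h.mem_cone y hy0)
      obtain ⟨δ', hδ', H'⟩ := Metric.continuousAt_iff.1 (h.continuous.continuousAt (x := y)) δ hδ
      refine ⟨min δ δ', by positivity, fun ρ hρ y' hy' => ?_⟩
      refine H ρ ⟨hρ.1, hρ.2.trans_le (min_le_left _ _)⟩ y' ?_ _ (H' ?_)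
      · rw [Metric.mem_ball, dist_eq_norm]; exact hy'.trans_le (min_le_left _ _)
      · rw [dist_eq_norm]; exact hy'.trans_le (min_le_right _ _)
  refine ⟨δ, hδ, fun y hy hyw => ?_⟩
  have hpos : 0 < ‖y - w‖ := norm_pos_iff.2 (sub_ne_zero.2 hy)
  have h1 := H ‖y - w‖ ⟨hpos, hyw⟩ (‖y - w‖⁻¹ • (y - w)) (by
    rw [norm_smul, norm_inv, norm_norm, inv_mul_cancel₀ hpos.ne'])
  rw [smul_inv_smul₀ hpos.ne', add_sub_cancel] at h1
  rw [h.eq_norm_smul]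
  exact TubeData.smul_mem_logCone h1 hpos

/-! ### Periodic cutoffs -/

/-- A smooth periodic function vanishing exactly on the lattice `2 π ℤ^d`. -/
def torusGauge (y : RSp d) : ℝ := ∑ i, (1 - Real.cos (y i))

theorem contDiff_torusGauge : ContDiff ℝ ∞ (torusGauge : RSp d → ℝ) := by
  unfold torusGauge
  refine ContDiff.sum fun i _ => contDiff_const.sub (Real.contDiff_cos.comp ?_)
  exact (EuclideanSpace.proj (𝕜 := ℝ) i).contDiff

theorem continuous_torusGauge : Continuous (torusGauge : RSp d → ℝ) :=
  contDiff_torusGauge.continuous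

theorem torusGauge_nonneg (y : RSp d) : 0 ≤ torusGauge y :=
  Finset.sum_nonneg fun _ _ => sub_nonneg.2 (Real.cos_le_one _)

@[simp] theorem torusGauge_zero : torusGauge (0 : RSp d) = 0 := by simp [torusGauge]

theorem torusGauge_add_lat (y : RSp d) (n : Fin d → ℤ) :
    torusGauge (y + lat n) = torusGauge y := by
  unfold torusGauge
  refine Finset.sum_congr rfl fun i _ => ?_
  simp only [PiLp.add_apply, lat]
  rw [mul_comm (2 * Real.pi), Real.cos_add_int_mul_two_pi]

theorem exists_eq_lat_of_torusGauge_eq_zero {y : RSp d} (h : torusGauge y = 0) :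
    ∃ n, y = lat n := by
  have h1 := (Finset.sum_eq_zero_iff_of_nonneg fun i _ =>
    sub_nonneg.2 (Real.cos_le_one (y i))).1 h
  have h2 : ∀ i, ∃ m : ℤ, (m : ℝ) * (2 * Real.pi) = y i := fun i =>
    (Real.cos_eq_one_iff _).1 (by linarith [h1 i (Finset.mem_univ i)])
  choose n hn using h2
  refine ⟨n, ?_⟩
  ext i
  simp only [lat]
  rw [← hn, mul_comm]

/-- Points with small `torusGauge` are close to the lattice. -/
theorem exists_torusGauge_lt {κ : ℝ} (hκ : 0 < κ) :
    ∃ δ > 0, ∀ y : RSp d, torusGauge y < δ → ∃ n, ‖y - lat n‖ < κ := by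
  have hcl : IsClosed {y : RSp d | ∀ n, κ ≤ ‖y - lat n‖} := by
    have : {y : RSp d | ∀ n, κ ≤ ‖y - lat n‖} = ⋂ n, {y | κ ≤ ‖y - lat n‖} := by
      ext; simp
    rw [this]
    exact isClosed_iInter fun n => isClosed_le continuous_const (by fun_prop)
  obtain ⟨δ, hδ, H⟩ := exists_pos_le_of_isCompact (isCompact_closedCube.inter_right hcl)
    continuous_torusGauge.continuousOn fun y hy => by
      refine lt_of_le_of_ne (torusGauge_nonneg y) fun h => ?_
      obtain ⟨n, rfl⟩ := exists_eq_lat_of_torusGauge_eq_zero h.symm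
      have := hy.2 n
      rw [sub_self, norm_zero] at this
      linarith
  refine ⟨δ, hδ, fun y hy => ?_⟩
  by_contra! hno
  obtain ⟨m, hm⟩ := exists_add_lat_mem_cube y
  have := H (y + lat m) ⟨cube_subset_closedCube hm, fun n => by
    have := hno (n - m)
    rw [sub_eq_add_neg n m, lat_add, lat_neg] at this
    have e : y + lat m - lat n = y - (lat n + -lat m) := by abel
    rwa [e]⟩
  rw [torusGauge_add_lat] at this
  linarith

/-! ### Existence of locally projective vector fields -/

theorem torusGauge_sub_add_lat (y w : RSp d) (n : Fin d → ℤ) :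
    torusGauge (y - (w + lat n)) = torusGauge (y - w) := by
  have : y - (w + lat n) = (y - w) + lat (-n) := by rw [lat_neg]; abel
  rw [this, torusGauge_add_lat]

namespace TubeData

variable {g : CSp d → ℂ} {B : Set (RSp d)} {r x : RSp d}

/-- At noncritical points the cone contains a direction on which `r` is positive. -/
theorem exists_mem_logCone_pos (hr : r ≠ 0) {y : RSp d}
    (hy : y ∉ critSet g B r x) : ∃ v ∈ logCone g B x y, 0 < inner ℝ r v := by
  by_cases h : g (pt x y) = 0
  · by_contra! hno
    exact hy ⟨h, hno⟩
  · refine ⟨r, fun h0 => absurd h0 h, ?_⟩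
    rw [real_inner_self_eq_norm_sq]
    positivity

/-- Every lattice class of critical points meets the fundamental cube. -/
theorem exists_critSet_cube (T : TubeData g B x) {w : RSp d} (hw : w ∈ critSet g B r x) :
    ∃ n, w + lat n ∈ critSet g B r x ∩ cube d :=
  let ⟨n, hn⟩ := exists_add_lat_mem_cube w
  ⟨n, (T.critSet_add_lat_iff r n w).2 hw, hn⟩

/-- A smooth periodic section of the cones, positive against `r`, away from the points at which
`torusGauge (· - w)` is small for some critical `w`. -/
theorem exists_section (T : TubeData g B x) (hr : r ≠ 0) {δ : ℝ} (hδ : 0 < δ) :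
    ∃ ζ : RSp d → RSp d, ContDiff ℝ ∞ ζ ∧ (∀ n y, ζ (y + lat n) = ζ y) ∧
      ∀ y, (∀ w ∈ critSet g B r x ∩ cube d, δ ≤ torusGauge (y - w)) →
        ζ y ∈ logCone g B x y ∧ 0 < inner ℝ r (ζ y) := by
  have hloc : ∀ c, c ∉ critSet g B r x → ∃ v, 0 < inner ℝ r v ∧ ∃ δ > 0, ∀ y,
      torusGauge (y - c) < δ → v ∈ logCone g B x y := by
    intro c hc
    obtain ⟨v, hv, hrv⟩ := exists_mem_logCone_pos hr hc
    obtain ⟨κ, hκ, h⟩ := Metric.eventually_nhds_iff.1 (T.eventually_mem_logCone hv)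
    obtain ⟨δ, hδ, H⟩ := exists_torusGauge_lt (d := d) hκ
    refine ⟨v, hrv, δ, hδ, fun y hy => ?_⟩
    obtain ⟨n, hn⟩ := H _ hy
    have h1 := h (y := y + lat (-n)) (by
      have e : y + -lat n - c = y - c - lat n := by abel
      rwa [dist_eq_norm, lat_neg, e])
    rwa [T.logCone_add_lat] at h1
  choose! v hrv ρ hρ hvρ using hloc
  let Z : Set (RSp d) := closedCube d ∩
    {y | ∀ w ∈ critSet g B r x ∩ cube d, δ ≤ torusGauge (y - w)}
  have hZc : IsCompact Z := by
    refine isCompact_closedCube.inter_right ?_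
    have : {y | ∀ w ∈ critSet g B r x ∩ cube d, δ ≤ torusGauge (y - w)}
        = ⋂ w ∈ critSet g B r x ∩ cube d, {y | δ ≤ torusGauge (y - w)} := by
      ext; simp
    rw [this]
    refine isClosed_biInter fun w _ => isClosed_le continuous_const ?_
    exact continuous_torusGauge.comp (by fun_prop)
  have hZW : ∀ c ∈ Z, c ∉ critSet g B r x := by
    intro c hc hcW
    obtain ⟨n, hn⟩ := T.exists_critSet_cube hcW
    have := hc.2 _ hn
    rw [torusGauge_sub_add_lat, sub_self, torusGauge_zero] at this
    linarith
  obtain ⟨t, htZ, htcov⟩ := hZc.elim_nhds_subcover (fun c => {y | torusGauge (y - c) < ρ c})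
    fun c hc => by
      have hcont : Continuous fun y => torusGauge (y - c) :=
        continuous_torusGauge.comp (by fun_prop)
      exact (isOpen_lt hcont continuous_const).mem_nhds
        (by simpa using hρ c (hZW c hc))
  let b : RSp d → RSp d → ℝ := fun c y => Real.smoothTransition (1 - torusGauge (y - c) / ρ c)
  have hbs : ∀ c, ContDiff ℝ ∞ (b c) := fun c =>
    Real.smoothTransition.contDiff.comp (contDiff_const.sub
      ((contDiff_torusGauge.comp (contDiff_id.sub contDiff_const)).div_const _))
  have hbpos : ∀ c ∈ t, ∀ y, 0 < b c y ↔ torusGauge (y - c) < ρ c := by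
    intro c hc y
    have hρc := hρ c (hZW c (htZ c hc))
    constructor
    · intro h
      by_contra! hle
      refine h.ne' (Real.smoothTransition.zero_of_nonpos ?_)
      rwa [sub_nonpos, one_le_div hρc]
    · intro h
      refine Real.smoothTransition.pos_of_pos ?_
      rwa [sub_pos, div_lt_one hρc]
  refine ⟨fun y => ∑ c ∈ t, b c y • v c, ContDiff.sum fun c _ => (hbs c).smul contDiff_const,
    fun n y => ?_, fun y hy => ?_⟩
  · refine Finset.sum_congr rfl fun c _ => ?_
    simp only [b]
    rw [add_sub_right_comm, torusGauge_add_lat]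
  · refine sum_smul_mem_of_cone (K := {v | v ∈ logCone g B x y ∧ 0 < inner ℝ r v}) ?_ ?_ t
      (fun c _ => Real.smoothTransition.nonneg _) ?_ ?_
    · exact fun v hv v' hv' => ⟨T.add_mem_logCone hv.1 hv'.1, by
        rw [inner_add_right]; exact add_pos hv.2 hv'.2⟩
    · exact fun v hv c hc => ⟨smul_mem_logCone hv.1 hc, by
        rw [inner_smul_right]; exact mul_pos hc hv.2⟩
    · intro c hc h
      have hc0 := hZW c (htZ c hc)
      exact ⟨hvρ c hc0 y ((hbpos c hc y).1 h), hrv c hc0⟩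
    · obtain ⟨n, hn⟩ := exists_add_lat_mem_cube y
      have hmem : y + lat n ∈ Z := ⟨cube_subset_closedCube hn, fun w hw => by
        rw [add_sub_right_comm, torusGauge_add_lat]; exact hy w hw⟩
      obtain ⟨c, hc, hyc⟩ := mem_iUnion₂.1 (htcov hmem)
      refine ⟨c, hc, (hbpos c hc y).2 ?_⟩
      have h1 : torusGauge (y + lat n - c) < ρ c := hyc
      rwa [add_sub_right_comm, torusGauge_add_lat] at h1

/-- Uniform radii for the finitely many lattice classes of critical points. -/
theorem exists_uniform_radius (T : TubeData g B x) (hfin : (critSet g B r x ∩ cube d).Finite)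
    {p : RSp d → RSp d → Prop}
    (hper : ∀ w ∈ critSet g B r x, ∀ n y, p (w + lat n) (y + lat n) → p w y)
    (h : ∀ w ∈ critSet g B r x, ∃ κ > 0, ∀ y, ‖y - w‖ < κ → p w y) :
    ∃ κ > 0, ∀ w ∈ critSet g B r x, ∀ y, ‖y - w‖ < κ → p w y := by
  have h1 : ∀ w ∈ critSet g B r x ∩ cube d,
      ∀ᶠ κ : ℝ in 𝓝[>] 0, ∀ y, ‖y - w‖ < κ → p w y := by
    intro w hw
    obtain ⟨κ, hκ, H⟩ := h w hw.1
    filter_upwards [Ioo_mem_nhdsGT hκ] with κ' hκ' y hy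
    exact H y (hy.trans hκ'.2)
  obtain ⟨κ, h2, hκ⟩ := (((eventually_all_finite hfin).2 h1).and self_mem_nhdsWithin).exists
  refine ⟨κ, hκ, fun w hw y hy => ?_⟩
  obtain ⟨n, hn⟩ := T.exists_critSet_cube hw
  exact hper w hw n y (h2 _ hn _ (by rwa [add_sub_add_right_eq_sub]))

/-- Locally projective fields exist: projective fields near the critical points are joined to a section
of the cones elsewhere by a periodic cutoff, which preserves the cones by convexity. -/
theorem exists_isLocProjField (T : TubeData g B x) (hr : r ≠ 0)
    (hfin : (critSet g B r x ∩ cube d).Finite) (hobs : NonObstructed g B r x)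
    {U : RSp d → Set (RSp d)} (hU : IsNhdFamily (critSet g B r x) U) :
    ∃ η, IsLocProjField g B r x U η := by
  classical
  set W := critSet g B r x with hW
  have hWper : ∀ n y, y + lat n ∈ W ↔ y ∈ W := T.critSet_add_lat_iff r
  -- projective fields, chosen periodically in the critical point
  let F : RSp d → RSp d → RSp d := fun w => Classical.epsilon (IsProjectiveField g B r x w)
  have hF : ∀ w ∈ W, IsProjectiveField g B r x w (F w) := fun w hw =>
    Classical.epsilon_spec (T.exists_isProjectiveField hr (hobs.2 w hw))
  have hFper : ∀ w n, F (w + lat n) = F w := fun w n => by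
    simp only [F, isProjectiveField_add_lat T]
  obtain ⟨κ, hκ, hκU⟩ := T.exists_uniform_radius hfin
    (p := fun w y => y ∈ U w ∧ (y ≠ w → F w (y - w) ∈ logCone g B x y))
    (fun w hw n y h => ⟨(hU.periodic w hw n y).1 h.1, fun hne => by
      have := h.2 (by simpa using hne)
      rwa [hFper, T.logCone_add_lat, add_sub_add_right_eq_sub] at this⟩)
    fun w hw => by
      obtain ⟨κ₁, hκ₁, h1⟩ := Metric.isOpen_iff.1 (hU.isOpen w hw) w (hU.mem w hw)
      obtain ⟨κ₂, hκ₂, h2⟩ := (hF w hw).exists_mem_logCone T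
      exact ⟨min κ₁ κ₂, by positivity, fun y hy =>
        ⟨h1 (by rw [Metric.mem_ball, dist_eq_norm]; exact hy.trans_le (min_le_left _ _)),
          fun hne => h2 y hne (hy.trans_le (min_le_right _ _))⟩⟩
  have huniq : ∀ w ∈ W, ∀ w' ∈ W, ∀ y, ‖y - w‖ < κ → ‖y - w'‖ < κ → w = w' := by
    intro w hw w' hw' y h1 h2
    by_contra hne
    exact (Set.disjoint_left.1 (hU.disjoint w hw w' hw' hne)) (hκU w hw y h1).1
      (hκU w' hw' y h2).1
  -- the projective fields, extended by zero off the balls of radius `κ` around the critical points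
  let P : RSp d → RSp d := fun y =>
    if h : ∃ w ∈ W, ‖y - w‖ < κ then F h.choose (y - h.choose) else 0
  have hP : ∀ w ∈ W, ∀ y, ‖y - w‖ < κ → P y = F w (y - w) := by
    intro w hw y hy
    have h : ∃ w ∈ W, ‖y - w‖ < κ := ⟨w, hw, hy⟩
    have h1 : h.choose = w :=
      huniq _ h.choose_spec.1 w hw y h.choose_spec.2 hy
    simp only [P, dif_pos h, h1]
  have hPpos : ∀ w ∈ W, ∀ y, ‖y - w‖ < κ → y ≠ w → 0 < inner ℝ r (P y) := by
    intro w hw y hy hne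
    rw [hP w hw y hy]
    refine lt_of_lt_of_le ?_ ((hF w hw).inner_ge _)
    have := norm_pos_iff.2 (sub_ne_zero.2 hne)
    positivity
  have hPper : ∀ n y, P (y + lat n) = P y := by
    intro n y
    by_cases h : ∃ w ∈ W, ‖y - w‖ < κ
    · obtain ⟨w, hw, hy⟩ := h
      rw [hP w hw y hy, hP (w + lat n) ((hWper n w).2 hw) (y + lat n)
        (by rwa [add_sub_add_right_eq_sub]), hFper, add_sub_add_right_eq_sub]
    · have h' : ¬ ∃ w ∈ W, ‖y + lat n - w‖ < κ := by
        rintro ⟨w, hw, hy⟩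
        refine h ⟨w + lat (-n), (hWper _ _).2 hw, ?_⟩
        have e : y - (w + -lat n) = y + lat n - w := by abel
        rwa [lat_neg, e]
      simp only [P, dif_neg h, dif_neg h']
  -- the cutoff `ψ` vanishes near the critical points and equals one off the balls of radius `κ`
  obtain ⟨δ, hδ, hδκ⟩ := exists_torusGauge_lt (d := d) hκ
  have hnear : ∀ w ∈ W, ∀ y, torusGauge (y - w) < δ → ∃ w' ∈ W, ‖y - w'‖ < κ := by
    intro w hw y hy
    obtain ⟨n, hn⟩ := hδκ _ hy
    exact ⟨w + lat n, (hWper n w).2 hw, by rwa [← sub_sub]⟩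
  let χ : RSp d → RSp d → ℝ := fun w y =>
    1 - Real.smoothTransition (2 - 4 * (torusGauge (y - w) / δ))
  let W₀ : Finset (RSp d) := hfin.toFinset
  have hW₀ : ∀ w, w ∈ W₀ ↔ w ∈ W ∩ cube d := fun w => hfin.mem_toFinset
  let ψ : RSp d → ℝ := fun y => ∏ w ∈ W₀, χ w y
  have hχ01 : ∀ w y, 0 ≤ χ w y ∧ χ w y ≤ 1 := fun w y =>
    ⟨sub_nonneg.2 (Real.smoothTransition.le_one _), by
      have := Real.smoothTransition.nonneg (2 - 4 * (torusGauge (y - w) / δ))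
      simp only [χ]; linarith⟩
  have hψ0 : ∀ y, 0 ≤ ψ y := fun y => Finset.prod_nonneg fun w _ => (hχ01 w y).1
  have hψ1 : ∀ y, ψ y ≤ 1 := fun y =>
    Finset.prod_le_one (fun w _ => (hχ01 w y).1) fun w _ => (hχ01 w y).2
  have hψs : ContDiff ℝ ∞ ψ := contDiff_prod fun w _ => contDiff_const.sub
    (Real.smoothTransition.contDiff.comp (contDiff_const.sub (contDiff_const.mul
      ((contDiff_torusGauge.comp (contDiff_id.sub contDiff_const)).div_const _))))
  have hψper : ∀ n y, ψ (y + lat n) = ψ y := by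
    intro n y
    refine Finset.prod_congr rfl fun w _ => ?_
    simp only [χ]
    rw [add_sub_right_comm, torusGauge_add_lat]
  have hψ_zero : ∀ w ∈ W₀, ∀ y, torusGauge (y - w) ≤ δ / 4 → ψ y = 0 := by
    intro w hw y hy
    refine Finset.prod_eq_zero hw ?_
    simp only [χ]
    rw [Real.smoothTransition.one_of_one_le, sub_self]
    have : torusGauge (y - w) / δ ≤ 1 / 4 := by rw [div_le_iff₀ hδ]; linarith
    linarith
  have hψ_one : ∀ y, (∀ w ∈ W₀, δ / 2 ≤ torusGauge (y - w)) → ψ y = 1 := by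
    intro y hy
    refine Finset.prod_eq_one fun w hw => ?_
    simp only [χ]
    rw [Real.smoothTransition.zero_of_nonpos, sub_zero]
    have : 1 / 2 ≤ torusGauge (y - w) / δ := by rw [le_div_iff₀ hδ]; linarith [hy w hw]
    linarith
  obtain ⟨ζ, hζs, hζper, hζ⟩ := T.exists_section hr (δ := δ / 4) (by positivity)
  have hζ' : ∀ y, ψ y ≠ 0 → ζ y ∈ logCone g B x y ∧ 0 < inner ℝ r (ζ y) := by
    intro y hy
    refine hζ y fun w hw => ?_
    by_contra! hlt
    exact hy (hψ_zero w ((hW₀ w).2 hw) y hlt.le)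
  have hcut : ∀ y, ψ y ≠ 1 → ∃ w ∈ W, ‖y - w‖ < κ := by
    intro y hy
    by_contra hno
    refine hy (hψ_one y fun w hw => ?_)
    by_contra! hlt
    exact hno (hnear w ((hW₀ w).1 hw).1 y (by linarith))
  have hrn : 0 < ‖r‖ := norm_pos_iff.2 hr
  -- the factor `‖r‖ / (r · ζ)` normalizes the section `ζ`
  let η : RSp d → RSp d := fun y => (1 - ψ y) • P y + (ψ y * (‖r‖ / inner ℝ r (ζ y))) • ζ y
  have hinner : ∀ y, inner ℝ r (η y) = (1 - ψ y) * inner ℝ r (P y) + ψ y * ‖r‖ := by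
    intro y
    simp only [η]
    rw [inner_add_right, inner_smul_right, inner_smul_right]
    congr 1
    by_cases h : ψ y = 0
    · simp [h]
    · have := (hζ' y h).2.ne'
      field_simp
  have hmemP : ∀ y ∉ W, ψ y ≠ 1 → P y ∈ logCone g B x y ∧ 0 < inner ℝ r (P y) := by
    intro y hyW hy
    obtain ⟨w, hw, hyw⟩ := hcut y hy
    have hne : y ≠ w := fun h => hyW (h ▸ hw)
    exact ⟨by rw [hP w hw y hyw]; exact (hκU w hw y hyw).2 hne, hPpos w hw y hyw hne⟩
  refine ⟨η, ⟨?_, ?_, ?_, ?_, ?_, ?_⟩⟩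
  · intro n y
    simp only [η, hψper, hPper, hζper]
  · intro y hy
    refine ContDiffAt.contDiffWithinAt (ContDiffAt.add ?_ ?_)
    · by_cases h : ∃ w ∈ W, ‖y - w‖ < κ
      · obtain ⟨w, hw, hyw⟩ := h
        have hne : y - w ≠ 0 := sub_ne_zero.2 fun h => hy (h ▸ hw)
        have h1 : ContDiffAt ℝ ∞ (fun y => F w (y - w)) y :=
          ((hF w hw).smooth.contDiffAt (isOpen_compl_singleton.mem_nhds hne)).comp y
            (contDiffAt_id.sub contDiffAt_const)
        have h2 : P =ᶠ[𝓝 y] fun y => F w (y - w) := by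
          have ho : IsOpen {y | ‖y - w‖ < κ} := isOpen_lt (by fun_prop) continuous_const
          filter_upwards [ho.mem_nhds hyw] with y' hy'
          exact hP w hw y' hy'
        exact (contDiffAt_const.sub hψs.contDiffAt).smul (h1.congr_of_eventuallyEq h2)
      · have hev : ∀ᶠ y' in 𝓝 y, ∀ w ∈ (W₀ : Set (RSp d)), δ / 2 < torusGauge (y' - w) := by
          rw [eventually_all_finite W₀.finite_toSet]
          intro w hw
          have hc : Continuous fun y => torusGauge (y - w) :=
            continuous_torusGauge.comp (by fun_prop)
          refine (hc.tendsto y).eventually (lt_mem_nhds ?_)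
          by_contra! hle
          exact h (hnear w ((hW₀ w).1 hw).1 y (by linarith))
        refine (contDiffAt_const (c := (0 : RSp d))).congr_of_eventuallyEq ?_
        filter_upwards [hev] with y' hy'
        rw [hψ_one y' fun w hw => (hy' w hw).le, sub_self, zero_smul]
    · by_cases h : ∃ w ∈ W₀, torusGauge (y - w) < δ / 4
      · obtain ⟨w, hw, hyw⟩ := h
        refine (contDiffAt_const (c := (0 : RSp d))).congr_of_eventuallyEq ?_
        have hc : Continuous fun y => torusGauge (y - w) :=
          continuous_torusGauge.comp (by fun_prop)
        filter_upwards [(hc.tendsto y).eventually (gt_mem_nhds hyw)] with y' hy'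
        rw [hψ_zero w hw y' hy'.le, zero_mul, zero_smul]
      · push Not at h
        have h1 := (hζ y fun w hw => h w ((hW₀ w).2 hw)).2.ne'
        have h2 : ContDiffAt ℝ ∞ (fun y => inner ℝ r (ζ y)) y :=
          (contDiff_const.inner ℝ hζs).contDiffAt
        exact (hψs.contDiffAt.mul (contDiffAt_const.div h2 h1)).smul hζs.contDiffAt
  · intro y hy
    by_cases h0 : ψ y = 0
    · have := (hmemP y hy (by rw [h0]; exact zero_ne_one)).1
      simpa [η, h0] using this
    have h0' : 0 < ψ y := lt_of_le_of_ne (hψ0 y) (Ne.symm h0)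
    obtain ⟨h2, h3⟩ := hζ' y h0
    have h4 : (ψ y * (‖r‖ / inner ℝ r (ζ y))) • ζ y ∈ logCone g B x y :=
      smul_mem_logCone h2 (by positivity)
    by_cases h1 : ψ y = 1
    · simpa [η, h1] using h4
    · have h1' : 0 < 1 - ψ y := sub_pos.2 (lt_of_le_of_ne (hψ1 y) h1)
      exact T.add_mem_logCone (smul_mem_logCone (hmemP y hy h1).1 h1') h4
  · intro y hy
    rw [hinner]
    by_cases h1 : ψ y = 1
    · rw [h1]; simpa using hr
    · have h1' : 0 < 1 - ψ y := sub_pos.2 (lt_of_le_of_ne (hψ1 y) h1)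
      have := (hmemP y hy h1).2
      have := hψ0 y
      positivity
  · intro y hy
    have h1 : ψ y = 1 := by
      by_contra h
      obtain ⟨w, hw, hyw⟩ := hcut y h
      exact hy w hw (hκU w hw y hyw).1
    rw [hinner, h1]
    ring
  · intro w hw
    refine ⟨F w, hF w hw, ?_⟩
    have hc : Continuous fun y => torusGauge (y - w) :=
      continuous_torusGauge.comp (by fun_prop)
    have e1 : ∀ᶠ y in 𝓝 w, torusGauge (y - w) < δ / 4 := by
      refine (hc.tendsto w).eventually (gt_mem_nhds ?_)
      rw [sub_self, torusGauge_zero]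
      positivity
    have ho : IsOpen {y | ‖y - w‖ < κ} := isOpen_lt (by fun_prop) continuous_const
    have e2 : ∀ᶠ y in 𝓝 w, ‖y - w‖ < κ := ho.mem_nhds (by simpa using hκ)
    filter_upwards [e1, e2] with y h1 h2
    obtain ⟨n, hn⟩ := T.exists_critSet_cube hw
    have h3 : ψ y = 0 := hψ_zero _ ((hW₀ _).2 hn) y (by rw [torusGauge_sub_add_lat]; exact h1.le)
    simp only [η, h3, hP w hw y h2]
    simp

end TubeData

/-! ### Regularity of locally projective vector fields -/

/-- A bound holding locally near every point of the torus holds uniformly. -/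
theorem exists_bound_of_periodic {p : RSp d → RSp d → ℝ → Prop}
    (hmono : ∀ y h L L', L ≤ L' → p y h L → p y h L')
    (hper : ∀ n y h L, p (y + lat n) h L → p y h L)
    (hloc : ∀ y₀, ∃ κ > 0, ∃ L, ∀ y h, ‖y - y₀‖ < κ → ‖h‖ < κ → p y h L) :
    ∃ κ > 0, ∃ L, ∀ y h, ‖h‖ < κ → p y h L := by
  have key : ∃ κ > 0, ∃ L, ∀ y ∈ closedCube d, ∀ h, ‖h‖ < κ → p y h L := by
    refine isCompact_closedCube.induction_on
      (p := fun s => ∃ κ > 0, ∃ L, ∀ y ∈ s, ∀ h, ‖h‖ < κ → p y h L) ?_ ?_ ?_ ?_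
    · exact ⟨1, one_pos, 0, by simp⟩
    · rintro s t hst ⟨κ, hκ, L, H⟩
      exact ⟨κ, hκ, L, fun y hy => H y (hst hy)⟩
    · rintro s t ⟨κ, hκ, L, H⟩ ⟨κ', hκ', L', H'⟩
      refine ⟨min κ κ', by positivity, max L L', fun y hy h hh => ?_⟩
      rcases hy with hy | hy
      · exact hmono _ _ _ _ (le_max_left _ _) (H y hy h (hh.trans_le (min_le_left _ _)))
      · exact hmono _ _ _ _ (le_max_right _ _) (H' y hy h (hh.trans_le (min_le_right _ _)))
    · intro y₀ _
      obtain ⟨κ, hκ, L, H⟩ := hloc y₀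
      refine ⟨Metric.ball y₀ κ, mem_nhdsWithin_of_mem_nhds (Metric.ball_mem_nhds _ hκ), κ, hκ, L,
        fun y hy h hh => H y h (by rwa [← dist_eq_norm]) hh⟩
  obtain ⟨κ, hκ, L, H⟩ := key
  refine ⟨κ, hκ, L, fun y h hh => ?_⟩
  obtain ⟨n, hn⟩ := exists_add_lat_mem_cube y
  exact hper n y h L (H _ (cube_subset_closedCube hn) h hh)

/-- The derivative of a function which is homogeneous of degree one is homogeneous of degree zero. -/
theorem IsProjectiveField.fderiv_smul {g : CSp d → ℂ} {B : Set (RSp d)} {r x w : RSp d}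
    {η : RSp d → RSp d} (h : IsProjectiveField g B r x w η) {c : ℝ} (hc : 0 < c) {y : RSp d}
    (hy : y ≠ 0) : fderiv ℝ η (c • y) = fderiv ℝ η y := by
  have hd : DifferentiableAt ℝ η y :=
    (h.smooth.contDiffAt (isOpen_compl_singleton.mem_nhds hy)).differentiableAt (by simp)
  have e : η = fun y' => c • η (c⁻¹ • y') := by
    funext y'
    rw [← h.homog _ _ hc.le, smul_inv_smul₀ hc.ne']
  have hd1 : HasFDerivAt η (fderiv ℝ η y) (c⁻¹ • c • y) := by
    rw [inv_smul_smul₀ hc.ne']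
    exact hd.hasFDerivAt
  have hs : HasFDerivAt (fun y' : RSp d => c⁻¹ • y') (c⁻¹ • ContinuousLinearMap.id ℝ (RSp d))
      (c • y) := (hasFDerivAt_id (c • y)).const_smul c⁻¹
  have h2 := (hd1.comp (c • y) hs).const_smul c
  have h3 : HasFDerivAt η
      (c • (fderiv ℝ η y).comp (c⁻¹ • ContinuousLinearMap.id ℝ (RSp d))) (c • y) := by
    exact h2.congr_of_eventuallyEq (Eventually.of_forall fun y' => congrFun e y')
  rw [h3.fderiv]
  ext v
  simp [hc.ne']

/-- A projective field is globally Lipschitz: pairs of points `a`, `b` with `‖a - b‖ < ‖a‖` are joined by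
a segment avoiding the origin, and for the other pairs homogeneity suffices. -/
theorem IsProjectiveField.exists_lipschitz {g : CSp d → ℂ} {B : Set (RSp d)} {r x w : RSp d}
    {η : RSp d → RSp d} (h : IsProjectiveField g B r x w η) :
    ∃ L > 0, ∀ a b, ‖η a - η b‖ ≤ L * ‖a - b‖ := by
  have hcd : ContinuousOn (fderiv ℝ η) {0}ᶜ :=
    h.smooth.continuousOn_fderiv_of_isOpen isOpen_compl_singleton (by simp)
  obtain ⟨L, hL, hb⟩ := exists_pos_bound_of_isCompact (isCompact_sphere (0 : RSp d) 1)
    (hcd.mono fun y hy => by rintro rfl; simp at hy)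
  obtain ⟨L', hL', hb'⟩ := h.exists_bound
  have hfd : ∀ y, y ≠ 0 → ‖fderiv ℝ η y‖ ≤ L := by
    intro y hy
    have hy' : 0 < ‖y‖ := norm_pos_iff.2 hy
    rw [← h.fderiv_smul (inv_pos.2 hy') hy]
    refine hb _ ?_
    rw [mem_sphere_zero_iff_norm, norm_smul, norm_inv, norm_norm, inv_mul_cancel₀ hy'.ne']
  refine ⟨max L (2 * L'), by positivity, fun a b => ?_⟩
  by_cases hab : ‖a - b‖ < ‖a‖
  · have hne : ∀ y ∈ Metric.ball a ‖a‖, y ≠ 0 := by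
      rintro y hy rfl
      simp at hy
    have h1 := (convex_ball a ‖a‖).norm_image_sub_le_of_norm_fderiv_le (𝕜 := ℝ) (f := η) (C := L)
      (fun y hy => (h.smooth.contDiffAt
        (isOpen_compl_singleton.mem_nhds (hne y hy))).differentiableAt (by simp))
      (fun y hy => hfd y (hne y hy)) (x := b) (y := a)
      (by rw [Metric.mem_ball, dist_comm, dist_eq_norm]; exact hab)
      (Metric.mem_ball_self ((norm_nonneg _).trans_lt hab))
    exact h1.trans (by gcongr; exact le_max_left _ _)
  · push Not at hab
    have h1 := norm_sub_le (η a) (η b)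
    have h2 : ‖b‖ ≤ 2 * ‖a - b‖ - ‖a - b‖ + ‖a‖ := by
      have := norm_sub_norm_le b a
      rw [norm_sub_rev] at this
      linarith
    by_cases hba : ‖b - a‖ < ‖b‖
    · have hne : ∀ y ∈ Metric.ball b ‖b‖, y ≠ 0 := by
        rintro y hy rfl
        simp at hy
      have h1 := (convex_ball b ‖b‖).norm_image_sub_le_of_norm_fderiv_le (𝕜 := ℝ) (f := η)
        (C := L) (fun y hy => (h.smooth.contDiffAt
          (isOpen_compl_singleton.mem_nhds (hne y hy))).differentiableAt (by simp))
        (fun y hy => hfd y (hne y hy)) (x := b) (y := a)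
        (Metric.mem_ball_self ((norm_nonneg _).trans_lt hba))
        (by rw [Metric.mem_ball, dist_comm, dist_eq_norm]; exact hba)
      exact h1.trans (by gcongr; exact le_max_left _ _)
    · push Not at hba
      rw [norm_sub_rev] at hba
      have h3 := hb' a
      have h4 := hb' b
      calc ‖η a - η b‖ ≤ L' * ‖a‖ + L' * ‖b‖ := by linarith
        _ ≤ L' * ‖a - b‖ + L' * ‖a - b‖ := by gcongr
        _ = 2 * L' * ‖a - b‖ := by ring
        _ ≤ _ := by gcongr; exact le_max_right _ _

namespace TubeData

variable {g : CSp d → ℂ} {B : Set (RSp d)} {r x : RSp d}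

theorem isClosed_critSet (T : TubeData g B x) (hr : r ≠ 0) : IsClosed (critSet g B r x) := by
  rw [← isOpen_compl_iff, isOpen_iff_mem_nhds]
  intro y hy
  obtain ⟨v, hv, hrv⟩ := exists_mem_logCone_pos hr hy
  filter_upwards [T.eventually_mem_logCone hv] with y' hy' hW
  exact absurd (hW.2 v hy') (not_le.2 hrv)

end TubeData

theorem conicNhd_mono {r : RSp d} {δ δ' : ℝ} (h : δ ≤ δ') : conicNhd r δ ⊆ conicNhd r δ' :=
  fun _ hr => ⟨hr.1, hr.2.trans_le h⟩

namespace IsLocProjField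

variable {g : CSp d → ℂ} {B : Set (RSp d)} {r x : RSp d} {U : RSp d → Set (RSp d)}
  {η : RSp d → RSp d}

theorem map_critPt (h : IsLocProjField g B r x U η) {w : RSp d} (hw : w ∈ critSet g B r x) :
    η w = 0 := by
  obtain ⟨ηw, h1, h2⟩ := h.projective w hw
  have h3 : η w = ηw (w - w) :=
    Filter.Eventually.self_of_nhds (p := fun y => η y = ηw (y - w)) h2
  rw [h3, sub_self, h1.map_zero]

theorem continuous (T : TubeData g B x) (hr : r ≠ 0) (h : IsLocProjField g B r x U η) :
    Continuous η := by
  rw [continuous_iff_continuousAt]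
  intro y
  by_cases hy : y ∈ critSet g B r x
  · obtain ⟨ηw, h1, h2⟩ := h.projective y hy
    have : Continuous fun y' => ηw (y' - y) := h1.continuous.comp (by fun_prop)
    exact this.continuousAt.congr (EventuallyEq.symm h2)
  · exact h.smooth.continuousOn.continuousAt ((T.isClosed_critSet hr).isOpen_compl.mem_nhds hy)

theorem differentiableAt (T : TubeData g B x) (hr : r ≠ 0) (h : IsLocProjField g B r x U η)
    {y : RSp d} (hy : y ∉ critSet g B r x) : DifferentiableAt ℝ η y :=
  (h.smooth.contDiffAt ((T.isClosed_critSet hr).isOpen_compl.mem_nhds hy)).differentiableAt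
    (by simp)

theorem exists_bound (T : TubeData g B x) (hr : r ≠ 0) (h : IsLocProjField g B r x U η) :
    ∃ M > 0, ∀ y, ‖η y‖ ≤ M := by
  obtain ⟨M, hM, hb⟩ := exists_pos_bound_of_isCompact isCompact_closedCube
    (h.continuous T hr).continuousOn
  refine ⟨M, hM, fun y => ?_⟩
  obtain ⟨n, hn⟩ := exists_add_lat_mem_cube y
  rw [← h.periodic n]
  exact hb _ (cube_subset_closedCube hn)

/-- A locally projective field is globally Lipschitz: it is so locally, also at the critical points, and
it is bounded. -/
theorem exists_lipschitz (T : TubeData g B x) (hr : r ≠ 0) (h : IsLocProjField g B r x U η) :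
    ∃ L > 0, ∀ a b, ‖η a - η b‖ ≤ L * ‖a - b‖ := by
  obtain ⟨M, hM, hb⟩ := h.exists_bound T hr
  obtain ⟨κ, hκ, L, hL⟩ := exists_bound_of_periodic
    (p := fun y e L => ‖η (y + e) - η y‖ ≤ L * ‖e‖)
    (fun y e L L' hLL h1 => h1.trans (by gcongr))
    (fun n y e L h1 => by rwa [add_right_comm, h.periodic, h.periodic] at h1) (by
      intro y₀
      have hlip : ∃ κ > 0, ∃ L, ∀ a b, ‖a - y₀‖ < κ → ‖b - y₀‖ < κ →
          ‖η a - η b‖ ≤ L * ‖a - b‖ := by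
        by_cases hy : y₀ ∈ critSet g B r x
        · obtain ⟨ηw, h1, h2⟩ := h.projective y₀ hy
          obtain ⟨κ, hκ, h3⟩ := Metric.eventually_nhds_iff.1 h2
          obtain ⟨L, -, h4⟩ := h1.exists_lipschitz
          refine ⟨κ, hκ, L, fun a b ha hb => ?_⟩
          rw [h3 (by rwa [dist_eq_norm]), h3 (by rwa [dist_eq_norm])]
          simpa using h4 (a - y₀) (b - y₀)
        · have h1 : ContDiffAt ℝ 1 η y₀ := (h.smooth.contDiffAt
            ((T.isClosed_critSet hr).isOpen_compl.mem_nhds hy)).of_le (by simp)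
          obtain ⟨K, t, ht, hK⟩ := h1.exists_lipschitzOnWith
          obtain ⟨κ, hκ, hball⟩ := Metric.mem_nhds_iff.1 ht
          refine ⟨κ, hκ, K, fun a b ha hb => ?_⟩
          have := hK.dist_le_mul a (hball (by rwa [Metric.mem_ball, dist_eq_norm])) b
            (hball (by rwa [Metric.mem_ball, dist_eq_norm]))
          simpa [dist_eq_norm] using this
      obtain ⟨κ, hκ, L, H⟩ := hlip
      refine ⟨κ / 2, by positivity, L, fun y e hy he => ?_⟩
      have := H (y + e) y (by
        have := norm_add_le (y - y₀) e
        rw [add_sub_right_comm]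
        linarith) (by linarith)
      rwa [add_sub_cancel_left] at this)
  refine ⟨max (max L (2 * M / κ)) 1, by positivity, fun a b => ?_⟩
  by_cases hab : ‖a - b‖ < κ
  · have := hL b (a - b) hab
    rw [add_sub_cancel] at this
    exact this.trans (by gcongr; exact (le_max_left _ _).trans (le_max_left _ _))
  · push Not at hab
    calc ‖η a - η b‖ ≤ ‖η a‖ + ‖η b‖ := norm_sub_le _ _
      _ ≤ M + M := add_le_add (hb a) (hb b)
      _ = 2 * M / κ * κ := by field_simp; ring
      _ ≤ max (max L (2 * M / κ)) 1 * ‖a - b‖ := by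
        gcongr
        exact (le_max_right _ _).trans (le_max_left _ _)

/-! ### Avoiding the zeros of `g` -/

/-- Near a critical point `w`, small displacements along `η`, combined with a direction `u` of the tangent
cone, avoid the zeros of `g`. In polar coordinates `y = w + ρ e`, the two-scale propagation applies
if the weight of `u` is small compared to `ρ`; otherwise the displacement is a small multiple of a
vector near `u`. -/
theorem eventually_free_near_critPt (T : TubeData g B x)
    (h : IsLocProjField g B r x U η) {u : RSp d} (hu : u ∈ tanCone B x) {w : RSp d}
    (hw : w ∈ critSet g B r x) :
    ∀ᶠ q : (ℝ × ℝ) × RSp d in 𝓝 ((0, 0), w), 0 ≤ q.1.1 → 0 ≤ q.1.2 →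
      (0 < q.1.1 ∨ (0 < q.1.2 ∧ q.2 ∉ critSet g B r x)) →
        g (pt (x + (q.1.1 • u + q.1.2 • η q.2)) q.2) ≠ 0 := by
  obtain ⟨ηw, hp, hev⟩ := h.projective w hw
  obtain ⟨L, hL, hLb⟩ := hp.exists_bound
  obtain ⟨δ₂, hδ₂, htube⟩ := T.exists_tube_radius hu
  have hsph : ∀ᶠ q : ℝ × ℝ × ℝ in 𝓝 (0, 0, 0), ∀ e ∈ Metric.sphere (0 : RSp d) 1,
      0 < q.1 → 0 ≤ q.2.1 → 0 ≤ q.2.2 → 0 < q.2.1 ∨ 0 < q.2.2 →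
        g (pt (x + (q.2.1 • u + q.2.2 • q.1 • ηw e)) (w + q.1 • e)) ≠ 0 := by
    refine (isCompact_sphere _ _).eventually_forall_of_forall_eventually fun e₀ he₀ => ?_
    have he₀0 : e₀ ≠ 0 := by rintro rfl; simp at he₀
    obtain ⟨δ₁, hδ₁, H⟩ := T.localFree_proj hu (hp.mem_cone e₀ he₀0)
    obtain ⟨δ₃, hδ₃, hcont⟩ := Metric.continuousAt_iff.1 (hp.continuous.continuousAt (x := e₀))
      δ₁ hδ₁
    set κ := min (min δ₁ δ₂) (min δ₃ (min 1 (δ₁ * δ₂ / (2 * L)))) with hκ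
    have hκ0 : 0 < κ := by positivity
    have hκ1 : κ ≤ δ₁ := (min_le_left _ _).trans (min_le_left _ _)
    have hκ2 : κ ≤ δ₂ := (min_le_left _ _).trans (min_le_right _ _)
    have hκ3 : κ ≤ δ₃ := (min_le_right _ _).trans (min_le_left _ _)
    have hκ4 : κ ≤ 1 :=
      (min_le_right _ _).trans ((min_le_right _ _).trans (min_le_left _ _))
    have hκ5 : κ ≤ δ₁ * δ₂ / (2 * L) :=
      (min_le_right _ _).trans ((min_le_right _ _).trans (min_le_right _ _))
    filter_upwards [Metric.ball_mem_nhds (((0 : ℝ), (0 : ℝ), (0 : ℝ)), e₀) hκ0]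
    rintro ⟨⟨ρ, s, t⟩, e⟩ hq hρ hs ht hst
    simp only [Metric.mem_ball, Prod.dist_eq, max_lt_iff, Real.dist_0_eq_abs] at hq
    obtain ⟨⟨hq1, hq2, hq3⟩, hq4⟩ := hq
    simp only at hρ hs ht hst
    rw [abs_of_pos hρ] at hq1
    rw [abs_of_nonneg hs] at hq2
    rw [abs_of_nonneg ht] at hq3
    -- the weight `s` of `u` is compared with the distance `ρ` to the critical point
    by_cases hcase : s < ρ * δ₁
    · have e1 : s • u + t • ρ • ηw e = ρ • ((s / ρ) • u + t • ηw e) := by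
        rw [smul_add, smul_smul ρ, mul_div_cancel₀ _ hρ.ne', smul_comm t ρ]
      have e2 : w + ρ • e = w + ρ • (e₀ + (e - e₀)) := by rw [add_sub_cancel]
      rw [e1, e2]
      refine (H (e - e₀) ?_ (ηw e) ?_ (s / ρ) ⟨div_nonneg hs hρ.le, ?_⟩ t ⟨ht, ?_⟩ ?_).2 ρ
        ⟨hρ, ?_⟩
      · rw [← dist_eq_norm]; linarith
      · exact hcont (by linarith)
      · rw [div_lt_iff₀ hρ]; linarith
      · linarith
      · exact hst.imp (fun h => div_pos h hρ) id
      · linarith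
    · push Not at hcase
      have hs0 : 0 < s := lt_of_lt_of_le (by positivity) hcase
      have e1 : s • u + t • ρ • ηw e = s • (u + (t * ρ / s) • ηw e) := by
        rw [smul_add, smul_smul, smul_smul, mul_div_cancel₀ _ hs0.ne']
      rw [e1]
      refine htube s ⟨hs0, by linarith⟩ _ ?_ _
      rw [Metric.mem_ball, dist_eq_norm, add_sub_cancel_left, norm_smul,
        Real.norm_of_nonneg (by positivity)]
      have he2 : ‖e‖ < 2 := by
        have h1 : ‖e₀‖ = 1 := by simpa using he₀
        have h2 := norm_sub_norm_le e e₀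
        rw [← dist_eq_norm] at h2
        linarith
      have h1 : ‖ηw e‖ < 2 * L := (hLb e).trans_lt (by nlinarith)
      have h2 : t * ρ / s ≤ t / δ₁ := by
        rw [div_le_div_iff₀ hs0 hδ₁, mul_assoc]
        exact mul_le_mul_of_nonneg_left hcase ht
      calc t * ρ / s * ‖ηw e‖ ≤ t / δ₁ * (2 * L) := by gcongr
        _ < δ₁ * δ₂ / (2 * L) / δ₁ * (2 * L) := by gcongr; linarith
        _ = δ₂ := by field_simp
  obtain ⟨κ, hκ, Hs⟩ := Metric.eventually_nhds_iff.1 hsph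
  obtain ⟨κ', hκ', hev⟩ := Metric.eventually_nhds_iff.1 hev
  set μ := min (min κ κ') δ₂ with hμ
  have hμ0 : 0 < μ := by positivity
  filter_upwards [Metric.ball_mem_nhds (((0 : ℝ), (0 : ℝ)), w) hμ0]
  rintro ⟨⟨s, t⟩, y⟩ hq hs ht hst
  simp only [Metric.mem_ball, Prod.dist_eq, max_lt_iff, Real.dist_0_eq_abs] at hq
  obtain ⟨⟨hq1, hq2⟩, hq3⟩ := hq
  have hμ1 : μ ≤ κ := (min_le_left _ _).trans (min_le_left _ _)
  have hμ2 : μ ≤ κ' := (min_le_left _ _).trans (min_le_right _ _)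
  have hμ3 : μ ≤ δ₂ := min_le_right _ _
  simp only at hs ht hst ⊢
  by_cases hyw : y = w
  · subst hyw
    have hs0 : 0 < s := hst.resolve_right fun h1 => h1.2 hw
    rw [h.map_critPt hw, smul_zero, add_zero]
    rw [abs_of_pos hs0] at hq1
    exact htube s ⟨hs0, by linarith⟩ u (Metric.mem_ball_self hδ₂) _
  · have hpos : 0 < ‖y - w‖ := norm_pos_iff.2 (sub_ne_zero.2 hyw)
    have h1 := Hs (y := (‖y - w‖, s, t)) (by
      simp only [Prod.dist_eq, max_lt_iff, Real.dist_0_eq_abs, abs_norm]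
      rw [← dist_eq_norm]
      exact ⟨by linarith, by linarith, by linarith⟩) (‖y - w‖⁻¹ • (y - w)) (by
      rw [mem_sphere_zero_iff_norm, norm_smul, norm_inv, norm_norm, inv_mul_cancel₀ hpos.ne'])
      hpos hs ht (hst.imp id fun h1 => h1.1)
    simp only at h1
    rw [← hp.eq_norm_smul, smul_inv_smul₀ hpos.ne', add_sub_cancel] at h1
    rw [hev (by linarith)]
    exact h1

/-- Small displacements along `η`, combined with a direction `u` of the tangent cone, avoid the
zeros of `g`, uniformly over the torus. -/
theorem exists_free (T : TubeData g B x) (hr : r ≠ 0)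
    (h : IsLocProjField g B r x U η) {u : RSp d} (hu : u ∈ tanCone B x) :
    ∃ δ > (0 : ℝ), ∀ y, ∀ s ∈ Ico 0 δ, ∀ t ∈ Ico 0 δ, (0 < s ∨ (0 < t ∧ y ∉ critSet g B r x)) →
      g (pt (x + (s • u + t • η y)) y) ≠ 0 := by
  have hev : ∀ᶠ q : ℝ × ℝ in 𝓝 (0, 0), ∀ y, 0 ≤ q.1 → 0 ≤ q.2 →
      (0 < q.1 ∨ (0 < q.2 ∧ y ∉ critSet g B r x)) →
        g (pt (x + (q.1 • u + q.2 • η y)) y) ≠ 0 := by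
    refine eventually_forall_of_periodic ?_ ?_
    · intro q n y hq
      rwa [T.critSet_add_lat_iff, T.periodic, h.periodic] at hq
    · intro y₀ _
      by_cases hy : y₀ ∈ critSet g B r x
      · exact h.eventually_free_near_critPt T hu hy
      · obtain ⟨δ, hδ, H⟩ := T.localFree hu (h.mem_cone y₀ hy)
        obtain ⟨δ', hδ', hc⟩ := Metric.continuousAt_iff.1
          ((h.continuous T hr).continuousAt (x := y₀)) δ hδ
        filter_upwards [Metric.ball_mem_nhds (((0 : ℝ), (0 : ℝ)), y₀)
          (lt_min hδ hδ')]
        rintro ⟨⟨s, t⟩, y⟩ hq hs ht hst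
        simp only [Metric.mem_ball, Prod.dist_eq, max_lt_iff, Real.dist_0_eq_abs, lt_min_iff] at hq
        obtain ⟨⟨⟨hq1, hq2⟩, hq3⟩, -, hq4⟩ := hq
        simp only at hs ht hst ⊢
        rw [abs_of_nonneg hs] at hq1
        rw [abs_of_nonneg ht] at hq2
        have := H (y - y₀) (by rwa [← dist_eq_norm]) (η y) (hc hq4) s ⟨hs, hq1⟩ t ⟨ht, hq2⟩
          (hst.imp id fun h1 => h1.1)
        rwa [add_sub_cancel] at this
  obtain ⟨δ, hδ, H⟩ := Metric.eventually_nhds_iff.1 hev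
  refine ⟨δ, hδ, fun y s hs t ht hst => H (y := (s, t)) ?_ y hs.1 ht.1 hst⟩
  rw [Prod.dist_eq, max_lt_iff, Real.dist_0_eq_abs, Real.dist_0_eq_abs, abs_of_nonneg hs.1,
    abs_of_nonneg ht.1]
  exact ⟨hs.2, ht.2⟩

/-! ### Lower bounds for `r' · η` -/

/-- Away from the critical points, `r' · η` is bounded below by a multiple of `|r'|`. -/
theorem exists_inner_ge_far (T : TubeData g B x) (hr : r ≠ 0)
    (h : IsLocProjField g B r x U η) {κ : ℝ} (hκ : 0 < κ) :
    ∃ c > 0, ∃ δ > 0, ∀ r' ∈ conicNhd r δ, ∀ y,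
      (∀ w ∈ critSet g B r x, κ ≤ ‖y - w‖) → c * ‖r'‖ ≤ inner ℝ r' (η y) := by
  obtain ⟨M, hM, hb⟩ := h.exists_bound T hr
  have hcl : IsClosed {y | ∀ w ∈ critSet g B r x, κ ≤ ‖y - w‖} := by
    have : {y | ∀ w ∈ critSet g B r x, κ ≤ ‖y - w‖}
        = ⋂ w ∈ critSet g B r x, {y | κ ≤ ‖y - w‖} := by ext; simp
    rw [this]
    exact isClosed_biInter fun w _ => isClosed_le continuous_const (by fun_prop)
  have hcont := h.continuous T hr
  obtain ⟨m, hm, hle⟩ := exists_pos_le_of_isCompact (isCompact_closedCube.inter_right hcl)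
    (f := fun y => inner ℝ r (η y)) (by fun_prop) fun y hy => h.pos y fun hW => by
      have := hy.2 y hW
      rw [sub_self, norm_zero] at this
      linarith
  have hrn : 0 < ‖r‖ := norm_pos_iff.2 hr
  refine ⟨m / (2 * ‖r‖), by positivity, m / (2 * ‖r‖ * M), by positivity, fun r' hr' y hy => ?_⟩
  have hr'n : 0 < ‖r'‖ := norm_pos_iff.2 hr'.1
  have h1 : m ≤ inner ℝ r (η y) := by
    obtain ⟨n, hn⟩ := exists_add_lat_mem_cube y
    have := hle (y + lat n) ⟨cube_subset_closedCube hn, fun w hw => by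
      have := hy (w + lat (-n)) ((T.critSet_add_lat_iff r _ _).2 hw)
      rw [lat_neg] at this
      have e : y + lat n - w = y - (w + -lat n) := by abel
      rwa [e]⟩
    simpa only [h.periodic] using this
  have h2 : inner ℝ r' (η y)
      = ‖r'‖ * (‖r‖⁻¹ * inner ℝ r (η y) + inner ℝ (‖r'‖⁻¹ • r' - ‖r‖⁻¹ • r) (η y)) := by
    rw [inner_sub_left, real_inner_smul_left, real_inner_smul_left]
    field_simp
    ring
  have h3 : -(m / (2 * ‖r‖)) ≤ inner ℝ (‖r'‖⁻¹ • r' - ‖r‖⁻¹ • r) (η y) := by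
    have h4 := abs_real_inner_le_norm (‖r'‖⁻¹ • r' - ‖r‖⁻¹ • r) (η y)
    have h5 : ‖‖r'‖⁻¹ • r' - ‖r‖⁻¹ • r‖ * ‖η y‖ ≤ m / (2 * ‖r‖ * M) * M := by
      have := hr'.2.le
      have := hb y
      gcongr
    have h6 : m / (2 * ‖r‖ * M) * M = m / (2 * ‖r‖) := by field_simp
    have := neg_abs_le (inner ℝ (‖r'‖⁻¹ • r' - ‖r‖⁻¹ • r) (η y))
    linarith
  rw [h2, mul_comm]
  refine mul_le_mul_of_nonneg_left ?_ hr'n.le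
  have h7 : m / ‖r‖ ≤ ‖r‖⁻¹ * inner ℝ r (η y) := by
    rw [div_eq_inv_mul]; gcongr
  have h8 : m / ‖r‖ = m / (2 * ‖r‖) + m / (2 * ‖r‖) := by field_simp; ring
  linarith

/-- Near the critical points, `r' · η ≥ |r'| |y - w|` for all `r'` close to the ray of `r`. -/
theorem exists_inner_ge_near (T : TubeData g B x) (hr : r ≠ 0)
    (hfin : (critSet g B r x ∩ cube d).Finite) (h : IsLocProjField g B r x U η) :
    ∃ δ > 0, ∀ r' ∈ conicNhd r δ, ∀ w ∈ critSet g B r x, ∀ y, ‖y - w‖ < δ →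
      ‖r'‖ * ‖y - w‖ ≤ inner ℝ r' (η y) := by
  have hrn : 0 < ‖r‖ := norm_pos_iff.2 hr
  have h1 : ∀ w ∈ critSet g B r x ∩ cube d, ∀ᶠ δ : ℝ in 𝓝[>] 0, ∀ r' ∈ conicNhd r δ, ∀ y,
      ‖y - w‖ < δ → ‖r'‖ * ‖y - w‖ ≤ inner ℝ r' (η y) := by
    intro w hw
    obtain ⟨ηw, hp, hev⟩ := h.projective w hw.1
    obtain ⟨κ, hκ, hev⟩ := Metric.eventually_nhds_iff.1 hev
    obtain ⟨κ', hκ', hgr⟩ := Metric.eventually_nhds_iff.1 hp.growth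
    have hmin : 0 < min κ (κ' / ‖r‖) := by positivity
    filter_upwards [Ioo_mem_nhdsGT hmin] with δ hδ r' hr' y hy
    have hr'n : 0 < ‖r'‖ := norm_pos_iff.2 hr'.1
    rw [hev (by rw [dist_eq_norm]; exact (hy.trans hδ.2).trans_le (min_le_left _ _))]
    have h2 := hgr (y := (‖r‖ * ‖r'‖⁻¹) • r') (by
      rw [dist_eq_norm]
      have e : (‖r‖ * ‖r'‖⁻¹) • r' - r = ‖r‖ • (‖r'‖⁻¹ • r' - ‖r‖⁻¹ • r) := by
        rw [smul_sub, smul_smul, smul_inv_smul₀ hrn.ne']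
      rw [e, norm_smul, norm_norm]
      calc ‖r‖ * ‖‖r'‖⁻¹ • r' - ‖r‖⁻¹ • r‖ < ‖r‖ * (κ' / ‖r‖) := by
            gcongr
            exact (hr'.2.trans hδ.2).trans_le (min_le_right _ _)
        _ = κ' := by field_simp) (y - w)
    rw [norm_smul, real_inner_smul_left, Real.norm_of_nonneg (by positivity), mul_assoc] at h2
    exact le_of_mul_le_mul_left h2 (by positivity)
  obtain ⟨δ, h2, hδ⟩ := (((eventually_all_finite hfin).2 h1).and self_mem_nhdsWithin).exists
  refine ⟨δ, hδ, fun r' hr' w hw y hy => ?_⟩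
  obtain ⟨n, hn⟩ := T.exists_critSet_cube hw
  have := h2 _ hn r' hr' (y + lat n) (by rwa [add_sub_add_right_eq_sub])
  rwa [add_sub_add_right_eq_sub, h.periodic] at this

/-- Balls of a uniform radius inside the neighborhoods `U w`; the closures of the other
neighborhoods do not meet them. -/
theorem _root_.LocProj.IsNhdFamily.exists_radius (T : TubeData g B x)
    (hfin : (critSet g B r x ∩ cube d).Finite) (hU : IsNhdFamily (critSet g B r x) U) :
    ∃ κ > 0, ∀ w ∈ critSet g B r x, Metric.ball w κ ⊆ U w ∧
      ∀ w' ∈ critSet g B r x, w' ≠ w → ∀ y ∈ closure (U w'), κ ≤ ‖y - w‖ := by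
  obtain ⟨κ, hκ, H⟩ := T.exists_uniform_radius hfin (p := fun w y => y ∈ U w)
    (fun w hw n y h => (hU.periodic w hw n y).1 h) fun w hw => by
      obtain ⟨κ, hκ, h1⟩ := Metric.isOpen_iff.1 (hU.isOpen w hw) w (hU.mem w hw)
      exact ⟨κ, hκ, fun y hy => h1 (by rwa [Metric.mem_ball, dist_eq_norm])⟩
  have hball : ∀ w ∈ critSet g B r x, Metric.ball w κ ⊆ U w := fun w hw y hy =>
    H w hw y (by rwa [← dist_eq_norm])
  refine ⟨κ, hκ, fun w hw => ⟨hball w hw, fun w' hw' hne y hy => ?_⟩⟩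
  by_contra! hlt
  have h1 : y ∈ Metric.ball w κ := by rwa [Metric.mem_ball, dist_eq_norm]
  obtain ⟨z, hz1, hz2⟩ := mem_closure_iff.1 hy _ Metric.isOpen_ball h1
  exact Set.disjoint_left.1 (hU.disjoint w' hw' w hw hne) hz2 (hball w hw hz1)

/-- On the closure of `U w`, `r' · η` is bounded below by a multiple of `|r'| |y - w|`. -/
theorem exists_inner_ge (T : TubeData g B x) (hr : r ≠ 0)
    (hfin : (critSet g B r x ∩ cube d).Finite) (hU : IsNhdFamily (critSet g B r x) U)
    (h : IsLocProjField g B r x U η) :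
    ∃ δ > 0, ∀ w ∈ critSet g B r x, ∃ c > 0, ∀ r' ∈ conicNhd r δ, ∀ y ∈ closure (U w),
      c * ‖r'‖ * ‖y - w‖ ≤ inner ℝ r' (η y) := by
  obtain ⟨δ₁, hδ₁, hnear⟩ := h.exists_inner_ge_near T hr hfin
  obtain ⟨κ, hκ, hrad⟩ := hU.exists_radius T hfin
  obtain ⟨c, hc, δ₂, hδ₂, hfar⟩ := h.exists_inner_ge_far T hr (lt_min hκ hδ₁)
  refine ⟨min δ₁ δ₂, by positivity, fun w hw => ?_⟩
  obtain ⟨R, hR0, hR⟩ : ∃ R > 0, ∀ y ∈ closure (U w), ‖y - w‖ ≤ R := by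
    obtain ⟨R, hR⟩ := ((hU.bounded w hw).closure).subset_closedBall w
    exact ⟨max R 1, by positivity, fun y hy => by
      have := hR hy
      rw [Metric.mem_closedBall, dist_eq_norm] at this
      exact this.trans (le_max_left _ _)⟩
  refine ⟨min 1 (c / R), by positivity, fun r' hr' y hy => ?_⟩
  by_cases hyw : ‖y - w‖ < δ₁
  · refine le_trans ?_ (hnear r' (conicNhd_mono (min_le_left _ _) hr') w hw y hyw)
    calc min 1 (c / R) * ‖r'‖ * ‖y - w‖ ≤ 1 * ‖r'‖ * ‖y - w‖ := by gcongr; exact min_le_left _ _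
      _ = _ := by rw [one_mul]
  · push Not at hyw
    refine le_trans ?_ (hfar r' (conicNhd_mono (min_le_right _ _) hr') y fun w' hw' => ?_)
    · calc min 1 (c / R) * ‖r'‖ * ‖y - w‖ ≤ c / R * ‖r'‖ * R := by
            gcongr
            · exact min_le_right _ _
            · exact hR y hy
        _ = c * ‖r'‖ := by field_simp
    · by_cases hww : w' = w
      · rw [hww]; exact (min_le_right _ _).trans hyw
      · exact (min_le_left _ _).trans ((hrad w' hw').2 w hw (Ne.symm hww) y hy)

end IsLocProjField

/-! ### Integrals concentrated at a point -/

theorem integrable_exp_neg_norm_mul_rpow (hd : 0 < d) {a β : ℝ} (ha : 0 < a) (hβ : 0 < β + d) :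
    Integrable fun y : RSp d => Real.exp (-(a * ‖y‖)) * ‖y‖ ^ β := by
  have : Nonempty (Fin d) := ⟨⟨0, hd⟩⟩
  have h1 : Integrable fun y : RSp d => Real.exp (-‖y‖) * ‖y‖ ^ β := by
    have h0 := (integrable_fun_norm_addHaar (volume : Measure (RSp d))
      (f := fun t => Real.exp (-t) * t ^ β)).2 ?_
    · exact h0
    · refine (Real.GammaIntegral_convergent hβ).congr_fun (fun t ht => ?_) measurableSet_Ioi
      have ht : 0 < t := ht
      rw [finrank_euclideanSpace, Fintype.card_fin, smul_eq_mul, ← Real.rpow_natCast,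
        mul_left_comm, ← Real.rpow_add ht, Nat.cast_sub hd, Nat.cast_one,
        show (d : ℝ) - 1 + β = β + d - 1 by ring]
  have h2 := (h1.comp_smul ha.ne').const_mul (a ^ (-β))
  refine h2.congr (Eventually.of_forall fun y => ?_)
  simp only [norm_smul, Real.norm_of_nonneg ha.le]
  rw [Real.mul_rpow ha.le (norm_nonneg _), mul_left_comm, ← mul_assoc (a ^ (-β)),
    ← Real.rpow_add ha, neg_add_cancel, Real.rpow_zero, one_mul]

/-- The shift by `σ > 0` removes the singularity at the origin, so that no condition on `β` is needed. -/
theorem integrable_exp_neg_norm_mul_add_rpow (hd : 0 < d) {a σ : ℝ} (β : ℝ) (ha : 0 < a)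
    (hσ : 0 < σ) : Integrable fun y : RSp d => Real.exp (-(a * ‖y‖)) * (‖y‖ + σ) ^ β := by
  have h0 := (integrable_exp_neg_norm_mul_rpow (d := d) hd ha (β := 0) (by simpa using hd))
  have h1 := (integrable_exp_neg_norm_mul_rpow (d := d) hd (half_pos ha) (β := 0)
    (by simpa using hd))
  simp only [Real.rpow_zero, mul_one] at h0 h1
  have hmeas : AEStronglyMeasurable (fun y : RSp d => Real.exp (-(a * ‖y‖)) * (‖y‖ + σ) ^ β) := by
    have : Continuous fun y : RSp d => Real.exp (-(a * ‖y‖)) * (‖y‖ + σ) ^ β := by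
      refine Continuous.mul (by fun_prop) (Continuous.rpow_const (by fun_prop) fun y => Or.inl ?_)
      positivity
    exact this.aestronglyMeasurable
  rcases le_or_gt β 0 with hβ | hβ
  · refine (h0.mul_const (σ ^ β)).mono' hmeas (Eventually.of_forall fun y => ?_)
    rw [Real.norm_of_nonneg (by positivity)]
    refine mul_le_mul_of_nonneg_left ?_ (Real.exp_pos _).le
    exact Real.rpow_le_rpow_of_nonpos hσ (le_add_of_nonneg_left (norm_nonneg y)) hβ
  · -- `t ^ β ≤ (β / b) ^ β * exp (b t)` for `t > 0`
    have key : ∀ t : ℝ, 0 < t → t ^ β ≤ (2 * β / a) ^ β * Real.exp (a / 2 * t) := by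
      intro t ht
      have h2 : a / (2 * β) * t ≤ Real.exp (a / (2 * β) * t) := by
        linarith [Real.add_one_le_exp (a / (2 * β) * t)]
      have h3 : t ≤ 2 * β / a * Real.exp (a / (2 * β) * t) := by
        calc t = 2 * β / a * (a / (2 * β) * t) := by field_simp
          _ ≤ _ := by gcongr
      calc t ^ β ≤ (2 * β / a * Real.exp (a / (2 * β) * t)) ^ β := by gcongr
        _ = _ := by
          rw [Real.mul_rpow (by positivity) (Real.exp_pos _).le, ← Real.exp_mul]
          congr 2
          field_simp
    refine (h1.const_mul ((2 * β / a) ^ β * Real.exp (a / 2 * σ))).mono' hmeas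
      (Eventually.of_forall fun y => ?_)
    rw [Real.norm_of_nonneg (by positivity)]
    calc Real.exp (-(a * ‖y‖)) * (‖y‖ + σ) ^ β
        ≤ Real.exp (-(a * ‖y‖)) * ((2 * β / a) ^ β * Real.exp (a / 2 * (‖y‖ + σ))) := by
          gcongr
          exact key _ (by positivity)
      _ = _ := by
          rw [mul_left_comm, mul_assoc, ← Real.exp_add, ← Real.exp_add]
          congr 2
          ring

/-- An integral dominated by a rescaled integrable function. -/
theorem integrableOn_of_scaled_bound (hd : 0 < d) {φ : RSp d → ℝ} (hφ : Integrable φ)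
    (h0 : ∀ y, 0 ≤ φ y) {a K : ℝ} (ha : 0 < a) (hK : 0 ≤ K) {S : Set (RSp d)}
    (hS : MeasurableSet S) {h : RSp d → ℂ} (hm : AEStronglyMeasurable h (volume.restrict S))
    {w : RSp d} (hb : ∀ y ∈ S, y ≠ w → ‖h y‖ ≤ K * φ (a • (y - w))) :
    IntegrableOn h S ∧ ‖∫ y in S, h y‖ ≤ K * a ^ (-(d : ℝ)) * ∫ y, φ y := by
  have : Nonempty (Fin d) := ⟨⟨0, hd⟩⟩
  have hI : Integrable fun y => K * φ (a • (y - w)) :=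
    ((hφ.comp_smul ha.ne').comp_sub_right w).const_mul K
  have hae : ∀ᵐ y ∂(volume.restrict S), ‖h y‖ ≤ K * φ (a • (y - w)) := by
    have h1 : ∀ᵐ y : RSp d ∂(volume.restrict S), y ≠ w :=
      ae_restrict_of_ae (compl_mem_ae_iff.2 (measure_singleton w))
    filter_upwards [ae_restrict_mem hS, h1] with y hy hyw using hb y hy hyw
  refine ⟨hI.integrableOn.mono' hm hae, ?_⟩
  calc ‖∫ y in S, h y‖ ≤ ∫ y in S, K * φ (a • (y - w)) :=
        norm_integral_le_of_norm_le hI.integrableOn hae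
    _ ≤ ∫ y, K * φ (a • (y - w)) :=
        setIntegral_le_integral hI (Eventually.of_forall fun y => mul_nonneg hK (h0 _))
    _ = K * a ^ (-(d : ℝ)) * ∫ y, φ y := by
        rw [integral_const_mul, integral_sub_right_eq_self (fun y => φ (a • y)),
          Measure.integral_comp_smul, finrank_euclideanSpace, Fintype.card_fin, smul_eq_mul,
          abs_of_nonneg (by positivity), Real.rpow_neg ha.le, Real.rpow_natCast, mul_assoc]

/-! ### The Jacobian of a chain -/

theorem norm_jac_le {c : RSp d → CSp d} {L : ℝ} (hL : 0 ≤ L)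
    (hc : ∀ a b, ‖c a - c b‖ ≤ L * ‖a - b‖) (y : RSp d) :
    ‖jac c y‖ ≤ (d.factorial : ℝ) * L ^ d := by
  have hf : ‖fderiv ℝ c y‖ ≤ L := norm_fderiv_le_of_lip' ℝ hL (Eventually.of_forall fun a => hc a y)
  have h := Matrix.det_le (abv := NormedField.toAbsoluteValue ℂ) (x := L)
    (A := Matrix.of fun i j : Fin d => (fderiv ℝ c y (EuclideanSpace.single j 1)) i) fun i j => by
      rw [Matrix.of_apply]
      change ‖(fderiv ℝ c y (EuclideanSpace.single j 1)) i‖ ≤ L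
      calc ‖(fderiv ℝ c y (EuclideanSpace.single j 1)) i‖
          ≤ ‖fderiv ℝ c y (EuclideanSpace.single j 1)‖ := PiLp.norm_apply_le _ _
        _ ≤ ‖fderiv ℝ c y‖ * ‖(EuclideanSpace.single j (1 : ℝ) : RSp d)‖ :=
            ContinuousLinearMap.le_opNorm _ _
        _ ≤ L * 1 := by
            gcongr
            simp
        _ = L := mul_one L
  rw [Fintype.card_fin, nsmul_eq_mul] at h
  exact h

theorem measurable_jac (c : RSp d → CSp d) : Measurable (jac c) := by
  unfold jac
  simp only [Matrix.det_apply, Matrix.of_apply]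
  refine Finset.measurable_sum _ fun σ _ => Measurable.const_smul ?_ _
  refine Finset.measurable_prod _ fun i _ => ?_
  exact (EuclideanSpace.proj (𝕜 := ℂ) (σ i)).continuous.measurable.comp
    (measurable_fderiv_apply_const ℝ c _)

/-! ### The end of the homotopy -/

theorem homotopy_eq (x u : RSp d) (η : RSp d → RSp d) (ε t : ℝ) (y : RSp d) :
    homotopy x u η ε t y = pt (x + ε • ((1 - t) • u + t • η y)) y := by
  ext i
  simp [homotopy]
  ring

theorem homotopy_one (x u : RSp d) (η : RSp d → RSp d) (ε : ℝ) (y : RSp d) :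
    homotopy x u η ε 1 y = pt (x + ε • η y) y := by
  rw [homotopy_eq]
  simp

theorem pt_sub (a b a' b' : RSp d) : pt (a - a') (b - b') = pt a b - pt a' b' := by
  ext i; simp; ring

theorem re_pair_pt (r a b : RSp d) : (pair r (pt a b)).re = inner ℝ r a := by
  simp [pair, PiLp.inner_apply, mul_comm]

theorem norm_exp_neg_pair (r a b : RSp d) :
    ‖Complex.exp (-pair r (pt a b))‖ = Real.exp (-inner ℝ r a) := by
  rw [Complex.norm_exp, Complex.neg_re, re_pair_pt]

theorem continuous_pair (r : RSp d) : Continuous (pair r) := by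
  unfold pair
  fun_prop

/-! ### Values of products of powers -/

open Classical in
/-- The indices of the factors of the singular part. -/
def singIdx (s : Fin k → ℝ) : Finset (Fin k) :=
  Finset.univ.filter fun j => ¬ ∃ n : ℕ, 0 < n ∧ s j = n

theorem mem_singIdx {s : Fin k → ℝ} {j : Fin k} :
    j ∈ singIdx s ↔ ¬ ∃ n : ℕ, 0 < n ∧ s j = n := by simp [singIdx]

theorem expPull_singularPart (Q : Fin k → MvPolynomial (Fin d) ℂ) (s : Fin k → ℝ) :
    expPull (singularPart Q s) = fun z => ∏ j ∈ singIdx s, expPull (Q j) z := by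
  funext z
  simp [expPull, singularPart, singIdx]

theorem degAt_expPull_singularPart {Q : Fin k → MvPolynomial (Fin d) ℂ} (hQ : ∀ j, Q j ≠ 0)
    (s : Fin k → ℝ) (z : CSp d) :
    degAt (expPull (singularPart Q s)) z = ∑ j ∈ singIdx s, degAt (expPull (Q j)) z := by
  rw [expPull_singularPart]
  exact (exists_prod_ne_zero_and_degAt_prod _ (fun j _ => analyticOnNhd_expPull (Q j))
    fun j _ => exists_expPull_ne_zero (hQ j)).2.2 z

theorem IsPowValue.norm_eq {q : ℂ} {s : ℝ} {v : ℂ} (h : IsPowValue q s v) : ‖v‖ = ‖q‖ ^ s := by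
  rcases h with ⟨n, -, rfl, rfl⟩ | ⟨l, rfl, rfl⟩
  · rw [norm_pow, Real.rpow_natCast]
  · rw [Complex.norm_exp, Complex.norm_exp, ← Real.exp_mul, Complex.re_ofReal_mul, mul_comm]

/-- Upper bounds of the factors and a lower bound of the singular part bound the values of the
product of powers. -/
theorem exists_bound_of_isValue (Q : Fin k → MvPolynomial (Fin d) ℂ) (s : Fin k → ℝ)
    (m : Fin k → ℕ) {c C : ℝ} (hc : 0 < c) (hC : 0 < C) :
    ∃ K > 0, ∀ (z : CSp d) (ρ : ℝ), 0 < ρ → (∀ j, ‖expPull (Q j) z‖ ≤ C * ρ ^ m j) →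
      c * ρ ^ (∑ j ∈ singIdx s, m j) ≤ ‖expPull (singularPart Q s) z‖ →
      ∀ v, IsValue Q s (fun i => Complex.exp (z i)) v → ‖v‖ ≤ K * ρ ^ (∑ j, s j * m j) := by
  classical
  -- a lower bound for the product `g` and upper bounds for its other factors give a lower bound for
  -- each factor, which is used for negative exponents
  set c' : Fin k → ℝ := fun j => c / C ^ ((singIdx s).erase j).card with hc'
  refine ⟨∏ j, max (C ^ s j) (c' j ^ s j), Finset.prod_pos fun j _ => by positivity,
    fun z ρ hρ hup hlow v hv => ?_⟩
  obtain ⟨p, hp, rfl⟩ := hv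
  rw [norm_prod, Real.rpow_sum_of_pos hρ, ← Finset.prod_mul_distrib]
  refine Finset.prod_le_prod (fun j _ => norm_nonneg _) fun j _ => ?_
  rw [(hp j).norm_eq]
  change ‖expPull (Q j) z‖ ^ s j ≤ _
  have hpow : ∀ a : ℝ, 0 < a → (a * ρ ^ m j) ^ s j = a ^ s j * ρ ^ (s j * m j) := by
    intro a ha
    rw [Real.mul_rpow ha.le (by positivity), ← Real.rpow_natCast, ← Real.rpow_mul hρ.le,
      mul_comm (s j)]
  rcases le_or_gt 0 (s j) with hs | hs
  · calc ‖expPull (Q j) z‖ ^ s j ≤ (C * ρ ^ m j) ^ s j := by gcongr; exact hup j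
      _ = C ^ s j * ρ ^ (s j * m j) := hpow C hC
      _ ≤ _ := by gcongr; exact le_max_left _ _
  · have hj : j ∈ singIdx s := mem_singIdx.2 fun ⟨n, hn, e⟩ => by
      rw [e] at hs
      exact absurd hs (not_lt.2 (Nat.cast_nonneg n))
    have h1 : c' j * ρ ^ m j ≤ ‖expPull (Q j) z‖ := by
      rw [expPull_singularPart, norm_prod, ← Finset.mul_prod_erase _ _ hj,
        ← Finset.add_sum_erase _ _ hj, pow_add] at hlow
      have h2 : ∏ i ∈ (singIdx s).erase j, ‖expPull (Q i) z‖
          ≤ C ^ ((singIdx s).erase j).card * ρ ^ (∑ i ∈ (singIdx s).erase j, m i) := by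
        rw [← Finset.prod_const, ← Finset.prod_pow_eq_pow_sum, ← Finset.prod_mul_distrib]
        exact Finset.prod_le_prod (fun i _ => norm_nonneg _) fun i _ => hup i
      have h3 : 0 < ρ ^ (∑ i ∈ (singIdx s).erase j, m i) := by positivity
      rw [hc', div_mul_eq_mul_div, div_le_iff₀ (by positivity)]
      refine le_of_mul_le_mul_right ?_ h3
      calc c * ρ ^ m j * ρ ^ (∑ i ∈ (singIdx s).erase j, m i)
          = c * (ρ ^ m j * ρ ^ (∑ i ∈ (singIdx s).erase j, m i)) := by ring
        _ ≤ _ := hlow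
        _ ≤ _ := mul_le_mul_of_nonneg_left h2 (norm_nonneg _)
        _ = _ := by ring
    calc ‖expPull (Q j) z‖ ^ s j ≤ (c' j * ρ ^ m j) ^ s j :=
          Real.rpow_le_rpow_of_nonpos (by positivity) h1 hs.le
      _ = c' j ^ s j * ρ ^ (s j * m j) := hpow _ (by positivity)
      _ ≤ _ := by gcongr; exact le_max_right _ _

/-! ### Bounds near the critical points -/

/-- An analytic function is bounded near `z` by the power given by its degree of vanishing. -/
theorem exists_norm_le_pow_degAt {f : CSp d → ℂ} (hf : AnalyticOnNhd ℂ f univ) (z : CSp d) :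
    ∃ R > 0, ∃ C > 0, ∀ h : CSp d, ‖h‖ ≤ R → ‖f (z + h)‖ ≤ C * ‖h‖ ^ degAt f z := by
  obtain ⟨R, hR, C, hC, H⟩ := exists_scaled_taylor_bound hf z
  obtain ⟨M, hM, hb⟩ := exists_pos_bound_of_isCompact (isCompact_sphere (0 : CSp d) 1)
    (continuous_homPart f z).continuousOn
  refine ⟨R, hR, max (M + C * R) ‖f z‖ + 1, by positivity, fun h hh => ?_⟩
  by_cases h0 : h = 0
  · subst h0
    by_cases hm : degAt f z = 0
    · simp only [add_zero, hm, pow_zero, mul_one]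
      linarith [le_max_right (M + C * R) ‖f z‖]
    · have hfz : f z = 0 := by
        by_contra hne
        exact hm (degAt_of_ne hne)
      rw [add_zero, hfz, norm_zero]
      positivity
  · have hn : 0 < ‖h‖ := norm_pos_iff.2 h0
    have hne : ((‖h‖ : ℝ) : ℂ) ≠ 0 := by exact_mod_cast hn.ne'
    have hu : ‖((‖h‖ : ℝ) : ℂ)⁻¹ • h‖ = 1 := by
      rw [norm_smul, norm_inv, Complex.norm_real, norm_norm, inv_mul_cancel₀ hn.ne']
    have h1 := H ((‖h‖ : ℝ) : ℂ) (((‖h‖ : ℝ) : ℂ)⁻¹ • h) hne (by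
      rw [hu, Complex.norm_real, norm_norm, mul_one]; exact hh)
    rw [smul_inv_smul₀ hne, hu, one_pow, mul_one, Complex.norm_real, norm_norm] at h1
    have h2 := hb _ (mem_sphere_zero_iff_norm.2 hu)
    have h3 : ‖f (z + h) / ((‖h‖ : ℝ) : ℂ) ^ degAt f z‖ ≤ M + C * R := by
      have := norm_sub_norm_le (f (z + h) / ((‖h‖ : ℝ) : ℂ) ^ degAt f z)
        (homPart f z (((‖h‖ : ℝ) : ℂ)⁻¹ • h))
      have h4 : C * ‖h‖ ≤ C * R := by gcongr
      linarith
    rw [norm_div, norm_pow, Complex.norm_real, norm_norm, div_le_iff₀ (by positivity)] at h3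
    refine h3.trans (mul_le_mul_of_nonneg_right ?_ (by positivity))
    linarith [le_max_left (M + C * R) ‖f z‖]

theorem TubeData.degAt_add_lat {g : CSp d → ℂ} {B : Set (RSp d)} {x : RSp d} (T : TubeData g B x)
    (n : Fin d → ℤ) (y : RSp d) : degAt g (pt x (y + lat n)) = degAt g (pt x y) :=
  (degAt_homPart_of_scaling (z := pt x y) (z' := pt x (y + lat n)) (a := 1) (b := 1)
    T.analytic T.exists_ne_zero one_ne_zero one_ne_zero fun w => by
      obtain ⟨a, b, rfl⟩ := exists_pt_eq w
      rw [one_mul, one_smul, ← pt_add, ← pt_add, ← T.periodic n (x + a) (y + b)]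
      congr 2
      abel).1

/-- A compact base of the cone of pairs `(s, e)` with `s ≥ 0`; it parametrizes the directions of the
chains near a critical point. -/
theorem isCompact_cone_base : IsCompact {q : ℝ × RSp d | 0 ≤ q.1 ∧ q.1 + ‖q.2‖ = 1} := by
  refine ((isCompact_Icc (a := (0 : ℝ)) (b := 1)).prod
    (isCompact_closedBall (0 : RSp d) 1)).of_isClosed_subset ?_ ?_
  · exact (isClosed_le continuous_const continuous_fst).inter
      (isClosed_eq (by fun_prop) continuous_const)
  · rintro ⟨s, e⟩ ⟨hs, he⟩
    simp only at hs he
    refine ⟨⟨hs, ?_⟩, ?_⟩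
    · simp only; linarith [norm_nonneg e]
    · rw [mem_closedBall_zero_iff]; simp only; linarith

/-- The homogeneous part of `g` at `w` has no zeros over the cone spanned by the imaginary space
displaced by a small multiple of the projective field and by the tangent direction `u`. -/
theorem IsProjectiveField.exists_tangentPoly_free {g : CSp d → ℂ} {B : Set (RSp d)} {r x w : RSp d}
    {η : RSp d → RSp d} (h : IsProjectiveField g B r x w η) (T : TubeData g B x) {u : RSp d}
    (hu : u ∈ tanCone B x) :
    ∃ δ > (0 : ℝ), ∀ t ∈ Ioo 0 δ, ∀ s : ℝ, 0 ≤ s → ∀ e : RSp d, s + ‖e‖ = 1 →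
      tangentPoly g x w (pt (s • u + t • η e) e) ≠ 0 := by
  have hK := isCompact_cone_base (d := d)
  have hc : Continuous (tangentPoly g x w) := continuous_homPart _ _
  have hη := h.continuous
  have hev : ∀ᶠ t : ℝ in 𝓝 0, ∀ q ∈ {q : ℝ × RSp d | 0 ≤ q.1 ∧ q.1 + ‖q.2‖ = 1}, 0 < t → 0 ≤ q.1 →
      tangentPoly g x w (pt (q.1 • u + t • η q.2) q.2) ≠ 0 := by
    refine hK.eventually_forall_of_forall_eventually ?_
    rintro ⟨s₀, e₀⟩ ⟨hs₀, he₀⟩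
    simp only at hs₀ he₀
    -- if `s₀ = 0` the second-level cone at `e₀` is used; if `s₀ > 0` then, for `t = 0`, the real part is a
    -- multiple of `u`
    rcases hs₀.eq_or_lt with rfl | hs₀
    · rw [zero_add] at he₀
      have he0 : e₀ ≠ 0 := by rintro rfl; simp at he₀
      obtain ⟨δ, hδ, H⟩ := T.localFree_proj hu (h.mem_cone e₀ he0)
      obtain ⟨δ', hδ', hc⟩ := Metric.continuousAt_iff.1 (hη.continuousAt (x := e₀)) δ hδ
      filter_upwards [Metric.ball_mem_nhds ((0 : ℝ), ((0 : ℝ), e₀)) (lt_min hδ hδ')]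
      rintro ⟨t, s, e⟩ hq ht hs
      simp only [Metric.mem_ball, Prod.dist_eq, max_lt_iff, Real.dist_0_eq_abs, lt_min_iff] at hq
      obtain ⟨⟨hq1, hq2, hq3⟩, -, -, hq4⟩ := hq
      simp only at ht hs ⊢
      rw [abs_of_nonneg hs] at hq2
      rw [abs_of_pos ht] at hq1
      have := (H (e - e₀) (by rwa [← dist_eq_norm]) (η e) (hc hq4) s ⟨hs, hq2⟩ t ⟨ht.le, hq1⟩
        (Or.inr ht)).1
      rwa [add_sub_cancel] at this
    · have hne : tangentPoly g x w (pt (s₀ • u + (0 : ℝ) • η e₀) e₀) ≠ 0 := by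
        rw [zero_smul, add_zero]
        exact TubeData.tangentPoly_ne_zero
          (TubeData.smul_mem_logCone (T.tanCone_subset_logCone w hu) hs₀) _
      have hcont : Continuous fun q : ℝ × ℝ × RSp d =>
          tangentPoly g x w (pt (q.2.1 • u + q.1 • η q.2.2) q.2.2) :=
        hc.comp (Continuous.pt (by fun_prop) (by fun_prop))
      filter_upwards [hcont.continuousAt.eventually_ne (x := (0, (s₀, e₀))) hne] with q hq _ _
        using hq
  obtain ⟨δ, hδ, H⟩ := Metric.eventually_nhds_iff.1 hev
  refine ⟨δ, hδ, fun t ht s hs e hse => H (y := t) ?_ (s, e) ⟨hs, hse⟩ ht.1 hs⟩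
  rw [Real.dist_0_eq_abs, abs_of_pos ht.1]
  exact ht.2

/-- Near a critical point, `|g|` on the displaced chain is bounded below by the power, given by the degree
of `g`, of the distance: its homogeneous part is bounded below on the compact set of directions. -/
theorem IsLocProjField.exists_lower_bound_near {g : CSp d → ℂ} {B : Set (RSp d)} {r x : RSp d}
    {U : RSp d → Set (RSp d)} {η : RSp d → RSp d} (T : TubeData g B x)
    (hfin : (critSet g B r x ∩ cube d).Finite) (h : IsLocProjField g B r x U η) {u : RSp d}
    (hu : u ∈ tanCone B x) :
    ∃ δ > (0 : ℝ), ∀ w ∈ critSet g B r x, ∀ ε ∈ Ioo 0 δ, ∃ c > 0, ∃ κ > 0, ∀ σ ∈ Ico 0 κ, ∀ y,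
      ‖y - w‖ < κ → (0 < σ ∨ y ≠ w) →
        c * (‖y - w‖ + σ) ^ degAt g (pt x w) ≤ ‖g (pt (x + (σ • u + ε • η y)) y)‖ := by
  have h1 : ∀ w ∈ critSet g B r x ∩ cube d, ∀ᶠ ε : ℝ in 𝓝[>] 0, ∃ c > 0, ∃ κ > 0,
      ∀ σ ∈ Ico 0 κ, ∀ y, ‖y - w‖ < κ → (0 < σ ∨ y ≠ w) →
        c * (‖y - w‖ + σ) ^ degAt g (pt x w) ≤ ‖g (pt (x + (σ • u + ε • η y)) y)‖ := by
    rintro w ⟨hw, -⟩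
    obtain ⟨ηw, hp, hev⟩ := h.projective w hw
    obtain ⟨δ, hδ, H⟩ := hp.exists_tangentPoly_free T hu
    obtain ⟨κ₀, hκ₀, hev⟩ := Metric.eventually_nhds_iff.1 hev
    obtain ⟨R, hR, C, hC, HT⟩ := exists_scaled_taylor_bound T.analytic (pt x w)
    filter_upwards [Ioo_mem_nhdsGT hδ] with ε hε
    have hK := isCompact_cone_base (d := d)
    have hη := hp.continuous
    have hpt : Continuous fun q : ℝ × RSp d => pt (q.1 • u + ε • ηw q.2) q.2 :=
      Continuous.pt (by fun_prop) (by fun_prop)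
    have hc : Continuous (tangentPoly g x w) := continuous_homPart _ _
    obtain ⟨c, hc0, hlow⟩ := exists_pos_le_of_isCompact hK (hc.comp hpt).norm.continuousOn
      fun q hq => norm_pos_iff.2 (H ε hε q.1 hq.1 q.2 hq.2)
    obtain ⟨M, hM, hup⟩ := exists_pos_bound_of_isCompact hK hpt.continuousOn
    set m := degAt g (pt x w) with hm
    set κ := min (κ₀) (min (R / (2 * M)) (c / (4 * (C * M ^ (m + 1))))) with hκ
    have hκ1 : κ ≤ κ₀ := min_le_left _ _
    have hκ2 : κ ≤ R / (2 * M) := (min_le_right _ _).trans (min_le_left _ _)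
    have hκ3 : κ ≤ c / (4 * (C * M ^ (m + 1))) := (min_le_right _ _).trans (min_le_right _ _)
    refine ⟨c / 2, by positivity, κ, by positivity, fun σ hσ y hy hne => ?_⟩
    set ρ := ‖y - w‖ + σ with hρ
    have hρ0 : 0 < ρ := by
      rcases hne with h0 | h0
      · positivity
      · have : 0 < ‖y - w‖ := norm_pos_iff.2 (sub_ne_zero.2 h0)
        linarith [hσ.1]
    have hρκ : ρ ≤ 2 * κ := by linarith [hσ.2]
    have hρc : ((ρ : ℝ) : ℂ) ≠ 0 := by exact_mod_cast hρ0.ne'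
    have hq : ((ρ⁻¹ * σ, ρ⁻¹ • (y - w)) : ℝ × RSp d) ∈
        {q : ℝ × RSp d | 0 ≤ q.1 ∧ q.1 + ‖q.2‖ = 1} := by
      refine ⟨mul_nonneg (by positivity) hσ.1, ?_⟩
      simp only [norm_smul, norm_inv, Real.norm_of_nonneg hρ0.le]
      rw [← mul_add, add_comm σ, ← hρ, inv_mul_cancel₀ hρ0.ne']
    have h2 := hlow _ hq
    have h3 := hup _ hq
    simp only [Function.comp] at h2 h3
    have h4 := HT ρ (pt ((ρ⁻¹ * σ) • u + ε • ηw (ρ⁻¹ • (y - w))) (ρ⁻¹ • (y - w))) hρc (by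
      rw [Complex.norm_real, Real.norm_of_nonneg hρ0.le]
      calc ρ * _ ≤ (2 * (R / (2 * M))) * M := by gcongr; linarith
        _ = R := by field_simp)
    have e1 : pt x w + (ρ : ℂ) • pt ((ρ⁻¹ * σ) • u + ε • ηw (ρ⁻¹ • (y - w))) (ρ⁻¹ • (y - w))
        = pt (x + (σ • u + ε • η y)) y := by
      rw [smul_pt, ← pt_add, smul_inv_smul₀ hρ0.ne', add_sub_cancel, smul_add, smul_smul ρ,
        mul_inv_cancel_left₀ hρ0.ne', smul_comm ρ ε, ← hp.homog _ _ hρ0.le, smul_inv_smul₀ hρ0.ne',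
        hev (by rw [dist_eq_norm]; exact hy.trans_le hκ1)]
    rw [e1, Complex.norm_real, Real.norm_of_nonneg hρ0.le] at h4
    have h5 : C * ρ * ‖pt ((ρ⁻¹ * σ) • u + ε • ηw (ρ⁻¹ • (y - w))) (ρ⁻¹ • (y - w))‖ ^ (m + 1)
        ≤ c / 2 := by
      calc _ ≤ C * (2 * (c / (4 * (C * M ^ (m + 1))))) * M ^ (m + 1) := by gcongr; linarith
        _ = c / 2 := by field_simp; norm_num
    have h6 : c / 2 ≤ ‖g (pt (x + (σ • u + ε • η y)) y) / (ρ : ℂ) ^ m‖ := by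
      have := norm_sub_norm_le (tangentPoly g x w
        (pt ((ρ⁻¹ * σ) • u + ε • ηw (ρ⁻¹ • (y - w))) (ρ⁻¹ • (y - w))))
        (g (pt (x + (σ • u + ε • η y)) y) / (ρ : ℂ) ^ m)
      rw [norm_sub_rev] at this
      unfold tangentPoly at this h2
      linarith
    rwa [norm_div, norm_pow, Complex.norm_real, Real.norm_of_nonneg hρ0.le,
      le_div_iff₀ (by positivity)] at h6
  have h2 := (eventually_all_finite hfin).2 h1
  obtain ⟨δ, hδ, H⟩ := mem_nhdsGT_iff_exists_Ioo_subset.1 h2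
  refine ⟨δ, hδ, fun w hw ε hε => ?_⟩
  obtain ⟨n, hn⟩ := T.exists_critSet_cube hw
  obtain ⟨c, hc, κ, hκ, H'⟩ := H hε _ hn
  refine ⟨c, hc, κ, hκ, fun σ hσ y hy hne => ?_⟩
  have := H' σ hσ (y + lat n) (by rwa [add_sub_add_right_eq_sub])
    (hne.imp id fun h0 h1 => h0 (add_right_cancel h1))
  rwa [add_sub_add_right_eq_sub, T.degAt_add_lat, T.periodic, h.periodic] at this

/-! ### Bounds of the values of `F` along the deformed chain -/

theorem continuous_expPull (Q : MvPolynomial (Fin d) ℂ) : Continuous (expPull Q) := by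
  have h := (analyticOnNhd_expPull Q).continuousOn
  rwa [continuousOn_univ] at h

/-- On compact sets without zeros of the singular part, all values of `F` are bounded. -/
theorem exists_isValue_bound_of_isCompact (Q : Fin k → MvPolynomial (Fin d) ℂ) (s : Fin k → ℝ)
    {S : Set (CSp d)} (hS : IsCompact S) (hne : ∀ z ∈ S, expPull (singularPart Q s) z ≠ 0) :
    ∃ K > 0, ∀ z ∈ S, ∀ v, IsValue Q s (fun i => Complex.exp (z i)) v → ‖v‖ ≤ K := by
  obtain ⟨c, hc, hlow⟩ := exists_pos_le_of_isCompact hS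
    (continuous_expPull (singularPart Q s)).norm.continuousOn fun z hz => norm_pos_iff.2 (hne z hz)
  have h1 : ∀ j, ∃ C > 0, ∀ z ∈ S, ‖expPull (Q j) z‖ ≤ C := fun j =>
    exists_pos_bound_of_isCompact hS (continuous_expPull (Q j)).continuousOn
  choose C hC hup using h1
  obtain ⟨K, hK, H⟩ := exists_bound_of_isValue Q s (fun _ => 0) hc
    (show 0 < ∑ j, C j + 1 from add_pos_of_nonneg_of_pos
      (Finset.sum_nonneg fun j _ => (hC j).le) one_pos)
  refine ⟨K, hK, fun z hz v hv => ?_⟩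
  have := H z 1 one_pos (fun j => ?_) (by simpa using hlow z hz) v hv
  · simpa using this
  · rw [pow_zero, mul_one]
    have := Finset.single_le_sum (fun j _ => (hC j).le) (Finset.mem_univ j)
    linarith [hup j z hz]

namespace IsLocProjField

variable {Q : Fin k → MvPolynomial (Fin d) ℂ} {s : Fin k → ℝ} {g : CSp d → ℂ} {B : Set (RSp d)}
  {r x : RSp d} {U : RSp d → Set (RSp d)} {η : RSp d → RSp d}

/-- Near a critical point, the values of `F` on the displaced chain are bounded by the power of the
distance given by the degree of `f`. -/
theorem exists_isValue_bound_near (hQ : ∀ j, Q j ≠ 0) (hg : g = expPull (singularPart Q s))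
    (T : TubeData g B x) (hr : r ≠ 0)
    (hfin : (critSet g B r x ∩ cube d).Finite) (h : IsLocProjField g B r x U η) {u : RSp d}
    (hu : u ∈ tanCone B x) :
    ∃ δ > (0 : ℝ), ∀ w ∈ critSet g B r x, ∀ ε ∈ Ioo 0 δ, ∃ K > 0, ∃ κ > 0, ∀ σ ∈ Ico 0 κ, ∀ y,
      ‖y - w‖ < κ → (0 < σ ∨ y ≠ w) →
        ∀ v, IsValue Q s (fun i => Complex.exp (pt (x + (σ • u + ε • η y)) y i)) v →
          ‖v‖ ≤ K * (‖y - w‖ + σ) ^ degF Q s (pt x w) := by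
  obtain ⟨δ, hδ, H⟩ := h.exists_lower_bound_near T hfin hu
  obtain ⟨L, hL, hlip⟩ := h.exists_lipschitz T hr
  refine ⟨δ, hδ, fun w hw ε hε => ?_⟩
  obtain ⟨c, hc, κ, hκ, hlow⟩ := H w hw ε hε
  have h1 : ∀ j, ∃ R > 0, ∃ C > 0, ∀ e : CSp d, ‖e‖ ≤ R →
      ‖expPull (Q j) (pt x w + e)‖ ≤ C * ‖e‖ ^ degAt (expPull (Q j)) (pt x w) := fun j =>
    exists_norm_le_pow_degAt (analyticOnNhd_expPull (Q j)) _
  choose R hR C hC hup using h1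
  obtain ⟨R₀, hR₀, hRle⟩ : ∃ R₀ > 0, ∀ j, R₀ ≤ R j := by
    have := (eventually_all (l := 𝓝[>] (0 : ℝ)) (p := fun (j : Fin k) (t : ℝ) => t ≤ R j)).2
      fun j => by filter_upwards [Ioo_mem_nhdsGT (hR j)] with t ht using ht.2.le
    obtain ⟨R₀, h1, h2⟩ := (this.and self_mem_nhdsWithin).exists
    exact ⟨R₀, h2, h1⟩
  set N := ‖u‖ + ε * L + 1 with hN
  have hε0 : 0 < ε := hε.1
  have hN1 : 1 ≤ N := by rw [hN]; linarith [norm_nonneg u, mul_pos hε0 hL]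
  have hN0 : 0 < N := by linarith
  have hC1 : ∀ j, C j * N ^ degAt (expPull (Q j)) (pt x w)
      ≤ ∑ j, C j * N ^ degAt (expPull (Q j)) (pt x w) + 1 := fun j => by
    have := Finset.single_le_sum (f := fun j => C j * N ^ degAt (expPull (Q j)) (pt x w))
      (fun j _ => (mul_pos (hC j) (by positivity)).le) (Finset.mem_univ j)
    linarith
  have hC0 : 0 < ∑ j, C j * N ^ degAt (expPull (Q j)) (pt x w) + 1 :=
    add_pos_of_nonneg_of_pos
      (Finset.sum_nonneg fun j _ => (mul_pos (hC j) (by positivity)).le) one_pos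
  obtain ⟨K, hK, HK⟩ := exists_bound_of_isValue Q s
    (fun j => degAt (expPull (Q j)) (pt x w)) hc hC0
  refine ⟨K, hK, min κ (R₀ / (2 * N)), by positivity, fun σ hσ y hy hne v hv => ?_⟩
  have hσκ : σ < κ := hσ.2.trans_le (min_le_left _ _)
  have hyκ : ‖y - w‖ < κ := hy.trans_le (min_le_left _ _)
  have hσR : σ < R₀ / (2 * N) := hσ.2.trans_le (min_le_right _ _)
  have hyR : ‖y - w‖ < R₀ / (2 * N) := hy.trans_le (min_le_right _ _)
  set ρ := ‖y - w‖ + σ with hρ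
  have hρ0 : 0 < ρ := by
    rcases hne with h0 | h0
    · positivity
    · have : 0 < ‖y - w‖ := norm_pos_iff.2 (sub_ne_zero.2 h0)
      linarith [hσ.1]
  have e1 : pt (x + (σ • u + ε • η y)) y = pt x w + pt (σ • u + ε • η y) (y - w) := by
    rw [← pt_add, add_sub_cancel]
  have hnorm : ‖pt (σ • u + ε • η y) (y - w)‖ ≤ N * ρ := by
    have h2 := hlip y w
    rw [h.map_critPt hw, sub_zero] at h2
    calc ‖pt (σ • u + ε • η y) (y - w)‖ ≤ ‖σ • u + ε • η y‖ + ‖y - w‖ := norm_pt_le _ _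
      _ ≤ ‖σ • u‖ + ‖ε • η y‖ + ‖y - w‖ := by gcongr; exact norm_add_le _ _
      _ = σ * ‖u‖ + ε * ‖η y‖ + ‖y - w‖ := by
          rw [norm_smul, norm_smul, Real.norm_of_nonneg hσ.1, Real.norm_of_nonneg hε0.le]
      _ ≤ σ * ‖u‖ + ε * (L * ‖y - w‖) + ‖y - w‖ := by gcongr
      _ ≤ N * ρ := by
          rw [hN, hρ]
          have h3 := mul_nonneg (norm_nonneg u) (norm_nonneg (y - w))
          have h4 := mul_nonneg (mul_nonneg hε0.le hL.le) hσ.1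
          nlinarith [hσ.1]
  refine HK _ ρ hρ0 (fun j => ?_) ?_ v hv
  · rw [e1]
    refine (hup j _ ?_).trans ?_
    · refine le_trans ?_ (hRle j)
      calc _ ≤ N * ρ := hnorm
        _ ≤ N * (R₀ / (2 * N) + R₀ / (2 * N)) := by
            gcongr
            exact add_le_add hyR.le hσR.le
        _ = R₀ := by field_simp; norm_num
    · calc C j * ‖pt (σ • u + ε • η y) (y - w)‖ ^ degAt (expPull (Q j)) (pt x w)
          ≤ C j * (N * ρ) ^ degAt (expPull (Q j)) (pt x w) := by
            have := (hC j).le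
            gcongr
        _ = C j * N ^ degAt (expPull (Q j)) (pt x w) * ρ ^ degAt (expPull (Q j)) (pt x w) := by
            rw [mul_pow, mul_assoc]
        _ ≤ _ := mul_le_mul_of_nonneg_right (hC1 j) (by positivity)
  · rw [← degAt_expPull_singularPart hQ, ← hg]
    exact hlow σ ⟨hσ.1, hσκ⟩ y hyκ hne

/-- The value bound on the whole closure of a bounded neighborhood of `w` that stays away from the
other critical points. -/
theorem exists_isValue_bound (hQ : ∀ j, Q j ≠ 0) (hg : g = expPull (singularPart Q s))
    (T : TubeData g B x) (hr : r ≠ 0)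
    (hfin : (critSet g B r x ∩ cube d).Finite) (hU : IsNhdFamily (critSet g B r x) U)
    (h : IsLocProjField g B r x U η) {u : RSp d}
    (hu : u ∈ tanCone B x) :
    ∃ δ > (0 : ℝ), ∀ w ∈ critSet g B r x, ∀ ε ∈ Ioo 0 δ, ∃ K > 0, ∀ y ∈ closure (U w), y ≠ w →
        ∀ v, IsValue Q s (fun i => Complex.exp (pt (x + ε • η y) y i)) v →
          ‖v‖ ≤ K * ‖y - w‖ ^ degF Q s (pt x w) := by
  obtain ⟨δ₁, hδ₁, hnear⟩ := h.exists_isValue_bound_near hQ hg T hr hfin hu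
  obtain ⟨δ₂, hδ₂, hfree⟩ := h.exists_free T hr hu
  obtain ⟨κ₀, hκ₀, hrad⟩ := hU.exists_radius T hfin
  refine ⟨min δ₁ δ₂, by positivity, fun w hw ε hε => ?_⟩
  have hε₁ : ε < δ₁ := hε.2.trans_le (min_le_left _ _)
  have hε₂ : ε < δ₂ := hε.2.trans_le (min_le_right _ _)
  obtain ⟨K₁, hK₁, κ, hκ, H₁⟩ := hnear w hw ε ⟨hε.1, hε₁⟩
  have hcpt : IsCompact (closure (U w) ∩ {y | κ ≤ ‖y - w‖}) :=
    ((hU.bounded w hw).isCompact_closure).inter_right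
      (isClosed_le continuous_const (by fun_prop))
  have hη := h.continuous T hr
  have hS := hcpt.image (f := fun y => pt (x + ε • η y) y)
    (Continuous.pt (by fun_prop) (by fun_prop))
  obtain ⟨K₂, hK₂, H₂⟩ := exists_isValue_bound_of_isCompact Q s hS (by
    rintro _ ⟨y, ⟨hy, hyκ⟩, rfl⟩
    have := hfree y 0 ⟨le_rfl, hδ₂⟩ ε ⟨hε.1.le, hε₂⟩ (Or.inr ⟨hε.1, fun hyW => ?_⟩)
    · rw [zero_smul, zero_add] at this
      rwa [← hg]
    · by_cases hyw : y = w
      · rw [hyw, mem_ofPred_eq, sub_self, norm_zero] at hyκ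
        linarith
      · have := (hrad y hyW).2 w hw (Ne.symm hyw) y hy
        rw [sub_self, norm_zero] at this
        linarith)
  obtain ⟨c, hc, hlow⟩ := exists_pos_le_of_isCompact hcpt
    (f := fun y => ‖y - w‖ ^ degF Q s (pt x w))
    (ContinuousOn.rpow_const (by fun_prop) fun y hy => Or.inl (by
      have : κ ≤ ‖y - w‖ := hy.2
      linarith)) fun y hy => by
        have : κ ≤ ‖y - w‖ := hy.2
        have : 0 < ‖y - w‖ := by linarith
        positivity
  refine ⟨max K₁ (K₂ / c), by positivity, fun y hy hyw v hv => ?_⟩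
  by_cases hyκ : ‖y - w‖ < κ
  · have := H₁ 0 ⟨le_rfl, hκ⟩ y hyκ (Or.inr hyw) v (by rwa [zero_smul, zero_add])
    rw [add_zero] at this
    refine this.trans (mul_le_mul_of_nonneg_right (le_max_left _ _) (by positivity))
  · push Not at hyκ
    calc ‖v‖ ≤ K₂ := H₂ _ ⟨y, ⟨hy, hyκ⟩, rfl⟩ v hv
      _ = K₂ / c * c := by field_simp
      _ ≤ max K₁ (K₂ / c) * ‖y - w‖ ^ degF Q s (pt x w) := by
        gcongr
        · exact le_max_right _ _
        · exact hlow y ⟨hy, hyκ⟩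

/-! ### Integrals over the chains -/

theorem homotopy_ne_zero (T : TubeData g B x) (hr : r ≠ 0) (h : IsLocProjField g B r x U η)
    {u : RSp d} (hu : u ∈ tanCone B x) :
    ∃ δ > (0 : ℝ), ∀ ε ∈ Ioo 0 δ, ∀ t ∈ Icc (0 : ℝ) 1, ∀ y, ¬ (t = 1 ∧ y ∈ critSet g B r x) →
      g (homotopy x u η ε t y) ≠ 0 := by
  obtain ⟨δ, hδ, H⟩ := h.exists_free T hr hu
  refine ⟨δ, hδ, fun ε hε t ht y hy => ?_⟩
  rw [homotopy_eq, smul_add, smul_smul, smul_smul]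
  have hε0 := hε.1
  refine H y _ ⟨mul_nonneg hε0.le (sub_nonneg.2 ht.2), ?_⟩ _ ⟨mul_nonneg hε0.le ht.1, ?_⟩ ?_
  · nlinarith [hε.2, ht.1]
  · nlinarith [hε.2, ht.2]
  · by_cases h1 : t = 1
    · exact Or.inr ⟨by rw [h1, mul_one]; exact hε0, fun h2 => hy ⟨h1, h2⟩⟩
    · have : t < 1 := lt_of_le_of_ne ht.2 h1
      exact Or.inl (mul_pos hε0 (by linarith))

theorem continuous_homotopy (hη : Continuous η) (u : RSp d) (ε t : ℝ) :
    Continuous (homotopy x u η ε t) := by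
  have : homotopy x u η ε t = fun y => pt (x + ε • ((1 - t) • u + t • η y)) y :=
    funext fun y => homotopy_eq _ _ _ _ _ _
  rw [this]
  exact Continuous.pt (by fun_prop) (by fun_prop)

theorem exists_homotopy_lipschitz (T : TubeData g B x) (hr : r ≠ 0)
    (h : IsLocProjField g B r x U η) (u : RSp d) {ε : ℝ} (hε : 0 ≤ ε) :
    ∃ L > 0, ∀ a b, ‖homotopy x u η ε 1 a - homotopy x u η ε 1 b‖ ≤ L * ‖a - b‖ := by
  obtain ⟨L, hL, hlip⟩ := h.exists_lipschitz T hr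
  refine ⟨ε * L + 1, by positivity, fun a b => ?_⟩
  rw [homotopy_one, homotopy_one, ← pt_sub, add_sub_add_left_eq_sub, ← smul_sub]
  calc _ ≤ ‖ε • (η a - η b)‖ + ‖a - b‖ := norm_pt_le _ _
    _ ≤ ε * (L * ‖a - b‖) + ‖a - b‖ := by
      rw [norm_smul, Real.norm_of_nonneg hε]
      gcongr
      exact hlip a b
    _ = _ := by ring

/-- The basic estimate, for integrands bounded by a power of the distance to the critical point. -/
theorem exists_chainIntegral_bound (hd : 0 < d) (T : TubeData g B x) (hr : r ≠ 0)
    (hfin : (critSet g B r x ∩ cube d).Finite) (hU : IsNhdFamily (critSet g B r x) U)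
    (h : IsLocProjField g B r x U η) (u : RSp d) {ε : ℝ} (hε : 0 < ε) :
    ∃ δ > 0, ∀ w ∈ critSet g B r x, ∀ β : ℝ, 0 < β + d → ∃ C > 0, ∀ (φ : CSp d → ℂ) (M : ℝ),
      AEStronglyMeasurable (fun y => φ (homotopy x u η ε 1 y)) (volume.restrict (closure (U w))) →
      (∀ y ∈ closure (U w), y ≠ w → ‖φ (homotopy x u η ε 1 y)‖ ≤ M * ‖y - w‖ ^ β) →
      ∀ r' ∈ conicNhd r δ,
        ChainIntegrable (homotopy x u η ε 1) (closure (U w))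
          (fun z => Complex.exp (-pair r' z) * φ z) ∧
        Real.exp (inner ℝ r' x) *
            ‖chainIntegral (homotopy x u η ε 1) (closure (U w))
              (fun z => Complex.exp (-pair r' z) * φ z)‖
          ≤ C * M * ‖r'‖ ^ (-(d : ℝ) - β) := by
  have : Nonempty (Fin d) := ⟨⟨0, hd⟩⟩
  obtain ⟨δ, hδ, hdec⟩ := h.exists_inner_ge T hr hfin hU
  obtain ⟨L, hL, hlip⟩ := h.exists_homotopy_lipschitz T hr u hε.le
  have hη := h.continuous T hr
  set J := (d.factorial : ℝ) * L ^ d + 1 with hJ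
  have hJ0 : 0 < J := by positivity
  have hjac : ∀ y, ‖jac (homotopy x u η ε 1) y‖ ≤ J := fun y => by
    linarith [norm_jac_le hL.le hlip y]
  refine ⟨δ, hδ, fun w hw β hβ => ?_⟩
  obtain ⟨c, hc, hdec⟩ := hdec w hw
  have hint := integrable_exp_neg_norm_mul_rpow hd (mul_pos hε hc) hβ
  set I := ∫ y : RSp d, Real.exp (-(ε * c * ‖y‖)) * ‖y‖ ^ β with hI
  have hI0 : 0 ≤ I := integral_nonneg fun y => by positivity
  refine ⟨J * I + 1, by positivity, fun φ M hφ hb r' hr' => ?_⟩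
  -- the constant `M` is not assumed to be nonnegative; `U w` contains points other than `w`
  have hM : 0 ≤ M := by
    obtain ⟨y, hy, hyw⟩ : ∃ y ∈ U w, y ≠ w := by
      have h1 : ∀ᶠ y in 𝓝[≠] w, y ∈ U w :=
        mem_nhdsWithin_of_mem_nhds ((hU.isOpen w hw).mem_nhds (hU.mem w hw))
      obtain ⟨y, h2, h3⟩ := (h1.and self_mem_nhdsWithin).exists
      exact ⟨y, h2, h3⟩
    have h1 : 0 < ‖y - w‖ := norm_pos_iff.2 (sub_ne_zero.2 hyw)
    have h2 := (norm_nonneg _).trans (hb y (subset_closure hy) hyw)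
    exact nonneg_of_mul_nonneg_left h2 (by positivity)
  have hr'0 : 0 < ‖r'‖ := norm_pos_iff.2 hr'.1
  set E := Real.exp (-inner ℝ r' x) with hE
  have key := integrableOn_of_scaled_bound hd hint (fun y => by positivity) hr'0
    (K := E * M * J * ‖r'‖ ^ (-β)) (S := closure (U w)) (by positivity) isClosed_closure.measurableSet
    (h := fun y => Complex.exp (-pair r' (homotopy x u η ε 1 y)) * φ (homotopy x u η ε 1 y)
      * jac (homotopy x u η ε 1) y) (w := w) ?_ ?_
  · refine ⟨key.1, ?_⟩
    calc _ ≤ Real.exp (inner ℝ r' x) * (E * M * J * ‖r'‖ ^ (-β) * ‖r'‖ ^ (-(d : ℝ)) * I) := by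
          gcongr
          exact key.2
      _ = Real.exp (inner ℝ r' x) * E * (J * I) * M * (‖r'‖ ^ (-(d : ℝ)) * ‖r'‖ ^ (-β)) := by ring
      _ = J * I * M * ‖r'‖ ^ (-(d : ℝ) - β) := by
          rw [hE, ← Real.exp_add, add_neg_cancel, Real.exp_zero, one_mul, ← Real.rpow_add hr'0,
            ← sub_eq_add_neg]
      _ ≤ _ := by gcongr; linarith
  · have h1 : Continuous fun y => Complex.exp (-pair r' (homotopy x u η ε 1 y)) :=
      Complex.continuous_exp.comp
        ((continuous_pair r').comp (continuous_homotopy hη u ε 1)).neg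
    exact (h1.aestronglyMeasurable.mul hφ).mul (measurable_jac _).aestronglyMeasurable
  · intro y hy hyw
    have h1 : 0 < ‖y - w‖ := norm_pos_iff.2 (sub_ne_zero.2 hyw)
    rw [norm_mul, norm_mul]
    have h2 : ‖Complex.exp (-pair r' (homotopy x u η ε 1 y))‖
        ≤ E * Real.exp (-(ε * c * ‖‖r'‖ • (y - w)‖)) := by
      rw [homotopy_one, norm_exp_neg_pair, hE, ← Real.exp_add, inner_add_right,
        real_inner_smul_right, norm_smul, norm_norm]
      have := mul_le_mul_of_nonneg_left (hdec r' hr' y hy) hε.le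
      refine Real.exp_le_exp.2 ?_
      linarith
    -- the integrand is rescaled by `‖r'‖`
    have h3 : ‖y - w‖ ^ β = ‖r'‖ ^ (-β) * ‖‖r'‖ • (y - w)‖ ^ β := by
      rw [norm_smul, norm_norm, Real.mul_rpow hr'0.le h1.le, ← mul_assoc, ← Real.rpow_add hr'0,
        neg_add_cancel, Real.rpow_zero, one_mul]
    calc _ ≤ E * Real.exp (-(ε * c * ‖‖r'‖ • (y - w)‖)) *
          (M * (‖r'‖ ^ (-β) * ‖‖r'‖ • (y - w)‖ ^ β)) * J := by
          rw [← h3]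
          gcongr
          · exact hb y hy hyw
          · exact hjac y
      _ = _ := by ring

/-- The basic estimate in terms of the distance of the points of the chain to the point `x + i w`, which
is comparable to the distance of their parameters. -/
theorem exists_chainIntegral_bound_dist (hd : 0 < d) (T : TubeData g B x) (hr : r ≠ 0)
    (hfin : (critSet g B r x ∩ cube d).Finite) (hU : IsNhdFamily (critSet g B r x) U)
    (h : IsLocProjField g B r x U η) (u : RSp d) {ε : ℝ} (hε : 0 < ε) :
    ∃ δ > 0, ∀ w ∈ critSet g B r x, ∀ β : ℝ, 0 < β + d → ∃ C > 0, ∀ (φ : CSp d → ℂ) (M : ℝ),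
      AEStronglyMeasurable (fun y => φ (homotopy x u η ε 1 y)) (volume.restrict (closure (U w))) →
      (∀ y ∈ closure (U w), y ≠ w →
        ‖φ (homotopy x u η ε 1 y)‖ ≤ M * ‖homotopy x u η ε 1 y - pt x w‖ ^ β) →
      ∀ r' ∈ conicNhd r δ,
        ChainIntegrable (homotopy x u η ε 1) (closure (U w))
          (fun z => Complex.exp (-pair r' z) * φ z) ∧
        Real.exp (inner ℝ r' x) *
            ‖chainIntegral (homotopy x u η ε 1) (closure (U w))
              (fun z => Complex.exp (-pair r' z) * φ z)‖
          ≤ C * M * ‖r'‖ ^ (-(d : ℝ) - β) := by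
  obtain ⟨δ, hδ, H⟩ := h.exists_chainIntegral_bound hd T hr hfin hU u hε
  obtain ⟨L, hL, hlip⟩ := h.exists_homotopy_lipschitz T hr u hε.le
  refine ⟨δ, hδ, fun w hw β hβ => ?_⟩
  obtain ⟨C, hC, H⟩ := H w hw β hβ
  refine ⟨C * max 1 (L ^ β), by positivity, fun φ M hφ hb r' hr' => ?_⟩
  have key := H φ (max 1 (L ^ β) * M) hφ (fun y hy hyw => ?_) r' hr'
  · rwa [mul_assoc C]
  have h1 : 0 < ‖y - w‖ := norm_pos_iff.2 (sub_ne_zero.2 hyw)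
  have hw0 : homotopy x u η ε 1 w = pt x w := by
    rw [homotopy_one, h.map_critPt hw, smul_zero, add_zero]
  have h2 : ‖y - w‖ ≤ ‖homotopy x u η ε 1 y - pt x w‖ := by
    rw [homotopy_one, ← pt_sub]
    exact norm_le_norm_pt_right _ _
  have h3 : ‖homotopy x u η ε 1 y - pt x w‖ ≤ L * ‖y - w‖ := by
    rw [← hw0]
    exact hlip y w
  have h4 : 0 < ‖homotopy x u η ε 1 y - pt x w‖ := h1.trans_le h2
  have hM : 0 ≤ M := nonneg_of_mul_nonneg_left ((norm_nonneg _).trans (hb y hy hyw)) (by positivity)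
  have h5 : ‖homotopy x u η ε 1 y - pt x w‖ ^ β ≤ max 1 (L ^ β) * ‖y - w‖ ^ β := by
    rcases le_or_gt 0 β with h0 | h0
    · calc _ ≤ (L * ‖y - w‖) ^ β := by gcongr
        _ = L ^ β * ‖y - w‖ ^ β := Real.mul_rpow hL.le h1.le
        _ ≤ _ := by gcongr; exact le_max_right _ _
    · calc _ ≤ ‖y - w‖ ^ β := Real.rpow_le_rpow_of_nonpos h1 h2 h0.le
        _ = 1 * ‖y - w‖ ^ β := (one_mul _).symm
        _ ≤ _ := by gcongr; exact le_max_left _ _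
  calc _ ≤ M * ‖homotopy x u η ε 1 y - pt x w‖ ^ β := hb y hy hyw
    _ ≤ M * (max 1 (L ^ β) * ‖y - w‖ ^ β) := by gcongr
    _ = _ := by ring

end IsLocProjField

/-! ### Holomorphic dependence of integrals on a parameter -/

/-- An integral depending on a complex parameter is holomorphic if the integrand is holomorphic and
locally bounded; the derivative of the integrand is controlled by Cauchy's estimate. -/
theorem differentiableOn_integral_of_locally_bounded {X : Type*} [MeasurableSpace X]
    {μ : Measure X} [IsFiniteMeasure μ] {Ω : Set ℂ} (hΩ : IsOpen Ω) {f : ℂ → X → ℂ}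
    (hm : ∀ τ ∈ Ω, AEStronglyMeasurable (f τ) μ)
    (hd : ∀ᵐ a ∂μ, DifferentiableOn ℂ (fun τ => f τ a) Ω)
    (hM : ∀ τ₀ ∈ Ω, ∃ r > 0, ∃ M : ℝ, ∀ᵐ a ∂μ, ∀ τ ∈ Metric.ball τ₀ r, ‖f τ a‖ ≤ M) :
    DifferentiableOn ℂ (fun τ => ∫ a, f τ a ∂μ) Ω := by
  intro τ₀ hτ₀
  obtain ⟨r₁, hr₁, M, hM⟩ := hM τ₀ hτ₀
  obtain ⟨r₂, hr₂, hball⟩ := Metric.isOpen_iff.1 hΩ τ₀ hτ₀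
  set r := min r₁ r₂ / 2 with hr
  have hr0 : 0 < r := by positivity
  have hr1 : 2 * r ≤ r₁ := by rw [hr]; linarith [min_le_left r₁ r₂]
  have hr2 : 2 * r ≤ r₂ := by rw [hr]; linarith [min_le_right r₁ r₂]
  have hsub : ∀ τ ∈ Metric.ball τ₀ r, Metric.closedBall τ r ⊆ Metric.ball τ₀ (2 * r) := by
    intro τ hτ τ' hτ'
    rw [Metric.mem_ball] at hτ ⊢
    rw [Metric.mem_closedBall] at hτ'
    linarith [dist_triangle τ' τ τ₀]
  have hsubΩ : Metric.ball τ₀ (2 * r) ⊆ Ω := (Metric.ball_subset_ball hr2).trans hball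
  have hself : τ₀ ∈ Metric.ball τ₀ r := Metric.mem_ball_self hr0
  have hdiff : ∀ᵐ a ∂μ, ∀ τ ∈ Metric.ball τ₀ r,
      HasDerivAt (fun τ => f τ a) (deriv (fun τ => f τ a) τ) τ := by
    filter_upwards [hd] with a ha τ hτ
    have : τ ∈ Ω := hsubΩ (hsub τ hτ (Metric.mem_closedBall_self hr0.le))
    exact ((ha τ this).differentiableAt (hΩ.mem_nhds this)).hasDerivAt
  have hbound : ∀ᵐ a ∂μ, ∀ τ ∈ Metric.ball τ₀ r, ‖deriv (fun τ => f τ a) τ‖ ≤ M / r := by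
    filter_upwards [hd, hM] with a ha hMa τ hτ
    refine Complex.norm_deriv_le_of_forall_mem_sphere_norm_le hr0 ?_ fun τ' hτ' => ?_
    · refine DifferentiableOn.diffContOnCl (ha.mono ?_)
      rw [closure_ball _ hr0.ne']
      exact (hsub τ hτ).trans hsubΩ
    · exact hMa τ' (Metric.ball_subset_ball hr1 (hsub τ hτ (Metric.sphere_subset_closedBall hτ')))
  have hmeas : ∀ᶠ τ in 𝓝 τ₀, AEStronglyMeasurable (f τ) μ := by
    filter_upwards [hΩ.mem_nhds hτ₀] with τ hτ using hm τ hτ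
  have hint : Integrable (f τ₀) μ := by
    refine Integrable.of_bound (hm τ₀ hτ₀) M ?_
    filter_upwards [hM] with a ha using ha τ₀ (Metric.mem_ball_self hr₁)
  have hmeas' : AEStronglyMeasurable (fun a => deriv (fun τ => f τ a) τ₀) μ := by
    have hev : ∀ᶠ τ in 𝓝[≠] τ₀, τ ∈ Ω := mem_nhdsWithin_of_mem_nhds (hΩ.mem_nhds hτ₀)
    have hfreq : ∃ᶠ τ in 𝓝[≠] τ₀, τ ∈ Ω := Filter.Eventually.frequently hev
    obtain ⟨u, hu, hu'⟩ := exists_seq_forall_of_frequently hfreq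
    refine aestronglyMeasurable_of_tendsto_ae (u := atTop)
      (f := fun n a => (u n - τ₀)⁻¹ • (f (u n) a - f τ₀ a)) (fun n => ?_) ?_
    · exact ((hm _ (hu' n)).sub (hm _ hτ₀)).const_smul (u n - τ₀)⁻¹
    · filter_upwards [hdiff] with a ha
      exact ((ha τ₀ hself).tendsto_slope.comp hu).congr fun n => by
        simp [slope_def_module]
  exact (hasDerivAt_integral_of_dominated_loc_of_deriv_le (Metric.ball_mem_nhds τ₀ hr0) hmeas hint
    (F' := fun τ a => deriv (fun τ => f τ a) τ) hmeas' hbound (integrable_const _)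
    hdiff).2.differentiableAt.differentiableWithinAt

/-! ### Increments of logarithms along segments -/

/-- The increment, along the segment from `z` to `z + v`, of a continuous logarithm of the entire
function `q`, provided that `q` does not vanish on this segment. -/
def logInc (q : CSp d → ℂ) (z v : CSp d) : ℂ :=
  ∫ θ in (0 : ℝ)..1, fderiv ℂ q (z + (θ : ℂ) • v) v / q (z + (θ : ℂ) • v)

/-- The projection of the real line to the unit interval. -/
def unitClamp (θ : ℝ) : ℝ := max 0 (min 1 θ)

theorem continuous_unitClamp : Continuous unitClamp := by unfold unitClamp; fun_prop

theorem unitClamp_mem (θ : ℝ) : unitClamp θ ∈ Icc (0 : ℝ) 1 :=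
  ⟨le_max_left _ _, max_le zero_le_one (min_le_left _ _)⟩

theorem unitClamp_of_mem {θ : ℝ} (h : θ ∈ Icc (0 : ℝ) 1) : unitClamp θ = θ := by
  rw [unitClamp, min_eq_right h.2, max_eq_right h.1]

/-- The parameter of the segment may be clamped to the unit interval; this makes the integrand defined
and continuous on the whole line. -/
theorem logInc_eq_clamp (q : CSp d → ℂ) (z v : CSp d) :
    logInc q z v = ∫ θ in (0 : ℝ)..1,
      fderiv ℂ q (z + (unitClamp θ : ℂ) • v) v / q (z + (unitClamp θ : ℂ) • v) := by
  refine intervalIntegral.integral_congr fun θ hθ => ?_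
  rw [uIcc_of_le zero_le_one] at hθ
  simp only [unitClamp_of_mem hθ]

theorem continuous_of_analyticOnNhd {q : CSp d → ℂ} (hq : AnalyticOnNhd ℂ q univ) :
    Continuous q := by
  have := hq.continuousOn
  rwa [continuousOn_univ] at this

theorem differentiable_of_analyticOnNhd {q : CSp d → ℂ} (hq : AnalyticOnNhd ℂ q univ) :
    Differentiable ℂ q := fun z =>
  (hq z (mem_univ z)).differentiableAt

theorem continuous_fderiv_of_analyticOnNhd {q : CSp d → ℂ} (hq : AnalyticOnNhd ℂ q univ) :
    Continuous (fderiv ℂ q) := by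
  have := hq.fderiv.continuousOn
  rwa [continuousOn_univ] at this

theorem continuousOn_logInc {q : CSp d → ℂ} (hq : AnalyticOnNhd ℂ q univ)
    {X : Type*} [TopologicalSpace X] [LocallyCompactSpace X]
    [FirstCountableTopology X] {S : Set X} (hS : IsOpen S) {z v : X → CSp d} (hz : Continuous z)
    (hv : Continuous v)
    (hne : ∀ p ∈ S, ∀ θ ∈ Icc (0 : ℝ) 1, q (z p + (θ : ℂ) • v p) ≠ 0) :
    ContinuousOn (fun p => logInc q (z p) (v p)) S := by
  have := hS.locallyCompactSpace
  rw [continuousOn_iff_continuous_domRestrict]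
  have hc := continuous_of_analyticOnNhd hq
  have hc' := continuous_fderiv_of_analyticOnNhd hq
  have h1 : Continuous fun a : S × ℝ => z a.1 + (unitClamp a.2 : ℂ) • v a.1 := by
    have := continuous_unitClamp
    fun_prop
  have h2 : Continuous (Function.uncurry fun (p : S) (θ : ℝ) =>
      fderiv ℂ q (z p + (unitClamp θ : ℂ) • v p) (v p) / q (z p + (unitClamp θ : ℂ) • v p)) := by
    refine Continuous.div ?_ (hc.comp h1) fun a => hne a.1 a.1.2 _ (unitClamp_mem _)
    exact (hc'.comp h1).clm_apply (by fun_prop)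
  refine (intervalIntegral.continuous_parametric_intervalIntegral_of_continuous' (μ := volume)
    h2 0 1).congr fun p => ?_
  rw [Set.domRestrict_apply, logInc_eq_clamp]

/-- `logInc q z v` is the increment of a logarithm of `q`: along the segment, the product of `q` with
`exp (- logInc)` has derivative zero. -/
theorem exp_logInc_mul {q : CSp d → ℂ} (hq : AnalyticOnNhd ℂ q univ)
    {z v : CSp d}
    (hne : ∀ θ ∈ Icc (0 : ℝ) 1, q (z + (θ : ℂ) • v) ≠ 0) :
    Complex.exp (logInc q z v) * q z = q (z + v) := by
  have hc := continuous_of_analyticOnNhd hq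
  have hc' := continuous_fderiv_of_analyticOnNhd hq
  set F : ℝ → ℂ := fun θ =>
    fderiv ℂ q (z + (unitClamp θ : ℂ) • v) v / q (z + (unitClamp θ : ℂ) • v) with hF
  have h1 : Continuous fun θ : ℝ => z + (unitClamp θ : ℂ) • v := by
    have := continuous_unitClamp
    fun_prop
  have hFc : Continuous F := Continuous.div ((hc'.comp h1).clm_apply continuous_const) (hc.comp h1)
    fun θ => hne _ (unitClamp_mem _)
  have hL : ∀ θ, HasDerivAt (fun t => ∫ a in (0 : ℝ)..t, F a) (F θ) θ := fun θ =>
    hFc.integral_hasStrictDerivAt 0 θ |>.hasDerivAt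
  have hγ : ∀ θ : ℝ, HasDerivAt (fun t : ℝ => q (z + (t : ℂ) • v))
      (fderiv ℂ q (z + (θ : ℂ) • v) v) θ := by
    intro θ
    have h2 : HasDerivAt (fun t : ℝ => z + (t : ℂ) • v) v θ := by
      have := ((Complex.ofRealCLM.hasDerivAt (x := θ)).smul_const v).const_add z
      simpa using this
    exact ((differentiable_of_analyticOnNhd hq _).hasFDerivAt.restrictScalars ℝ).comp_hasDerivAt θ h2
  have key := constant_of_has_deriv_right_zero
    (f := fun θ : ℝ => q (z + (θ : ℂ) • v) * Complex.exp (-∫ a in (0 : ℝ)..θ, F a)) (a := 0) (b := 1)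
    (fun θ _ => ((hγ θ).continuousAt.mul (hL θ).neg.cexp.continuousAt).continuousWithinAt)
    fun θ hθ => by
      have h3 : HasDerivAt (fun θ : ℝ => q (z + (θ : ℂ) • v) * Complex.exp (-∫ a in (0 : ℝ)..θ, F a))
        (fderiv ℂ q (z + (θ : ℂ) • v) v * Complex.exp (-∫ a in (0 : ℝ)..θ, F a)
          + q (z + (θ : ℂ) • v) * (Complex.exp (-∫ a in (0 : ℝ)..θ, F a) * -F θ)) θ :=
        (hγ θ).mul (hL θ).neg.cexp
      have h4 : unitClamp θ = θ := unitClamp_of_mem (Ico_subset_Icc_self hθ)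
      have h5 : q (z + (θ : ℂ) • v) ≠ 0 := hne θ (Ico_subset_Icc_self hθ)
      have h6 : q (z + (θ : ℂ) • v) * F θ = fderiv ℂ q (z + (θ : ℂ) • v) v := by
        simp only [hF, h4]
        rw [mul_div_cancel₀ _ h5]
      have h7 : fderiv ℂ q (z + (θ : ℂ) • v) v * Complex.exp (-∫ a in (0 : ℝ)..θ, F a)
          + q (z + (θ : ℂ) • v) * (Complex.exp (-∫ a in (0 : ℝ)..θ, F a) * -F θ) = 0 := by
        rw [← h6]
        ring
      rw [h7] at h3
      exact h3.hasDerivWithinAt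
  have h6 := key 1 (by simp)
  simp only [Complex.ofReal_one, one_smul, Complex.ofReal_zero, zero_smul, add_zero,
    intervalIntegral.integral_same, neg_zero, Complex.exp_zero, mul_one] at h6
  rw [logInc_eq_clamp, ← h6, mul_comm, mul_assoc, ← Complex.exp_add, neg_add_cancel,
    Complex.exp_zero, mul_one]

/-- For a holomorphic logarithm `l` of `q` on a neighborhood of the segment, `logInc` is the increment
of `l`. -/
theorem logInc_eq_sub {q : CSp d → ℂ} (hq : AnalyticOnNhd ℂ q univ)
    {V : Set (CSp d)} (hV : IsOpen V) {l : CSp d → ℂ}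
    (hl : DifferentiableOn ℂ l V) (he : ∀ z ∈ V, Complex.exp (l z) = q z) {z v : CSp d}
    (hzv : ∀ θ ∈ Icc (0 : ℝ) 1, z + (θ : ℂ) • v ∈ V) : logInc q z v = l (z + v) - l z := by
  have hc := continuous_of_analyticOnNhd hq
  have hc' := continuous_fderiv_of_analyticOnNhd hq
  have hd : ∀ θ ∈ uIcc (0 : ℝ) 1, HasDerivAt (fun t : ℝ => l (z + (t : ℂ) • v))
      (fderiv ℂ q (z + (θ : ℂ) • v) v / q (z + (θ : ℂ) • v)) θ := by
    intro θ hθ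
    rw [uIcc_of_le zero_le_one] at hθ
    have hz := hzv θ hθ
    have h1 : DifferentiableAt ℂ l (z + (θ : ℂ) • v) := hl.differentiableAt (hV.mem_nhds hz)
    have h2 : HasDerivAt (fun t : ℝ => z + (t : ℂ) • v) v θ := by
      have := ((Complex.ofRealCLM.hasDerivAt (x := θ)).smul_const v).const_add z
      simpa using this
    have h3 : HasFDerivAt q (Complex.exp (l (z + (θ : ℂ) • v)) • fderiv ℂ l (z + (θ : ℂ) • v))
        (z + (θ : ℂ) • v) := by
      refine h1.hasFDerivAt.cexp.congr_of_eventuallyEq ?_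
      filter_upwards [hV.mem_nhds hz] with z' hz' using (he z' hz').symm
    rw [h3.fderiv, ← he _ hz]
    have h4 := (h1.hasFDerivAt.restrictScalars ℝ).comp_hasDerivAt θ h2
    have h5 : (Complex.exp (l (z + (θ : ℂ) • v)) • fderiv ℂ l (z + (θ : ℂ) • v)) v
        / Complex.exp (l (z + (θ : ℂ) • v)) = fderiv ℂ l (z + (θ : ℂ) • v) v :=
      mul_div_cancel_left₀ _ (Complex.exp_ne_zero _)
    rw [h5]
    exact h4
  have := intervalIntegral.integral_eq_sub_of_hasDerivAt hd ?_
  · rw [logInc, this]; simp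
  · refine ContinuousOn.intervalIntegrable fun θ hθ => ?_
    rw [uIcc_of_le zero_le_one] at hθ
    have h1 : Continuous fun θ : ℝ => z + (θ : ℂ) • v := by fun_prop
    refine (ContinuousAt.div ((hc'.comp h1).clm_apply continuous_const).continuousAt
      (hc.comp h1).continuousAt ?_).continuousWithinAt
    simp only [Function.comp]
    rw [← he _ (hzv θ hθ)]
    exact Complex.exp_ne_zero _

theorem differentiableOn_logInc {q : CSp d → ℂ} (hq : AnalyticOnNhd ℂ q univ)
    {Ω : Set ℂ} (hΩ : IsOpen Ω) (z v : CSp d)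
    (hne : ∀ τ ∈ Ω, ∀ θ ∈ Icc (0 : ℝ) 1, q (z + (θ : ℂ) • τ • v) ≠ 0) :
    DifferentiableOn ℂ (fun τ => logInc q z (τ • v)) Ω := by
  have hc := continuous_of_analyticOnNhd hq
  have hc' := continuous_fderiv_of_analyticOnNhd hq
  have hd' : Differentiable ℂ (fderiv ℂ q) := fun z => (hq.fderiv z (mem_univ z)).differentiableAt
  have hd := differentiable_of_analyticOnNhd hq
  simp only [logInc_eq_clamp, intervalIntegral.integral_of_le zero_le_one]
  have h1 : Continuous fun a : ℂ × ℝ => z + (unitClamp a.2 : ℂ) • a.1 • v := by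
    have := continuous_unitClamp
    fun_prop
  have h2 : ContinuousOn (fun a : ℂ × ℝ => fderiv ℂ q (z + (unitClamp a.2 : ℂ) • a.1 • v) (a.1 • v)
      / q (z + (unitClamp a.2 : ℂ) • a.1 • v)) (Ω ×ˢ univ) := by
    refine ContinuousOn.div ?_ (hc.comp h1).continuousOn fun a ha => hne a.1 ha.1 _ (unitClamp_mem _)
    exact ((hc'.comp h1).clm_apply (by fun_prop)).continuousOn
  refine differentiableOn_integral_of_locally_bounded hΩ (fun τ hτ => ?_)
    (Eventually.of_forall fun θ => ?_) fun τ₀ hτ₀ => ?_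
  · have : Continuous fun θ : ℝ => fderiv ℂ q (z + (unitClamp θ : ℂ) • τ • v) (τ • v)
        / q (z + (unitClamp θ : ℂ) • τ • v) :=
      h2.comp_continuous (f := fun θ : ℝ => (τ, θ)) (by fun_prop) fun θ => ⟨hτ, mem_univ _⟩
    exact this.aestronglyMeasurable
  · intro τ hτ
    refine DifferentiableAt.differentiableWithinAt ?_
    have h3 : DifferentiableAt ℂ (fun τ : ℂ => z + (unitClamp θ : ℂ) • τ • v) τ := by fun_prop
    refine DifferentiableAt.div ?_ ((hd _).comp τ h3) (hne τ hτ _ (unitClamp_mem _))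
    exact ((hd' _).comp τ h3).clm_apply (by fun_prop)
  · obtain ⟨r, hr, hball⟩ := Metric.isOpen_iff.1 hΩ τ₀ hτ₀
    have hsub : Metric.closedBall τ₀ (r / 2) ⊆ Ω :=
      (Metric.closedBall_subset_ball (by linarith)).trans hball
    obtain ⟨M, -, hM⟩ := exists_pos_bound_of_isCompact
      ((isCompact_closedBall τ₀ (r / 2)).prod (isCompact_Icc (a := (0 : ℝ)) (b := 1)))
      (h2.mono (prod_mono hsub (subset_univ _)))
    refine ⟨r / 2, by positivity, M, ?_⟩
    filter_upwards [ae_restrict_mem measurableSet_Ioc] with θ hθ τ hτ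
    exact hM (τ, θ) ⟨Metric.ball_subset_closedBall hτ, Ioc_subset_Icc_self hθ⟩

/-! ### Fundamental domains of the lattice `2 π ℤ^d` -/

/-- The lattice `2 π ℤ^d`. -/
def latGroup (d : ℕ) : AddSubgroup (RSp d) where
  carrier := range lat
  zero_mem' := ⟨0, lat_zero⟩
  add_mem' := by
    rintro _ _ ⟨n, rfl⟩ ⟨m, rfl⟩
    exact ⟨n + m, lat_add n m⟩
  neg_mem' := by
    rintro _ ⟨n, rfl⟩
    exact ⟨-n, lat_neg n⟩

instance : Countable (latGroup d) := (countable_range (lat : (Fin d → ℤ) → RSp d)).to_subtype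

theorem existsUnique_add_lat_mem_cube (y : RSp d) : ∃! n, y + lat n ∈ cube d := by
  obtain ⟨n, hn⟩ := exists_add_lat_mem_cube y
  refine ⟨n, hn, fun m hm => ?_⟩
  funext i
  have h1 := hn i
  have h2 := hm i
  simp only [PiLp.add_apply, lat] at h1 h2
  have hpi : (0 : ℝ) < 2 * Real.pi := by positivity
  have h3 : ((m i - n i : ℤ) : ℝ) < 1 := by
    push_cast
    by_contra! h
    nlinarith [h1.1, h2.2]
  have h4 : (-1 : ℝ) < ((m i - n i : ℤ) : ℝ) := by
    push_cast
    by_contra! h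
    nlinarith [h1.2, h2.1]
  have h5 : m i - n i < 1 := by exact_mod_cast h3
  have h6 : -1 < m i - n i := by exact_mod_cast h4
  omega

theorem measurableSet_cube : MeasurableSet (cube d) := by
  have : cube d = ⋂ i, (fun y : RSp d => y i) ⁻¹' Ico 0 (2 * Real.pi) := by
    ext y; simp [cube]
  rw [this]
  refine MeasurableSet.iInter fun i => measurableSet_Ico.preimage ?_
  exact (EuclideanSpace.proj (𝕜 := ℝ) i).continuous.measurable

/-- The image of the fundamental cube under a homeomorphism of `ℝ^d` commuting with the lattice
translations is a fundamental domain. -/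
theorem isAddFundamentalDomain_image_cube (T : RSp d ≃ₜ RSp d)
    (hT : ∀ n y, T (y + lat n) = T y + lat n) :
    IsAddFundamentalDomain (latGroup d) (T '' cube d) := by
  refine IsAddFundamentalDomain.mk' ?_ fun y => ?_
  · exact (T.measurableEmbedding.measurableSet_image.2 measurableSet_cube).nullMeasurableSet
  · have hmem : ∀ n : Fin d → ℤ, lat n + y ∈ T '' cube d ↔ T.symm y + lat n ∈ cube d := by
      intro n
      have e : T (T.symm y + lat n) = lat n + y := by
        rw [hT, T.apply_symm_apply, add_comm]
      rw [← e]
      exact T.injective.mem_set_image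
    obtain ⟨n, hn, huniq⟩ := existsUnique_add_lat_mem_cube (T.symm y)
    refine ⟨⟨lat n, n, rfl⟩, (hmem n).2 hn, ?_⟩
    rintro ⟨_, m, rfl⟩ hm
    have := huniq m ((hmem m).1 hm)
    subst this
    rfl

theorem setIntegral_image_cube (T : RSp d ≃ₜ RSp d) (hT : ∀ n y, T (y + lat n) = T y + lat n)
    {H : RSp d → ℂ} (hH : ∀ n y, H (y + lat n) = H y) :
    ∫ y in T '' cube d, H y = ∫ y in cube d, H y := by
  have h1 := isAddFundamentalDomain_image_cube T hT
  have h2 : IsAddFundamentalDomain (latGroup d) (cube d) := by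
    simpa using isAddFundamentalDomain_image_cube (Homeomorph.refl (RSp d)) fun _ _ => rfl
  refine h1.setIntegral_eq h2 ?_
  rintro ⟨_, n, rfl⟩ y
  change H (lat n + y) = H y
  rw [add_comm, hH]

/-! ### Change of variables for small periodic perturbations of the identity -/

/-- The determinant has no zero on the segment from the identity to `id + A`. -/
theorem det_id_add_pos {A : RSp d →L[ℝ] RSp d} (hA : ‖A‖ < 1) :
    0 < (ContinuousLinearMap.id ℝ (RSp d) + A).det := by
  by_contra! hneg
  have hcont : Continuous fun t : ℝ => (ContinuousLinearMap.id ℝ (RSp d) + t • A).det :=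
    ContinuousLinearMap.continuous_det.comp (by fun_prop)
  obtain ⟨t, ht, h0⟩ := intermediate_value_Icc' zero_le_one hcont.continuousOn
    (show (0 : ℝ) ∈ _ from ⟨by simpa using hneg, by simp [ContinuousLinearMap.det]⟩)
  obtain ⟨y, hy, hy0⟩ := (Submodule.ne_bot_iff _).1 (LinearMap.bot_lt_ker_of_det_eq_zero h0).ne'
  have h1 : y + t • A y = 0 := by simpa using hy
  have h2 : ‖y‖ = ‖t • A y‖ := by rw [← norm_neg (t • A y), ← eq_neg_of_add_eq_zero_left h1]
  have h3 : ‖t • A y‖ ≤ ‖A‖ * ‖y‖ := by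
    rw [norm_smul, Real.norm_of_nonneg ht.1]
    calc t * ‖A y‖ ≤ 1 * ‖A y‖ := by gcongr; exact ht.2
      _ ≤ ‖A‖ * ‖y‖ := by rw [one_mul]; exact A.le_opNorm y
  have h4 : 0 < ‖y‖ := norm_pos_iff.2 hy0
  nlinarith

/-- The Jacobian matrix of a vector field. -/
def jacMat (v : RSp d → RSp d) (y : RSp d) : Matrix (Fin d) (Fin d) ℝ :=
  Matrix.of fun i j => fderiv ℝ v y (EuclideanSpace.single j 1) i

theorem det_id_add_smul_fderiv (v : RSp d → RSp d) (y : RSp d) (σ : ℝ) :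
    (ContinuousLinearMap.id ℝ (RSp d) + σ • fderiv ℝ v y).det = (1 + σ • jacMat v y).det := by
  rw [ContinuousLinearMap.det, ← LinearMap.det_toMatrix (EuclideanSpace.basisFun (Fin d) ℝ).toBasis]
  congr 1
  ext i j
  simp [LinearMap.toMatrix_apply, jacMat, Matrix.one_apply]

/-- Perturbations of the identity by a contraction are homeomorphisms. -/
theorem exists_homeomorph_id_add (hd : 0 < d) {v : RSp d → RSp d} {c : ℝ} (hc0 : 0 ≤ c) (hc : c < 1)
    (hv : ∀ a b, ‖v a - v b‖ ≤ c * ‖a - b‖) : ∃ T : RSp d ≃ₜ RSp d, ∀ y, T y = y + v y := by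
  have : Nonempty (Fin d) := ⟨⟨0, hd⟩⟩
  have h1 : ApproximatesLinearOn (fun y => y + v y)
      ((ContinuousLinearEquiv.refl ℝ (RSp d) : RSp d ≃L[ℝ] RSp d) : RSp d →L[ℝ] RSp d) univ
      ⟨c, hc0⟩ := by
    intro a _ b _
    have e : a + v a - (b + v b) - (a - b) = v a - v b := by abel
    have h2 := hv a b
    rw [← e] at h2
    exact h2
  refine ⟨h1.toHomeomorph _ (Or.inr ?_), fun y => rfl⟩
  have h2 : ‖(((ContinuousLinearEquiv.refl ℝ (RSp d)).symm : RSp d ≃L[ℝ] RSp d) :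
      RSp d →L[ℝ] RSp d)‖₊ = 1 := by
    ext
    exact ContinuousLinearMap.norm_id
  rw [h2, inv_one]
  exact_mod_cast hc

/-- Change of variables on the torus along the diffeomorphism `y ↦ y + σ v (y)`, for `v` Lipschitz and
differentiable off finitely many points of the torus. -/
theorem setIntegral_cube_comp_mul_det (hd : 0 < d) {v : RSp d → RSp d} {L σ : ℝ} (hL : 0 ≤ L)
    (hv : ∀ a b, ‖v a - v b‖ ≤ L * ‖a - b‖) (hper : ∀ n y, v (y + lat n) = v y) {N : Set (RSp d)}
    (hN : (N ∩ cube d).Finite) (hdiff : ∀ y ∉ N, DifferentiableAt ℝ v y) (hσ : |σ| * L < 1)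
    {H : RSp d → ℂ} (hH : ∀ n y, H (y + lat n) = H y) :
    ∫ y in cube d, H (y + σ • v y) * (((1 + σ • jacMat v y).det : ℝ) : ℂ)
      = ∫ y in cube d, H y := by
  have : Nonempty (Fin d) := ⟨⟨0, hd⟩⟩
  obtain ⟨T, hT⟩ := exists_homeomorph_id_add hd (v := fun y => σ • v y) (c := |σ| * L)
    (by positivity) hσ fun a b => by
      rw [← smul_sub, norm_smul, Real.norm_eq_abs, mul_assoc]
      gcongr
      exact hv a b
  have hTper : ∀ n y, T (y + lat n) = T y + lat n := fun n y => by
    rw [hT, hT, hper]; abel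
  rw [← setIntegral_image_cube T hTper hH]
  have hae : (cube d \ (N ∩ cube d) : Set (RSp d)) =ᵐ[volume] cube d :=
    sdiff_null_ae_eq_self (hN.measure_zero volume)
  have hae' : (T '' (cube d \ (N ∩ cube d)) : Set (RSp d)) =ᵐ[volume] T '' cube d := by
    rw [image_sdiff T.injective]
    exact sdiff_null_ae_eq_self ((hN.image T).measure_zero volume)
  rw [← setIntegral_congr_set hae, ← setIntegral_congr_set hae']
  have hm : MeasurableSet (cube d \ (N ∩ cube d) : Set (RSp d)) :=
    measurableSet_cube.diff hN.measurableSet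
  have hder : ∀ y ∈ (cube d \ (N ∩ cube d) : Set (RSp d)), HasFDerivAt T
      (ContinuousLinearMap.id ℝ (RSp d) + σ • fderiv ℝ v y) y := by
    intro y hy
    have hyN : y ∉ N := fun h => hy.2 ⟨h, hy.1⟩
    have h1 := (hasFDerivAt_id y).add ((hdiff y hyN).hasFDerivAt.const_smul σ)
    exact h1.congr_of_eventuallyEq (Eventually.of_forall fun y' => hT y')
  rw [integral_image_eq_integral_abs_det_fderiv_smul volume hm
    (fun y hy => (hder y hy).hasFDerivWithinAt) T.injective.injOn]
  refine setIntegral_congr_fun hm fun y hy => ?_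
  have hnorm : ‖σ • fderiv ℝ v y‖ < 1 := by
    rw [norm_smul, Real.norm_eq_abs]
    refine lt_of_le_of_lt ?_ hσ
    gcongr
    exact norm_fderiv_le_of_lip' ℝ hL (Eventually.of_forall fun a => hv a y)
  rw [abs_of_pos (det_id_add_pos hnorm), det_id_add_smul_fderiv, hT, Complex.real_smul, mul_comm]

/-! ### Fourier coefficients on the torus -/

theorem volume_cube_ne_zero : volume (cube d) ≠ 0 := by
  have h : IsAddFundamentalDomain (latGroup d) (cube d) := by
    simpa using isAddFundamentalDomain_image_cube (Homeomorph.refl (RSp d)) fun _ _ => rfl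
  exact h.measure_ne_zero (NeZero.ne _)

theorem volume_cube_lt_top : volume (cube d) < ⊤ :=
  (measure_mono cube_subset_closedCube).trans_lt isCompact_closedCube.measure_lt_top

theorem pair_add (r : RSp d) (z z' : CSp d) : pair r (z + z') = pair r z + pair r z' := by
  simp [pair, mul_add, Finset.sum_add_distrib]

theorem pair_smul (r : RSp d) (c : ℂ) (z : CSp d) : pair r (c • z) = c * pair r z := by
  simp only [pair, Finset.mul_sum, PiLp.smul_apply, smul_eq_mul]
  exact Finset.sum_congr rfl fun i _ => by ring

theorem pair_sub_left (r r' : RSp d) (z : CSp d) : pair (r - r') z = pair r z - pair r' z := by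
  simp [pair, sub_mul, Finset.sum_sub_distrib]

theorem exp_pair_add_lat {r : RSp d} (hr : ∃ m : Fin d → ℤ, ∀ i, r i = m i) (n : Fin d → ℤ)
    (a b : RSp d) : Complex.exp (pair r (pt a (b + lat n))) = Complex.exp (pair r (pt a b)) := by
  obtain ⟨m, hm⟩ := hr
  rw [Complex.exp_eq_exp_iff_exists_int]
  refine ⟨∑ i, m i * n i, ?_⟩
  simp only [pair, pt_apply, PiLp.add_apply, lat, hm]
  push_cast
  rw [Finset.sum_mul, ← Finset.sum_add_distrib]
  exact Finset.sum_congr rfl fun i _ => by ring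

theorem integral_cube_exp_pair (hd : 0 < d) {r : RSp d} (hr : ∃ m : Fin d → ℤ, ∀ i, r i = m i)
    (hr0 : r ≠ 0) (b : RSp d) : ∫ y in cube d, Complex.exp (pair r (pt b y)) = 0 := by
  obtain ⟨i, hi⟩ : ∃ i, r i ≠ 0 := by
    by_contra! h
    exact hr0 (by ext i; simp [h i])
  -- translation by a vector pairing to `π` with `r` changes the sign
  set h : RSp d := EuclideanSpace.single i (Real.pi / r i) with hh
  have h1 := setIntegral_cube_comp_mul_det hd (v := fun _ => h) (L := 0) (σ := 1) (N := ∅) le_rfl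
    (fun a b => by simp) (fun _ _ => rfl) (by simp) (fun y _ => differentiableAt_const _) (by simp)
    (H := fun y => Complex.exp (pair r (pt b y))) fun n y => exp_pair_add_lat hr n b y
  have h2 : ∀ y, jacMat (fun _ : RSp d => h) y = 0 := fun y => by
    ext i j
    simp [jacMat]
  have h3 : ∀ y, Complex.exp (pair r (pt b (y + (1 : ℝ) • h))) = -Complex.exp (pair r (pt b y)) := by
    intro y
    have e : pt b (y + (1 : ℝ) • h) = pt b y + pt 0 h := by rw [← pt_add, add_zero, one_smul]
    have e2 : pair r (pt 0 h) = Real.pi * Complex.I := by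
      simp only [pair, pt_apply, hh]
      rw [Finset.sum_eq_single i]
      · have : (r i : ℂ) ≠ 0 := by exact_mod_cast hi
        simp
        field_simp
      · intro j _ hj
        simp [hj]
      · simp
    rw [e, pair_add, Complex.exp_add, e2, Complex.exp_pi_mul_I, mul_neg_one]
  simp only [h2, h3, smul_zero, add_zero, Matrix.det_one, Complex.ofReal_one, mul_one,
    integral_neg] at h1
  exact self_eq_neg.1 h1.symm

/-! ### The power series in logarithmic coordinates -/

/-- The tube over a translate of the negative orthant. -/
def tube (d : ℕ) (c : ℝ) : Set (CSp d) := {z | ∀ i, (z i).re < c}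

theorem isOpen_tube (c : ℝ) : IsOpen (tube d c) := by
  have : tube d c = ⋂ i, {z : CSp d | (z i).re < c} := by ext; simp [tube]
  rw [this]
  exact isOpen_iInter_of_finite fun i => isOpen_lt (by fun_prop) continuous_const

theorem convex_tube (c : ℝ) : Convex ℝ (tube d c) := by
  intro z hz z' hz' a b ha hb hab i
  have h1 := hz i
  have h2 := hz' i
  simp only [PiLp.add_apply, PiLp.smul_apply, Complex.add_re, Complex.real_smul,
    Complex.re_ofReal_mul]
  have e : c = a * c + b * c := by rw [← add_mul, hab, one_mul]
  rcases ha.eq_or_lt with rfl | ha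
  · have : b = 1 := by linarith
    subst this
    simpa using h2
  · have h3 := mul_lt_mul_of_pos_left h1 ha
    have h4 := mul_le_mul_of_nonneg_left h2.le hb
    linarith

theorem pt_mem_tube {c : ℝ} {b : RSp d} (hb : ∀ i, b i < c) (y : RSp d) : pt b y ∈ tube d c := by
  intro i
  simpa using hb i

/-- The power series with coefficients `a`, as a function of the logarithms of the variables. -/
def expSeries (a : (Fin d → ℕ) → ℂ) (z : CSp d) : ℂ :=
  ∑' n, a n * Complex.exp (pair (natVec n) z)

theorem norm_exp_pair_natVec_le {c : ℝ} {z : CSp d} (hz : z ∈ tube d c) (n : Fin d → ℕ) :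
    ‖Complex.exp (pair (natVec n) z)‖ ≤ Real.exp (c * ∑ i, (n i : ℝ)) := by
  rw [Complex.norm_exp, Real.exp_le_exp, pair, Complex.re_sum, Finset.mul_sum]
  refine Finset.sum_le_sum fun i _ => ?_
  simp only [natVec, Complex.re_ofReal_mul]
  rw [mul_comm]
  exact mul_le_mul_of_nonneg_right (hz i).le (Nat.cast_nonneg _)

section
variable {a : (Fin d → ℕ) → ℂ} {c : ℝ}

theorem norm_term_le {z : CSp d} (hz : z ∈ tube d c) (n : Fin d → ℕ) :
    ‖a n * Complex.exp (pair (natVec n) z)‖ ≤ ‖a n‖ * Real.exp (c * ∑ i, (n i : ℝ)) := by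
  rw [norm_mul]
  exact mul_le_mul_of_nonneg_left (norm_exp_pair_natVec_le hz n) (norm_nonneg _)

theorem continuousOn_expSeries (hs : Summable fun n => ‖a n‖ * Real.exp (c * ∑ i, (n i : ℝ))) :
    ContinuousOn (expSeries a) (tube d c) :=
  continuousOn_tsum (fun _ => (continuous_const.mul
    (Complex.continuous_exp.comp (continuous_pair _))).continuousOn) hs
    fun _ _ hz => norm_term_le hz _

theorem differentiableOn_expSeries_line
    (hs : Summable fun n => ‖a n‖ * Real.exp (c * ∑ i, (n i : ℝ))) (z v : CSp d) :
    DifferentiableOn ℂ (fun t : ℂ => expSeries a (z + t • v)) {t | z + t • v ∈ tube d c} := by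
  refine Complex.differentiableOn_tsum_of_summable_norm hs (fun n => ?_)
    ((isOpen_tube c).preimage (by fun_prop)) fun _ _ ht => norm_term_le ht _
  simp only [pair_add, pair_smul]
  fun_prop

/-- Cauchy's formula for the coefficients of the power series. -/
theorem integral_cube_expSeries (hd : 0 < d)
    (hs : Summable fun n => ‖a n‖ * Real.exp (c * ∑ i, (n i : ℝ))) {b : RSp d}
    (hb : ∀ i, b i < c) (n : Fin d → ℕ) :
    ∫ y in cube d, expSeries a (pt b y) * Complex.exp (-pair (natVec n) (pt b y))
      = volume.real (cube d) * a n := by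
  have hfin : IsFiniteMeasure (volume.restrict (cube d)) :=
    ⟨by rw [Measure.restrict_apply_univ]; exact volume_cube_lt_top⟩
  set F : (Fin d → ℕ) → RSp d → ℂ := fun m y =>
    a m * Complex.exp (pair (natVec m) (pt b y)) * Complex.exp (-pair (natVec n) (pt b y)) with hF
  have hcont : ∀ m, Continuous (F m) := fun m => by
    have h1 : Continuous fun y : RSp d => pt b y := Continuous.pt continuous_const continuous_id
    have h2 := (continuous_pair (natVec m)).comp h1
    have h3 := (continuous_pair (natVec n)).comp h1
    simp only [Function.comp_def] at h2 h3
    simp only [hF]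
    fun_prop
  set K := Real.exp (-inner ℝ (natVec n) b) with hK
  have hb' : ∀ m y, ‖F m y‖ ≤ ‖a m‖ * Real.exp (c * ∑ i, (m i : ℝ)) * K := fun m y => by
    simp only [hF]
    rw [norm_mul, norm_exp_neg_pair]
    exact mul_le_mul_of_nonneg_right (norm_term_le (pt_mem_tube hb y) m) (Real.exp_pos _).le
  have hint : ∀ m, Integrable (F m) (volume.restrict (cube d)) := fun m =>
    Integrable.of_bound (hcont m).aestronglyMeasurable _ (Eventually.of_forall (hb' m))
  have hsum := hasSum_integral_of_summable_integral_norm hint ?_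
  · have e1 : ∀ m, ∫ y in cube d, F m y = if m = n then volume.real (cube d) * a n else 0 := by
      intro m
      have e2 : ∀ y, F m y = a m * Complex.exp (pair (natVec m - natVec n) (pt b y)) := fun y => by
        simp only [hF]
        rw [mul_assoc, ← Complex.exp_add, pair_sub_left, sub_eq_add_neg]
      simp only [e2, integral_const_mul]
      split_ifs with hmn
      · subst hmn
        simp [pair, mul_comm]
      · rw [integral_cube_exp_pair hd ⟨fun i => (m i : ℤ) - n i, fun i => by simp [natVec]⟩,
          mul_zero]
        intro h0
        refine hmn (funext fun i => ?_)
        have := congrArg (fun y : RSp d => y i) (sub_eq_zero.1 h0)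
        simpa [natVec] using this
    simp only [e1] at hsum
    rw [(hasSum_ite_eq n ((volume.real (cube d) : ℂ) * a n)).unique hsum]
    refine integral_congr_ae (Eventually.of_forall fun y => ?_)
    simp only [expSeries, hF]
    rw [tsum_mul_right]
  · refine Summable.of_nonneg_of_le (fun m => integral_nonneg fun y => norm_nonneg _) (fun m => ?_)
      ((hs.mul_right K).mul_left (volume.real (cube d)))
    calc ∫ y in cube d, ‖F m y‖ ≤ ∫ y in cube d, ‖a m‖ * Real.exp (c * ∑ i, (m i : ℝ)) * K :=
          integral_mono (hint m).norm (integrable_const _) (hb' m)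
      _ = _ := by
          rw [setIntegral_const, smul_eq_mul]

end

/-! ### The branch of `F` at the origin -/

/-- The branch of `F ∘ exp` given by the logarithms `l j` of the factors with singular
exponents; the other factors are powers with natural exponents. -/
def branchVal (Q : Fin k → MvPolynomial (Fin d) ℂ) (s : Fin k → ℝ) (l : Fin k → ℂ) (z : CSp d) :
    ℂ :=
  ∏ j, open Classical in
    if j ∈ singIdx s then Complex.exp (s j * l j) else expPull (Q j) z ^ ⌊s j⌋₊

theorem exists_nat_of_notMem_singIdx {s : Fin k → ℝ} {j : Fin k} (h : j ∉ singIdx s) :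
    0 < ⌊s j⌋₊ ∧ s j = ⌊s j⌋₊ := by
  rw [mem_singIdx, not_not] at h
  obtain ⟨n, hn, e⟩ := h
  rw [e, Nat.floor_natCast]
  exact ⟨hn, rfl⟩

theorem isValue_branchVal {Q : Fin k → MvPolynomial (Fin d) ℂ} {s : Fin k → ℝ} {l : Fin k → ℂ}
    {z : CSp d} (h : ∀ j ∈ singIdx s, Complex.exp (l j) = expPull (Q j) z) :
    IsValue Q s (fun i => Complex.exp (z i)) (branchVal Q s l z) := by
  refine ⟨_, fun j => ?_, rfl⟩
  split_ifs with hj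
  · exact Or.inr ⟨l j, h j hj, rfl⟩
  · obtain ⟨h1, h2⟩ := exists_nat_of_notMem_singIdx hj
    exact Or.inl ⟨_, h1, h2, rfl⟩

/-- The monodromy factors of `F`: the factor by which a branch changes when `n j` times `2 π i` is added
to the logarithm of the `j`-th factor. -/
def phase (s : Fin k → ℝ) (n : Fin k → ℤ) : ℂ :=
  Complex.exp (((∑ j, s j * (2 * Real.pi * n j) : ℝ) : ℂ) * Complex.I)

theorem norm_phase (s : Fin k → ℝ) (n : Fin k → ℤ) : ‖phase s n‖ = 1 :=
  Complex.norm_exp_ofReal_mul_I _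

/-- Two values of `F` at a point differ by one of countably many factors of modulus one. -/
theorem IsValue.exists_phase {Q : Fin k → MvPolynomial (Fin d) ℂ} {s : Fin k → ℝ} {l : Fin k → ℂ}
    {z : CSp d} {v : ℂ} (hv : IsValue Q s (fun i => Complex.exp (z i)) v)
    (h : ∀ j ∈ singIdx s, Complex.exp (l j) = expPull (Q j) z) :
    ∃ n, v = phase s n * branchVal Q s l z := by
  classical
  obtain ⟨p, hp, rfl⟩ := hv
  have h1 : ∀ j, ∃ n : ℤ, p j = Complex.exp ((s j * (2 * Real.pi * n) : ℝ) * Complex.I) *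
      if j ∈ singIdx s then Complex.exp (s j * l j) else expPull (Q j) z ^ ⌊s j⌋₊ := by
    intro j
    split_ifs with hj
    · rcases hp j with ⟨n, hn, e, -⟩ | ⟨l', hl', e⟩
      · exact absurd ⟨n, hn, e⟩ (mem_singIdx.1 hj)
      · have h2 : Complex.exp l' = Complex.exp (l j) := by rw [hl', h j hj]; rfl
        obtain ⟨n, hn⟩ := Complex.exp_eq_exp_iff_exists_int.1 h2
        refine ⟨n, ?_⟩
        rw [e, hn, ← Complex.exp_add]
        congr 1
        push_cast
        ring
    · refine ⟨0, ?_⟩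
      obtain ⟨hpos, hfl⟩ := exists_nat_of_notMem_singIdx hj
      simp only [Int.cast_zero, mul_zero, Complex.ofReal_zero, zero_mul, Complex.exp_zero, one_mul]
      rcases hp j with ⟨n, hn, e, e'⟩ | ⟨l', hl', e⟩
      · rw [e', e, Nat.floor_natCast]; rfl
      · rw [e, hfl, Nat.floor_natCast]
        change _ = MvPolynomial.eval _ (Q j) ^ _
        rw [← hl', ← Complex.exp_nat_mul]
        simp
  choose n hn using h1
  refine ⟨n, ?_⟩
  rw [phase, branchVal, Finset.prod_congr rfl fun j _ => hn j, Finset.prod_mul_distrib,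
    ← Complex.exp_sum, Complex.ofReal_sum, Finset.sum_mul]

/-- Data on a tube over a translate of the negative orthant: the power series `a` converges
absolutely there to a value of `F ∘ exp`, and `l j` are holomorphic logarithms of the factors with
singular exponents. -/
structure TubeBranch (Q : Fin k → MvPolynomial (Fin d) ℂ) (s : Fin k → ℝ) (a : (Fin d → ℕ) → ℂ)
    (c : ℝ) (l : Fin k → CSp d → ℂ) : Prop where
  summable : Summable fun n => ‖a n‖ * Real.exp (c * ∑ i, (n i : ℝ))
  isValue : ∀ z ∈ tube d c, IsValue Q s (fun i => Complex.exp (z i)) (expSeries a z)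
  differentiableOn : ∀ j ∈ singIdx s, DifferentiableOn ℂ (l j) (tube d c)
  exp_eq : ∀ j ∈ singIdx s, ∀ z ∈ tube d c, Complex.exp (l j z) = expPull (Q j) z

/-- The singular factors do not vanish at the origin, so near the origin their quotients by their values
there stay in the slit plane, and the principal logarithm applies. -/
theorem IsTaylorCoeff.exists_tubeBranch {Q : Fin k → MvPolynomial (Fin d) ℂ} {s : Fin k → ℝ}
    {a : (Fin d → ℕ) → ℂ} (ha : IsTaylorCoeff Q s a) : ∃ c l, TubeBranch Q s a c l := by
  have h0 : ∀ j ∈ singIdx s, MvPolynomial.eval 0 (Q j) ≠ 0 := by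
    intro j hj
    obtain ⟨v, ⟨p, hp, -⟩, -⟩ := Filter.Eventually.self_of_nhds ha
    rcases hp j with ⟨n, hn, e, -⟩ | ⟨l, hl, -⟩
    · exact absurd ⟨n, hn, e⟩ (mem_singIdx.1 hj)
    · rw [← hl]; exact Complex.exp_ne_zero l
  have h1 : ∀ᶠ Z : Fin d → ℂ in 𝓝 0, ∀ j ∈ singIdx s,
      ‖MvPolynomial.eval Z (Q j) / MvPolynomial.eval 0 (Q j) - 1‖ < 1 := by
    refine (Finset.eventually_all _).2 fun j hj => ?_
    have hc : Continuous fun Z : Fin d → ℂ =>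
        ‖MvPolynomial.eval Z (Q j) / MvPolynomial.eval 0 (Q j) - 1‖ :=
      (((MvPolynomial.continuous_eval (Q j)).div_const _).sub continuous_const).norm
    refine (hc.tendsto 0).eventually_lt_const ?_
    rw [div_self (h0 j hj), sub_self, norm_zero]
    exact one_pos
  obtain ⟨ρ, hρ, H⟩ := Metric.eventually_nhds_iff.1 (Filter.Eventually.and ha h1)
  set c := Real.log (ρ / 2) with hc
  have hexp : Real.exp c = ρ / 2 := Real.exp_log (by positivity)
  have hZ : ∀ z ∈ tube d c, dist (fun i => Complex.exp (z i)) 0 < ρ := by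
    intro z hz
    rw [dist_zero_right]
    refine lt_of_le_of_lt ((pi_norm_le_iff_of_nonneg (by positivity)).2 fun i => ?_)
      (half_lt_self hρ)
    rw [Complex.norm_exp, ← hexp]
    exact (Real.exp_lt_exp.2 (hz i)).le
  have hterm : ∀ (z : CSp d) (n : Fin d → ℕ), a n * ∏ i, Complex.exp (z i) ^ n i
      = a n * Complex.exp (pair (natVec n) z) := by
    intro z n
    rw [pair, Complex.exp_sum]
    congr 1
    refine Finset.prod_congr rfl fun i _ => ?_
    rw [← Complex.exp_nat_mul]
    simp [natVec]
  refine ⟨c, fun j z => Complex.log (1 + (MvPolynomial.eval (fun i => Complex.exp (z i)) (Q j)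
    / MvPolynomial.eval 0 (Q j) - 1)) + Complex.log (MvPolynomial.eval 0 (Q j)), ?_, ?_, ?_, ?_⟩
  · have hmem : dist (fun _ : Fin d => ((ρ / 2 : ℝ) : ℂ)) 0 < ρ := by
      rw [dist_zero_right]
      refine lt_of_le_of_lt ((pi_norm_le_iff_of_nonneg (by positivity)).2 fun i => ?_)
        (half_lt_self hρ)
      rw [Complex.norm_real, Real.norm_of_nonneg (by positivity)]
    obtain ⟨⟨v, -, hsum⟩, -⟩ := H hmem
    refine hsum.summable.norm.congr fun n => ?_
    rw [norm_mul, norm_prod, Finset.mul_sum, Real.exp_sum]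
    congr 1
    refine Finset.prod_congr rfl fun i _ => ?_
    rw [norm_pow, Complex.norm_real, Real.norm_of_nonneg (by positivity), ← hexp, ← Real.exp_nat_mul,
      mul_comm]
  · intro z hz
    obtain ⟨⟨v, hv, hsum⟩, -⟩ := H (hZ z hz)
    simp only [hterm] at hsum
    rw [expSeries, hsum.tsum_eq]
    exact hv
  · intro j hj
    have hd : Differentiable ℂ (expPull (Q j)) :=
      differentiable_of_analyticOnNhd (analyticOnNhd_expPull (Q j))
    refine DifferentiableOn.add_const _ (DifferentiableOn.clog ?_ fun z hz => ?_)
    · have h2 : Differentiable ℂ fun z : CSp d =>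
          1 + (expPull (Q j) z / MvPolynomial.eval (0 : Fin d → ℂ) (Q j) - 1) := by fun_prop
      exact h2.differentiableOn
    · exact Complex.mem_slitPlane_of_norm_lt_one ((H (hZ z hz)).2 j hj)
  · intro j hj z hz
    have h2 := Complex.slitPlane_ne_zero
      (Complex.mem_slitPlane_of_norm_lt_one ((H (hZ z hz)).2 j hj))
    rw [Complex.exp_add, Complex.exp_log h2, Complex.exp_log (h0 j hj), add_sub_cancel,
      div_mul_cancel₀ _ (h0 j hj)]
    rfl

namespace TubeBranch

variable {Q : Fin k → MvPolynomial (Fin d) ℂ} {s : Fin k → ℝ} {a : (Fin d → ℕ) → ℂ} {c : ℝ}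
  {l : Fin k → CSp d → ℂ}

theorem continuousOn_branchVal (h : TubeBranch Q s a c l) :
    ContinuousOn (fun z => branchVal Q s (fun j => l j z) z) (tube d c) := by
  unfold branchVal
  refine continuousOn_finsetProd _ fun j _ => ?_
  split_ifs with hj
  · exact Complex.continuous_exp.comp_continuousOn
      (continuousOn_const.mul (h.differentiableOn j hj).continuousOn)
  · exact ((continuous_expPull (Q j)).pow _).continuousOn

theorem differentiableOn_branchVal_line (h : TubeBranch Q s a c l) (z v : CSp d) :
    DifferentiableOn ℂ (fun t : ℂ => branchVal Q s (fun j => l j (z + t • v)) (z + t • v))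
      {t | z + t • v ∈ tube d c} := by
  have hline : Differentiable ℂ fun t : ℂ => z + t • v := by fun_prop
  unfold branchVal
  refine DifferentiableOn.fun_finsetProd fun j _ => ?_
  split_ifs with hj
  · exact (((h.differentiableOn j hj).comp hline.differentiableOn fun t ht => ht).const_mul _).cexp
  · exact (((differentiable_of_analyticOnNhd (analyticOnNhd_expPull (Q j))).comp hline).pow _).differentiableOn

/-- The power series is a constant multiple, of modulus one, of the branch given by the logarithms:
by Baire's theorem one of the countably many monodromy factors occurs on an open set, and along
complex lines through that set the identity theorem applies. -/
theorem exists_eq_phase_mul (h : TubeBranch Q s a c l) :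
    ∃ n, ∀ z ∈ tube d c, expSeries a z = phase s n * branchVal Q s (fun j => l j z) z := by
  have hcont : ∀ n, ContinuousOn
      (fun z => expSeries a z - phase s n * branchVal Q s (fun j => l j z) z) (tube d c) := fun n =>
    (continuousOn_expSeries h.summable).sub (continuousOn_const.mul h.continuousOn_branchVal)
  have hne : (WithLp.toLp 2 fun _ => ((c - 1 : ℝ) : ℂ) : CSp d) ∈ tube d c := fun i => by simp
  obtain ⟨ρ, hρ, hball⟩ := Metric.isOpen_iff.1 (isOpen_tube c) _ hne
  set z₀ : CSp d := WithLp.toLp 2 fun _ => ((c - 1 : ℝ) : ℂ) with hz₀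
  have hK : Metric.closedBall z₀ (ρ / 2) ⊆ tube d c :=
    (Metric.closedBall_subset_ball (by linarith)).trans hball
  -- the closed sets on which the monodromy factor is given by `n`, with the complement of a small ball
  -- as an additional member so that they cover the whole space
  set f : Option (Fin k → ℤ) → Set (CSp d) := fun o => o.elim (Metric.ball z₀ (ρ / 2))ᶜ fun n =>
    Metric.closedBall z₀ (ρ / 2) ∩
      (fun z => expSeries a z - phase s n * branchVal Q s (fun j => l j z) z) ⁻¹' {0} with hf
  have hclosed : ∀ o, IsClosed (f o) := by
    rintro (_ | n)
    · exact Metric.isOpen_ball.isClosed_compl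
    · exact ((hcont n).mono hK).preimage_isClosed_of_isClosed Metric.isClosed_closedBall
        isClosed_singleton
  have hcover : ⋃ o, f o = univ := by
    refine eq_univ_of_forall fun z => mem_iUnion.2 ?_
    by_cases hz : z ∈ Metric.ball z₀ (ρ / 2)
    · have hz' := Metric.ball_subset_closedBall hz
      obtain ⟨n, hn⟩ := (h.isValue z (hK hz')).exists_phase (l := fun j => l j z)
        fun j hj => h.exp_eq j hj z (hK hz')
      exact ⟨some n, hz', by simp [hn]⟩
    · exact ⟨none, hz⟩
  obtain ⟨z₁, hz₁, hz₁'⟩ := (dense_iUnion_interior_of_closed hclosed hcover).inter_open_nonempty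
    (Metric.ball z₀ (ρ / 2)) Metric.isOpen_ball ⟨z₀, Metric.mem_ball_self (by positivity)⟩
  obtain ⟨o, ho⟩ := mem_iUnion.1 hz₁'
  rcases o with _ | n
  · exact absurd hz₁ (interior_subset ho)
  have hz₁V : z₁ ∈ tube d c := hK (Metric.ball_subset_closedBall hz₁)
  refine ⟨n, fun z hz => ?_⟩
  -- on the complex line through `z₁` and `z`, equality holds near `z₁`
  set Ω : Set ℂ := {t | z₁ + t • (z - z₁) ∈ tube d c} with hΩ
  have hline : Continuous fun t : ℂ => z₁ + t • (z - z₁) := by fun_prop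
  have hΩo : IsOpen Ω := (isOpen_tube c).preimage hline
  have hΩc : Convex ℝ Ω := by
    intro t ht t' ht' p q hp hq hpq
    have := convex_tube c ht ht' hp hq hpq
    have e : z₁ + (p • t + q • t') • (z - z₁)
        = p • (z₁ + t • (z - z₁)) + q • (z₁ + t' • (z - z₁)) := by
      have e2 : z₁ = p • z₁ + q • z₁ := by rw [← add_smul, hpq, one_smul]
      rw [add_smul, smul_assoc, smul_assoc, smul_add, smul_add]
      nth_rewrite 1 [e2]
      abel
    change z₁ + (p • t + q • t') • (z - z₁) ∈ tube d c
    rwa [e]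
  have hdiff := ((differentiableOn_expSeries_line h.summable z₁ (z - z₁)).sub
    ((h.differentiableOn_branchVal_line z₁ (z - z₁)).const_mul (phase s n))).analyticOnNhd hΩo
  have h0 : (0 : ℂ) ∈ Ω := by
    change z₁ + (0 : ℂ) • (z - z₁) ∈ tube d c
    rwa [zero_smul, add_zero]
  have h1 : (1 : ℂ) ∈ Ω := by
    change z₁ + (1 : ℂ) • (z - z₁) ∈ tube d c
    rwa [one_smul, add_sub_cancel]
  have hev := hdiff.eqOn_zero_of_preconnected_of_eventuallyEq_zero hΩc.isPreconnected h0 (by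
    have h2 : ∀ᶠ t : ℂ in 𝓝 0, z₁ + t • (z - z₁) ∈ interior (f (some n)) := by
      refine hline.continuousAt.eventually_mem ?_
      rw [zero_smul, add_zero]
      exact isOpen_interior.mem_nhds ho
    filter_upwards [h2] with t ht
    exact (interior_subset ht).2)
  have := hev h1
  simp only [Pi.sub_apply, one_smul, add_sub_cancel, Pi.zero_apply] at this
  exact sub_eq_zero.1 this

end TubeBranch

/-! ### Deformation of the torus of integration -/

/-- The determinant `det (1 - i τ Dv)`, as a function of the complex parameter `τ`. -/
def detParam (v : RSp d → RSp d) (τ : ℂ) (y : RSp d) : ℂ :=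
  (1 + (-Complex.I * τ) • (jacMat v y).map Complex.ofReal).det

theorem abs_jacMat_le {v : RSp d → RSp d} {L : ℝ} (hL : 0 ≤ L)
    (hv : ∀ a b, ‖v a - v b‖ ≤ L * ‖a - b‖) (y : RSp d) (i j : Fin d) : |jacMat v y i j| ≤ L := by
  have hf : ‖fderiv ℝ v y‖ ≤ L := norm_fderiv_le_of_lip' ℝ hL (Eventually.of_forall fun a => hv a y)
  calc ‖(fderiv ℝ v y (EuclideanSpace.single j 1)) i‖
      ≤ ‖fderiv ℝ v y (EuclideanSpace.single j 1)‖ := PiLp.norm_apply_le _ _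
    _ ≤ ‖fderiv ℝ v y‖ * ‖(EuclideanSpace.single j (1 : ℝ) : RSp d)‖ :=
        ContinuousLinearMap.le_opNorm _ _
    _ ≤ L * 1 := by
        gcongr
        simp
    _ = L := mul_one L

theorem norm_detParam_le {v : RSp d → RSp d} {L : ℝ} (hL : 0 ≤ L)
    (hv : ∀ a b, ‖v a - v b‖ ≤ L * ‖a - b‖) (τ : ℂ) (y : RSp d) :
    ‖detParam v τ y‖ ≤ (d.factorial : ℝ) * (1 + ‖τ‖ * L) ^ d := by
  have h := Matrix.det_le (abv := NormedField.toAbsoluteValue ℂ) (x := 1 + ‖τ‖ * L)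
    (A := 1 + (-Complex.I * τ) • (jacMat v y).map Complex.ofReal) fun i j => by
      change ‖(1 + (-Complex.I * τ) • (jacMat v y).map Complex.ofReal) i j‖ ≤ 1 + ‖τ‖ * L
      rw [Matrix.add_apply, Matrix.smul_apply, Matrix.map_apply]
      refine (norm_add_le _ _).trans (add_le_add ?_ ?_)
      · rw [Matrix.one_apply]
        split_ifs <;> simp
      · rw [norm_smul, norm_mul, norm_neg, Complex.norm_I, one_mul, Complex.norm_real,
          Real.norm_eq_abs]
        gcongr
        exact abs_jacMat_le hL hv y i j
  rw [Fintype.card_fin, nsmul_eq_mul] at h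
  exact h

theorem measurable_detParam (v : RSp d → RSp d) (τ : ℂ) : Measurable (detParam v τ) := by
  unfold detParam
  simp only [Matrix.det_apply]
  refine Finset.measurable_sum _ fun σ _ => Measurable.const_smul ?_ _
  refine Finset.measurable_prod _ fun i _ => ?_
  simp only [Matrix.add_apply, Matrix.smul_apply, Matrix.map_apply]
  refine Measurable.const_add (Measurable.const_smul (g := fun y => ((jacMat v y (σ i) i : ℝ) : ℂ))
    (Complex.measurable_ofReal.comp ?_) (-Complex.I * τ)) _
  exact (EuclideanSpace.proj (𝕜 := ℝ) (σ i)).continuous.measurable.comp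
    (measurable_fderiv_apply_const ℝ v _)

theorem differentiable_detParam (v : RSp d → RSp d) (y : RSp d) :
    Differentiable ℂ fun τ => detParam v τ y := by
  unfold detParam
  simp only [Matrix.det_apply, Matrix.add_apply, Matrix.smul_apply]
  refine Differentiable.fun_sum fun σ _ => Differentiable.const_smul ?_ _
  refine Differentiable.fun_finsetProd fun i _ => ?_
  fun_prop

/-- For imaginary parameters, `detParam` is the Jacobian determinant of `y ↦ y + σ v (y)`. -/
theorem detParam_I_mul (v : RSp d → RSp d) (σ : ℝ) (y : RSp d) :
    detParam v (σ * Complex.I) y = (((1 + σ • jacMat v y).det : ℝ) : ℂ) := by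
  have h := RingHom.map_det Complex.ofRealHom (1 + σ • jacMat v y)
  rw [Complex.ofRealHom_eq_coe] at h
  rw [h, detParam]
  congr 1
  ext i j
  have e : -Complex.I * (σ * Complex.I) = σ := by
    rw [mul_left_comm, neg_mul, Complex.I_mul_I, neg_neg, mul_one]
  rw [e]
  simp [Matrix.one_apply]
  split_ifs <;> simp

set_option maxHeartbeats 400000 in
/-- Cauchy's theorem for the coefficients of a branch of `F`: the torus over a point `b` deep in the
negative orthant can be deformed along a periodic vector field `v`, as long as the singular part
does not vanish on the way. The integrals over the intermediate chains are analytic in a complex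
deformation parameter, and for imaginary parameters they are related to the integral over the
original torus by a real change of variables. -/
theorem TubeBranch.exists_deformed_integral {Q : Fin k → MvPolynomial (Fin d) ℂ} {s : Fin k → ℝ}
    {a : (Fin d → ℕ) → ℂ} {c : ℝ} {l : Fin k → CSp d → ℂ} (hd : 0 < d)
    (h : TubeBranch Q s a c l) {b : RSp d} (hb : ∀ i, b i < c) {v : RSp d → RSp d} {L : ℝ}
    (hL : 0 ≤ L) (hv : ∀ a b, ‖v a - v b‖ ≤ L * ‖a - b‖) (hper : ∀ n y, v (y + lat n) = v y)
    {N : Set (RSp d)} (hN : (N ∩ cube d).Finite) (hdiff : ∀ y ∉ N, DifferentiableAt ℝ v y)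
    (hne : ∀ t ∈ Icc (0 : ℝ) 1, ∀ y,
      expPull (singularPart Q s) (pt (b + t • v y) y) ≠ 0) :
    ∃ V : RSp d → ℂ, (∀ y, ∃ ζ V', ‖ζ‖ = 1 ∧ V y = ζ * V' ∧
        IsValue Q s (fun i => Complex.exp (pt (b + v y) y i)) V') ∧
      ∀ n, volume.real (cube d) * a n = ∫ y in cube d,
        V y * Complex.exp (-pair (natVec n) (pt (b + v y) y)) * detParam v 1 y := by
  have hvc : Continuous v := by
    have : LipschitzWith ⟨L, hL⟩ v := LipschitzWith.of_dist_le_mul fun a b => by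
      rw [dist_eq_norm, dist_eq_norm]; exact hv a b
    exact this.continuous
  set g := expPull (singularPart Q s) with hg
  have hgc : Continuous g := continuous_expPull _
  -- the deformed points
  set Z : ℂ → RSp d → CSp d := fun τ y => pt b y + τ • cx (v y) with hZ
  have hZpt : ∀ τ y, Z τ y = pt (b + τ.re • v y) (y + τ.im • v y) := fun τ y => by
    rw [hZ]; simp only; rw [smul_cx, ← pt_add]
  have hZc : Continuous fun p : ℂ × RSp d => Z p.1 p.2 := by
    have h1 : Continuous fun p : ℂ × RSp d => pt b p.2 := Continuous.pt continuous_const continuous_snd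
    have h2 : Continuous fun p : ℂ × RSp d => cx (v p.2) := (Continuous.cx (hvc.comp continuous_snd))
    exact h1.add (continuous_fst.smul h2)
  have hgper : ∀ τ n y, g (Z τ (y + lat n)) = g (Z τ y) := fun τ n y => by
    rw [hZpt, hZpt, hper, add_right_comm, hg, expPull_add_lat]
  -- a convex neighborhood of the parameter interval
  have hKc : IsCompact ((segment ℝ (0 : ℂ) 1) ×ˢ closedCube d) := by
    have hseg : IsCompact (segment ℝ (0 : ℂ) 1) := by
      rw [segment_eq_image]
      exact isCompact_Icc.image (by fun_prop)
    exact hseg.prod isCompact_closedCube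
  have hO : IsOpen {p : ℂ × RSp d | g (Z p.1 p.2) ≠ 0} :=
    isOpen_ne_fun (hgc.comp hZc) continuous_const
  obtain ⟨δ, hδ, hthick⟩ := hKc.exists_thickening_subset_open hO (by
      rintro ⟨τ, y⟩ ⟨hτ, -⟩
      rw [segment_eq_image] at hτ
      obtain ⟨t, ht, rfl⟩ := hτ
      have := hne t ht y
      change g (Z _ y) ≠ 0
      rw [hZpt]
      simpa using this)
  set Ω : Set ℂ := Metric.thickening δ (segment ℝ (0 : ℂ) 1) with hΩ
  have hΩo : IsOpen Ω := Metric.isOpen_thickening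
  have hΩc : Convex ℝ Ω := (convex_segment _ _).thickening δ
  have h0Ω : (0 : ℂ) ∈ Ω := Metric.self_subset_thickening hδ _ (left_mem_segment ℝ _ _)
  have h1Ω : (1 : ℂ) ∈ Ω := Metric.self_subset_thickening hδ _ (right_mem_segment ℝ _ _)
  have hstar : ∀ τ ∈ Ω, ∀ θ ∈ Icc (0 : ℝ) 1, (θ : ℂ) * τ ∈ Ω := by
    intro τ hτ θ hθ
    have := hΩc h0Ω hτ (sub_nonneg.2 hθ.2) hθ.1 (sub_add_cancel 1 θ)
    simpa using this
  have hgne : ∀ τ ∈ Ω, ∀ y, g (Z τ y) ≠ 0 := by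
    intro τ hτ y
    obtain ⟨n, hn⟩ := exists_add_lat_mem_cube y
    rw [← hgper τ n]
    obtain ⟨τ', hτ', hdist⟩ := Metric.mem_thickening_iff.1 hτ
    have hmem : (τ, y + lat n) ∈ Metric.thickening δ (segment ℝ (0 : ℂ) 1 ×ˢ closedCube d) :=
      Metric.mem_thickening_iff.2 ⟨(τ', y + lat n), ⟨hτ', cube_subset_closedCube hn⟩, by
        simpa [Prod.dist_eq] using hdist⟩
    have := hthick hmem
    exact this
  have hqne : ∀ j ∈ singIdx s, ∀ τ ∈ Ω, ∀ y, expPull (Q j) (Z τ y) ≠ 0 := by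
    intro j hj τ hτ y
    have := hgne τ hτ y
    rw [hg, expPull_singularPart, Finset.prod_ne_zero_iff] at this
    exact this j hj
  have hseg : ∀ j ∈ singIdx s, ∀ τ ∈ Ω, ∀ y, ∀ θ ∈ Icc (0 : ℝ) 1,
      expPull (Q j) (pt b y + (θ : ℂ) • τ • cx (v y)) ≠ 0 := by
    intro j hj τ hτ y θ hθ
    rw [smul_smul]
    exact hqne j hj _ (hstar τ hτ θ hθ) y
  -- continuation of the logarithms along the deformation
  set Λ : ℂ → RSp d → Fin k → ℂ := fun τ y j =>
    l j (pt b y) + logInc (expPull (Q j)) (pt b y) (τ • cx (v y)) with hΛ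
  have hΛexp : ∀ τ ∈ Ω, ∀ y, ∀ j ∈ singIdx s,
      Complex.exp (Λ τ y j) = expPull (Q j) (Z τ y) := by
    intro τ hτ y j hj
    rw [hΛ, Complex.exp_add, h.exp_eq j hj _ (pt_mem_tube hb y), mul_comm]
    exact exp_logInc_mul (analyticOnNhd_expPull (Q j)) (hseg j hj τ hτ y)
  have hptc : Continuous fun y : RSp d => pt b y := Continuous.pt continuous_const continuous_id
  have hΛc : ∀ j ∈ singIdx s, ContinuousOn (fun p : ℂ × RSp d => Λ p.1 p.2 j) (Ω ×ˢ univ) := by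
    intro j hj
    refine ContinuousOn.add ?_ ?_
    · have h1 : Continuous fun y => l j (pt b y) :=
        (h.differentiableOn j hj).continuousOn.comp_continuous hptc (pt_mem_tube hb)
      exact (h1.comp continuous_snd).continuousOn
    · refine continuousOn_logInc (analyticOnNhd_expPull (Q j)) (hΩo.prod isOpen_univ)
        (hptc.comp continuous_snd) (continuous_fst.smul (Continuous.cx (hvc.comp continuous_snd))) ?_
      rintro ⟨τ, y⟩ ⟨hτ, -⟩ θ hθ
      exact hseg j hj τ hτ y θ hθ
  have hΛd : ∀ j ∈ singIdx s, ∀ y, DifferentiableOn ℂ (fun τ => Λ τ y j) Ω := by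
    intro j hj y
    exact (differentiableOn_logInc (analyticOnNhd_expPull (Q j)) hΩo _ _ fun τ hτ θ hθ =>
      hseg j hj τ hτ y θ hθ).const_add _
  obtain ⟨n₀, hn₀⟩ := h.exists_eq_phase_mul
  set V : ℂ → RSp d → ℂ := fun τ y => phase s n₀ * branchVal Q s (Λ τ y) (Z τ y) with hV
  have hVc : ContinuousOn (fun p : ℂ × RSp d => V p.1 p.2) (Ω ×ˢ univ) := by
    refine continuousOn_const.mul ?_
    unfold branchVal
    refine continuousOn_finsetProd _ fun j _ => ?_
    split_ifs with hj
    · exact Complex.continuous_exp.comp_continuousOn (continuousOn_const.mul (hΛc j hj))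
    · exact (((continuous_expPull (Q j)).comp hZc).pow _).continuousOn
  have hVd : ∀ y, DifferentiableOn ℂ (fun τ => V τ y) Ω := by
    intro y
    refine DifferentiableOn.const_mul ?_ _
    unfold branchVal
    refine DifferentiableOn.fun_finsetProd fun j _ => ?_
    split_ifs with hj
    · exact ((hΛd j hj y).const_mul _).cexp
    · have hline : Differentiable ℂ fun τ : ℂ => Z τ y := by
        simp only [hZ]; fun_prop
      exact (((differentiable_of_analyticOnNhd (analyticOnNhd_expPull (Q j))).comp hline).pow
        _).differentiableOn
  refine ⟨V 1, fun y => ⟨phase s n₀, _, norm_phase _ _, rfl, ?_⟩, fun n => ?_⟩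
  · have e : Z 1 y = pt (b + v y) y := by rw [hZpt]; simp
    rw [← e]
    exact isValue_branchVal (hΛexp 1 h1Ω y)
  have hfinm : IsFiniteMeasure (volume.restrict (cube d)) :=
    ⟨by rw [Measure.restrict_apply_univ]; exact volume_cube_lt_top⟩
  set E : ℂ → RSp d → ℂ := fun τ y => V τ y * Complex.exp (-pair (natVec n) (Z τ y)) with hE
  have hEc : ContinuousOn (fun p : ℂ × RSp d => E p.1 p.2) (Ω ×ˢ univ) :=
    hVc.mul (Complex.continuous_exp.comp ((continuous_pair _).comp hZc).neg).continuousOn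
  have hEd : ∀ y, DifferentiableOn ℂ (fun τ => E τ y) Ω := by
    intro y
    refine (hVd y).mul (Differentiable.differentiableOn ?_)
    simp only [hZ, pair_add, pair_smul]
    fun_prop
  -- the integrals over the deformed tori are holomorphic in `τ`
  set J : ℂ → ℂ := fun τ => ∫ y in cube d, E τ y * detParam v τ y with hJ
  have hJd : DifferentiableOn ℂ J Ω := by
    refine differentiableOn_integral_of_locally_bounded hΩo (fun τ hτ => ?_)
      (Eventually.of_forall fun y => (hEd y).mul (differentiable_detParam v y).differentiableOn)
      fun τ₀ hτ₀ => ?_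
    · have : Continuous fun y => E τ y :=
        hEc.comp_continuous (f := fun y : RSp d => (τ, y)) (by fun_prop) fun y => ⟨hτ, mem_univ _⟩
      exact this.aestronglyMeasurable.mul (measurable_detParam v τ).aestronglyMeasurable
    · obtain ⟨ρ, hρ, hball⟩ := Metric.isOpen_iff.1 hΩo τ₀ hτ₀
      have hsub : Metric.closedBall τ₀ (ρ / 2) ⊆ Ω :=
        (Metric.closedBall_subset_ball (by linarith)).trans hball
      obtain ⟨M, hM0, hM⟩ := exists_pos_bound_of_isCompact
        ((isCompact_closedBall τ₀ (ρ / 2)).prod (isCompact_closedCube (d := d)))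
        (hEc.mono (prod_mono hsub (subset_univ _)))
      refine ⟨ρ / 2, by positivity,
        M * ((d.factorial : ℝ) * (1 + (‖τ₀‖ + ρ / 2) * L) ^ d), ?_⟩
      filter_upwards [ae_restrict_mem measurableSet_cube] with y hy τ hτ
      rw [norm_mul]
      have h1 := hM (τ, y) ⟨Metric.ball_subset_closedBall hτ, cube_subset_closedCube hy⟩
      have h2 : ‖τ‖ ≤ ‖τ₀‖ + ρ / 2 := by
        rw [Metric.mem_ball, dist_eq_norm] at hτ
        linarith [norm_sub_norm_le τ τ₀]
      refine mul_le_mul h1 ((norm_detParam_le hL hv τ y).trans ?_) (norm_nonneg _) hM0.le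
      gcongr
  -- for `τ = i σ` the deformed torus is the original one, reparametrized by `y + σ v (y)`
  have hJ0 : ∀ σ : ℝ, (σ : ℂ) * Complex.I ∈ Ω → |σ| * L < 1 →
      J (σ * Complex.I) = volume.real (cube d) * a n := by
    intro σ hσ hσL
    rw [← integral_cube_expSeries hd h.summable hb n,
      ← setIntegral_cube_comp_mul_det hd hL hv hper hN hdiff hσL
      (H := fun y => expSeries a (pt b y) * Complex.exp (-pair (natVec n) (pt b y)))]
    · refine setIntegral_congr_fun measurableSet_cube fun y _ => ?_
      have e : Z (σ * Complex.I) y = pt b (y + σ • v y) := by rw [hZpt]; simp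
      have e1 : V (σ * Complex.I) y = expSeries a (pt b (y + σ • v y)) := by
        rw [hn₀ _ (pt_mem_tube hb _), hV]
        simp only [e]
        unfold branchVal
        congr 1
        refine Finset.prod_congr rfl fun j _ => ?_
        split_ifs with hj
        · have e2 : pt b y + ((σ : ℂ) * Complex.I) • cx (v y) = pt b (y + σ • v y) := e
          rw [hΛ]
          simp only
          rw [logInc_eq_sub (analyticOnNhd_expPull (Q j)) (isOpen_tube c) (h.differentiableOn j hj)
            (h.exp_eq j hj), e2, add_sub_cancel]
          intro θ _
          have e3 : pt b y + (θ : ℂ) • ((σ : ℂ) * Complex.I) • cx (v y)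
              = pt b (y + (θ * σ) • v y) := by
            rw [smul_smul, smul_cx, ← pt_add]; simp
          rw [e3]
          exact pt_mem_tube hb _
        · rfl
      simp only [hE]
      rw [e1, e, detParam_I_mul]
    · intro m y
      have h1 : ∀ y, expSeries a (pt b (y + lat m)) = expSeries a (pt b y) := fun y => by
        unfold expSeries
        refine tsum_congr fun i => ?_
        rw [exp_pair_add_lat ⟨fun j => i j, fun j => by simp [natVec]⟩]
      rw [h1, Complex.exp_neg, Complex.exp_neg,
        exp_pair_add_lat ⟨fun j => n j, fun j => by simp [natVec]⟩]
  have hfreq : ∃ᶠ τ in 𝓝[≠] (0 : ℂ), J τ = volume.real (cube d) * a n := by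
    have hcont : Continuous fun σ : ℝ => (σ : ℂ) * Complex.I := by fun_prop
    have ht : Tendsto (fun σ : ℝ => (σ : ℂ) * Complex.I) (𝓝[≠] 0) (𝓝[≠] 0) := by
      refine tendsto_nhdsWithin_iff.2 ⟨?_, ?_⟩
      · have := hcont.tendsto 0
        rw [Complex.ofReal_zero, zero_mul] at this
        exact this.mono_left nhdsWithin_le_nhds
      · filter_upwards [self_mem_nhdsWithin] with σ hσ
        exact mul_ne_zero (by exact_mod_cast hσ) Complex.I_ne_zero
    refine ht.frequently (Eventually.frequently ?_)
    have h2 : ∀ᶠ σ : ℝ in 𝓝[≠] 0, (σ : ℂ) * Complex.I ∈ Ω :=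
      ht.eventually (mem_nhdsWithin_of_mem_nhds (hΩo.mem_nhds h0Ω))
    have h3 : ∀ᶠ σ : ℝ in 𝓝[≠] 0, |σ| * L < 1 := by
      have : Continuous fun σ : ℝ => |σ| * L := by fun_prop
      refine nhdsWithin_le_nhds ((this.tendsto 0).eventually_lt_const ?_)
      rw [abs_zero, zero_mul]
      exact one_pos
    filter_upwards [h2, h3] with σ h2 h3 using hJ0 σ h2 h3
  -- the identity theorem extends the equality from small imaginary `τ` to `τ = 1`
  have key := (hJd.analyticOnNhd hΩo).eqOn_of_preconnected_of_frequently_eq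
    analyticOnNhd_const hΩc.isPreconnected h0Ω hfreq h1Ω
  simp only at key
  rw [← key, hJ]
  refine setIntegral_congr_fun measurableSet_cube fun y _ => ?_
  have e : Z 1 y = pt (b + v y) y := by rw [hZpt]; simp
  simp only [hE, e]

/-! ### Estimates of the Taylor coefficients -/

theorem exists_exp_neg_le_rpow {a : ℝ} (ha : 0 < a) (p : ℝ) :
    ∃ C > 0, ∀ t : ℝ, 1 ≤ t → Real.exp (-(a * t)) ≤ C * t ^ (-p) := by
  have h := tendsto_rpow_mul_exp_neg_mul_atTop_nhds_zero p a ha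
  obtain ⟨R, hR⟩ := Filter.eventually_atTop.1 (h.eventually_le_const (show (0 : ℝ) < 1 by norm_num))
  have hcont : ContinuousOn (fun t : ℝ => t ^ p * Real.exp (-a * t)) (Icc 1 (max R 1)) :=
    ContinuousOn.mul (continuousOn_id.rpow_const fun t ht => Or.inl (by
      have : (1 : ℝ) ≤ t := ht.1
      simp only [id]
      linarith)) (by fun_prop)
  obtain ⟨M, hM0, hM⟩ := exists_pos_bound_of_isCompact isCompact_Icc hcont
  refine ⟨max M 1, by positivity, fun t ht => ?_⟩
  have ht0 : 0 < t := by linarith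
  have h1 : t ^ p * Real.exp (-a * t) ≤ max M 1 := by
    rcases le_total t (max R 1) with h2 | h2
    · exact ((le_abs_self _).trans (hM t ⟨ht, h2⟩)).trans (le_max_left _ _)
    · exact (hR t ((le_max_left _ _).trans h2)).trans (le_max_right _ _)
  rw [Real.rpow_neg ht0.le, ← div_eq_mul_inv, le_div_iff₀ (by positivity), mul_comm, ← neg_mul]
  exact h1

namespace TubeData

variable {g : CSp d → ℂ} {B : Set (RSp d)} {r x : RSp d}

/-- Small balls around the critical points are disjoint: near a critical point, a projective field shows
that no other point is critical. -/
theorem exists_isNhdFamily (T : TubeData g B x) (hr : r ≠ 0)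
    (hfin : (critSet g B r x ∩ cube d).Finite) (hobs : NonObstructed g B r x) :
    ∃ U, IsNhdFamily (critSet g B r x) U := by
  obtain ⟨κ, hκ, H⟩ := T.exists_uniform_radius hfin
    (p := fun w y => y ∈ critSet g B r x → y = w)
    (fun w hw n y h hy => add_right_cancel (h ((T.critSet_add_lat_iff r n y).2 hy))) fun w hw => by
      obtain ⟨η, hη⟩ := T.exists_isProjectiveField hr (hobs.2 w hw)
      obtain ⟨κ, hκ, h1⟩ := hη.exists_mem_logCone T
      refine ⟨κ, hκ, fun y hy hyW => ?_⟩
      by_contra hne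
      have h2 : 0 < ‖y - w‖ := norm_pos_iff.2 (sub_ne_zero.2 hne)
      have h3 : η (y - w) ∈ logCone g B x y := h1 y hne hy
      have h4 := hyW.2 _ h3
      have h5 := Filter.Eventually.self_of_nhds hη.growth (y - w)
      have h6 : 0 < ‖r‖ := norm_pos_iff.2 hr
      nlinarith
  refine ⟨fun w => Metric.ball w (κ / 2), fun w _ => Metric.isOpen_ball,
    fun w _ => Metric.mem_ball_self (by positivity), fun w _ => Metric.isBounded_ball, ?_, ?_⟩
  · intro w hw w' hw' hne
    rw [Set.disjoint_left]
    intro y hy hy'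
    refine hne (H w' hw' w ?_ hw)
    rw [Metric.mem_ball] at hy hy'
    rw [← dist_eq_norm]
    linarith [dist_triangle_left w w' y]
  · intro w _ n y
    rw [Metric.mem_ball, Metric.mem_ball, dist_add_right]

end TubeData

namespace IsLocProjField

variable {Q : Fin k → MvPolynomial (Fin d) ℂ} {s : Fin k → ℝ} {g : CSp d → ℂ} {B : Set (RSp d)}
  {r x : RSp d} {U : RSp d → Set (RSp d)} {η : RSp d → RSp d}

/-- The segments from a point `x + u` of `B` to the chain `x + σ u + ε η` avoid the zeros of
`g`. -/
theorem exists_free_segment (T : TubeData g B x) (hr : r ≠ 0) (h : IsLocProjField g B r x U η)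
    {u : RSp d} (hu : x + u ∈ B) :
    ∃ δ > (0 : ℝ), ∀ ε ∈ Ioo 0 δ, ∀ σ ∈ Ioo (0 : ℝ) 1, ∀ t ∈ Icc (0 : ℝ) 1, ∀ y,
      g (pt (x + ((1 - t + t * σ) • u + (t * ε) • η y)) y) ≠ 0 := by
  have hut : u ∈ tanCone B x := by simpa using T.sub_mem_tanCone hu
  obtain ⟨δ, hδ, hfree⟩ := h.exists_free T hr hut
  obtain ⟨M, hM, hMb⟩ := h.exists_bound T hr
  have hcpt : IsCompact ((fun p : ℝ => x + p • u) '' Icc δ 1) := isCompact_Icc.image (by fun_prop)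
  obtain ⟨μ, hμ, hthick⟩ := hcpt.exists_thickening_subset_open T.isOpen (by
    rintro _ ⟨p, hp, rfl⟩
    exact T.add_smul_mem (t := 1) (by rwa [one_smul]) (hδ.trans_le hp.1) hp.2)
  refine ⟨min δ (μ / M), by positivity, fun ε hε σ hσ t ht y => ?_⟩
  have hε1 : ε < δ := hε.2.trans_le (min_le_left _ _)
  have hε2 : ε < μ / M := hε.2.trans_le (min_le_right _ _)
  have hp0 : 0 < 1 - t + t * σ := by
    rcases ht.1.eq_or_lt with rfl | h0
    · simp
    · have := mul_pos h0 hσ.1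
      linarith [ht.2]
  have hp1 : 1 - t + t * σ ≤ 1 := by nlinarith [ht.1, hσ.2]
  have hte : 0 ≤ t * ε := mul_nonneg ht.1 hε.1.le
  have hte' : t * ε ≤ ε := by nlinarith [ht.2, hε.1]
  -- if the weight of `u` is small, the displacement is free by `exists_free`; otherwise its real part is
  -- close to the compact part of the segment from `x` to `x + u` lying in `B`
  by_cases hp : 1 - t + t * σ < δ
  · exact hfree y _ ⟨hp0.le, hp⟩ _ ⟨hte, hte'.trans_lt hε1⟩ (Or.inl hp0)
  · push Not at hp
    rw [← add_assoc]
    refine T.ne_zero _ (hthick (Metric.mem_thickening_iff.2 ⟨_, ⟨_, ⟨hp, hp1⟩, rfl⟩, ?_⟩)) y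
    rw [dist_eq_norm, add_sub_cancel_left, norm_smul, Real.norm_of_nonneg hte]
    calc t * ε * ‖η y‖ ≤ ε * M := mul_le_mul hte' (hMb y) (norm_nonneg _) hε.1.le
      _ < μ / M * M := by gcongr
      _ = μ := by field_simp

/-- The Taylor coefficients are bounded by integrals of values of `F` over the deformed torus. The
bounds are stated with the Lebesgue integral of nonnegative functions, as the measurability of the
values is not needed. -/
theorem exists_coeff_le_lintegral (hd : 0 < d) (hg : g = expPull (singularPart Q s))
    (T : TubeData g B x) (hr : r ≠ 0) (hfin : (critSet g B r x ∩ cube d).Finite)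
    (h : IsLocProjField g B r x U η) (hB : ∃ c : RSp d, ∀ y : RSp d, (∀ i, y i < c i) → y ∈ B)
    {a : (Fin d → ℕ) → ℂ} (ha : IsTaylorCoeff Q s a) :
    ∃ u ∈ tanCone B x, ∃ δ > (0 : ℝ), ∀ ε ∈ Ioo 0 δ, ∃ D : ℝ, 0 ≤ D ∧ ∀ σ ∈ Ioo (0 : ℝ) 1,
      ∃ V : RSp d → ℂ,
        (∀ y, IsValue Q s (fun i => Complex.exp (pt (x + (σ • u + ε • η y)) y i)) (V y)) ∧
        ∀ n, ENNReal.ofReal ‖a n‖ ≤ ENNReal.ofReal D * ∫⁻ y in closedCube d,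
          ENNReal.ofReal (‖V y‖ * Real.exp (-inner ℝ (natVec n) (x + (σ • u + ε • η y)))) := by
  obtain ⟨c, l, hTB⟩ := ha.exists_tubeBranch
  obtain ⟨c₀, hc₀⟩ := hB
  set b : RSp d := WithLp.toLp 2 fun i => min c (c₀ i) - 1 with hb
  have hbc : ∀ i, b i < c := fun i => by
    have := min_le_left c (c₀ i)
    simp only [hb]; linarith
  have hbB : b ∈ B := hc₀ b fun i => by
    have := min_le_right c (c₀ i)
    simp only [hb]; linarith
  obtain ⟨δ, hδ, hfree⟩ := h.exists_free_segment T hr (u := b - x) (by rwa [add_sub_cancel])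
  obtain ⟨L, hL, hlip⟩ := h.exists_lipschitz T hr
  have hvol : 0 < volume.real (cube d) :=
    ENNReal.toReal_pos volume_cube_ne_zero volume_cube_lt_top.ne
  refine ⟨b - x, T.sub_mem_tanCone hbB, δ, hδ, fun ε hε => ⟨(volume.real (cube d))⁻¹ *
    ((d.factorial : ℝ) * (1 + ε * L) ^ d), by have := hε.1; positivity, fun σ hσ => ?_⟩⟩
  set u := b - x with hu
  have hε0 := hε.1
  -- the field deforming the torus over `b` to the chain `x + σ u + ε η`
  set v : RSp d → RSp d := fun y => (-1 + σ) • u + ε • η y with hv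
  have hbv : ∀ (t : ℝ) y, b + t • v y = x + ((1 - t + t * σ) • u + (t * ε) • η y) := by
    intro t y
    have e : b = x + u := by rw [hu, add_sub_cancel]
    rw [e, hv]
    simp only
    module
  have hbv1 : ∀ y, b + v y = x + (σ • u + ε • η y) := by
    intro y
    have := hbv 1 y
    simpa using this
  have hvlip : ∀ a b, ‖v a - v b‖ ≤ ε * L * ‖a - b‖ := by
    intro p q
    rw [hv]
    simp only [add_sub_add_left_eq_sub]
    rw [← smul_sub, norm_smul, Real.norm_of_nonneg hε0.le, mul_assoc]
    gcongr
    exact hlip p q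
  obtain ⟨V, hV, hint⟩ := hTB.exists_deformed_integral hd hbc (v := v) (L := ε * L) (by positivity)
    hvlip (fun n y => by simp only [hv, h.periodic]) hfin
    (fun y hy => ((h.differentiableAt T hr hy).const_smul ε).const_add _) (fun t ht y => by
      rw [hbv, ← hg]
      exact hfree ε hε σ hσ t ht y)
  choose ζ V' hζ hVV' hV' using hV
  refine ⟨V', fun y => ?_, fun n => ?_⟩
  · rw [← hbv1]; exact hV' y
  have hne : ENNReal.ofReal (volume.real (cube d)) ≠ 0 := by simpa using hvol
  have e1 : ENNReal.ofReal ‖a n‖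
      = ENNReal.ofReal (volume.real (cube d))⁻¹ * ‖(volume.real (cube d) : ℂ) * a n‖ₑ := by
    rw [← ofReal_norm, ← ENNReal.ofReal_mul (by positivity), norm_mul, Complex.norm_real,
      Real.norm_of_nonneg hvol.le, inv_mul_cancel_left₀ hvol.ne']
  rw [e1, hint n, ENNReal.ofReal_mul (by positivity), mul_assoc]
  gcongr
  refine (enorm_integral_le_lintegral_enorm _).trans ?_
  rw [← lintegral_const_mul' _ _ ENNReal.ofReal_ne_top]
  refine (lintegral_mono fun y => ?_).trans (lintegral_mono_set cube_subset_closedCube)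
  rw [← ofReal_norm, ← ENNReal.ofReal_mul (by positivity)]
  refine ENNReal.ofReal_le_ofReal ?_
  rw [norm_mul, norm_mul, norm_exp_neg_pair, hVV', norm_mul, hζ, one_mul, hbv1, mul_comm]
  have := norm_detParam_le (by positivity) hvlip 1 y
  rw [norm_one, one_mul] at this
  gcongr

/-- The contribution of a neighborhood of a critical point, for the deformed torus at height
`σ = σ₀ / |r'|`. After rescaling by `|r'|`, the height becomes the constant `σ₀`. -/
theorem exists_lintegral_le_near (hd : 0 < d) (hQ : ∀ j, Q j ≠ 0)
    (hg : g = expPull (singularPart Q s)) (T : TubeData g B x) (hr : r ≠ 0)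
    (hfin : (critSet g B r x ∩ cube d).Finite) (h : IsLocProjField g B r x U η) {u : RSp d}
    (hu : u ∈ tanCone B x) :
    ∃ δ₀ > (0 : ℝ), ∀ ε ∈ Ioo 0 δ₀, ∀ w ∈ critSet g B r x, ∀ m ≤ degF Q s (pt x w),
      ∃ κ > 0, ∃ δ > 0, ∃ σ₁ > (0 : ℝ), ∀ σ₀ ∈ Ioo 0 σ₁, ∃ C : ℝ, 0 ≤ C ∧
        ∀ r' ∈ conicNhd r δ, 1 ≤ ‖r'‖ → ∀ V : RSp d → ℂ,
          (∀ y, IsValue Q s (fun i => Complex.exp (pt (x + ((σ₀ / ‖r'‖) • u + ε • η y)) y i))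
            (V y)) →
          ∫⁻ y in Metric.ball w κ, ENNReal.ofReal (‖V y‖ * Real.exp (-inner ℝ r' (ε • η y)))
            ≤ ENNReal.ofReal (C * ‖r'‖ ^ (-((d : ℝ) + m))) := by
  obtain ⟨δ₀, hδ₀, hval⟩ := h.exists_isValue_bound_near hQ hg T hr hfin hu
  obtain ⟨δ, hδ, hdec⟩ := h.exists_inner_ge_near T hr hfin
  refine ⟨δ₀, hδ₀, fun ε hε w hw m hm => ?_⟩
  obtain ⟨K, hK, κ, hκ, hval⟩ := hval w hw ε hε
  refine ⟨min κ δ, by positivity, δ, hδ, κ, hκ, fun σ₀ hσ₀ => ?_⟩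
  set β := degF Q s (pt x w) with hβ
  have hφ := integrable_exp_neg_norm_mul_add_rpow hd (a := ε) (σ := σ₀) β hε.1 hσ₀.1
  set φ : RSp d → ℝ := fun y => Real.exp (-(ε * ‖y‖)) * (‖y‖ + σ₀) ^ β with hφdef
  have hφ0 : ∀ y, 0 ≤ φ y := fun y => by
    have := hσ₀.1
    positivity
  refine ⟨K * ∫ y, φ y, mul_nonneg hK.le (integral_nonneg hφ0), fun r' hr' hr1 V hV => ?_⟩
  have hr0 : 0 < ‖r'‖ := by linarith
  have hI : Integrable fun y => K * ‖r'‖ ^ (-β) * φ (‖r'‖ • (y - w)) :=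
    ((hφ.comp_smul hr0.ne').comp_sub_right w).const_mul _
  calc ∫⁻ y in Metric.ball w (min κ δ),
        ENNReal.ofReal (‖V y‖ * Real.exp (-inner ℝ r' (ε • η y)))
      ≤ ∫⁻ y in Metric.ball w (min κ δ),
        ENNReal.ofReal (K * ‖r'‖ ^ (-β) * φ (‖r'‖ • (y - w))) := by
        refine setLIntegral_mono' Metric.isOpen_ball.measurableSet fun y hy => ?_
        refine ENNReal.ofReal_le_ofReal ?_
        rw [Metric.mem_ball, dist_eq_norm, lt_min_iff] at hy
        have hσ : 0 < σ₀ / ‖r'‖ := div_pos hσ₀.1 hr0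
        have h1 := hval (σ₀ / ‖r'‖) ⟨hσ.le, (div_le_self hσ₀.1.le hr1).trans_lt hσ₀.2⟩ y hy.1
          (Or.inl hσ) (V y) (hV y)
        have h2 : Real.exp (-inner ℝ r' (ε • η y)) ≤ Real.exp (-(ε * ‖‖r'‖ • (y - w)‖)) := by
          rw [Real.exp_le_exp, real_inner_smul_right, norm_smul, norm_norm]
          exact neg_le_neg (mul_le_mul_of_nonneg_left (hdec r' hr' w hw y hy.2) hε.1.le)
        have h3 : (‖y - w‖ + σ₀ / ‖r'‖) ^ β = ‖r'‖ ^ (-β) * (‖‖r'‖ • (y - w)‖ + σ₀) ^ β := by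
          have e : ‖y - w‖ + σ₀ / ‖r'‖ = ‖r'‖⁻¹ * (‖‖r'‖ • (y - w)‖ + σ₀) := by
            rw [norm_smul, norm_norm]
            field_simp
          have := hσ₀.1
          rw [e, Real.mul_rpow (by positivity) (by positivity), Real.inv_rpow hr0.le,
            Real.rpow_neg hr0.le]
        calc ‖V y‖ * Real.exp (-inner ℝ r' (ε • η y))
            ≤ K * (‖y - w‖ + σ₀ / ‖r'‖) ^ β * Real.exp (-(ε * ‖‖r'‖ • (y - w)‖)) := by gcongr
          _ = K * ‖r'‖ ^ (-β) * φ (‖r'‖ • (y - w)) := by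
            rw [h3, hφdef]
            ring
    _ ≤ ∫⁻ y, ENNReal.ofReal (K * ‖r'‖ ^ (-β) * φ (‖r'‖ • (y - w))) := setLIntegral_le_lintegral _ _
    _ = ENNReal.ofReal (∫ y, K * ‖r'‖ ^ (-β) * φ (‖r'‖ • (y - w))) :=
        (ofReal_integral_eq_lintegral_ofReal hI (Eventually.of_forall fun y => by
          have := hφ0 (‖r'‖ • (y - w))
          simp only [Pi.zero_apply]
          positivity)).symm
    _ ≤ _ := by
        refine ENNReal.ofReal_le_ofReal ?_
        rw [integral_const_mul, integral_sub_right_eq_self (fun y => φ (‖r'‖ • y)),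
          Measure.integral_comp_smul, finrank_euclideanSpace, Fintype.card_fin, smul_eq_mul,
          abs_of_nonneg (by positivity)]
        have e : K * ‖r'‖ ^ (-β) * ((‖r'‖ ^ d)⁻¹ * ∫ y, φ y)
            = (K * ∫ y, φ y) * ‖r'‖ ^ (-((d : ℝ) + β)) := by
          rw [neg_add, Real.rpow_add hr0, Real.rpow_neg hr0.le (d : ℝ), Real.rpow_natCast]
          ring
        rw [e]
        refine mul_le_mul_of_nonneg_left ?_ (mul_nonneg hK.le (integral_nonneg hφ0))
        exact Real.rpow_le_rpow_of_exponent_le hr1 (by linarith)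

/-- The contribution of a neighborhood of a noncritical point decays exponentially. -/
theorem exists_lintegral_le_far (hg : g = expPull (singularPart Q s)) (T : TubeData g B x)
    (hr : r ≠ 0) (h : IsLocProjField g B r x U η) {u : RSp d} (hu : u ∈ tanCone B x) :
    ∃ δ₀ > (0 : ℝ), ∀ ε ∈ Ioo 0 δ₀, ∀ w ∉ critSet g B r x, ∀ m : ℝ,
      ∃ κ > 0, ∃ δ > 0, ∃ σ₁ > (0 : ℝ), ∀ σ₀ ∈ Ioo 0 σ₁, ∃ C : ℝ, 0 ≤ C ∧
        ∀ r' ∈ conicNhd r δ, 1 ≤ ‖r'‖ → ∀ V : RSp d → ℂ,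
          (∀ y, IsValue Q s (fun i => Complex.exp (pt (x + ((σ₀ / ‖r'‖) • u + ε • η y)) y i))
            (V y)) →
          ∫⁻ y in Metric.ball w κ, ENNReal.ofReal (‖V y‖ * Real.exp (-inner ℝ r' (ε • η y)))
            ≤ ENNReal.ofReal (C * ‖r'‖ ^ (-((d : ℝ) + m))) := by
  obtain ⟨δ₀, hδ₀, hfree⟩ := h.exists_free T hr hu
  refine ⟨δ₀, hδ₀, fun ε hε w hw m => ?_⟩
  obtain ⟨κ', hκ', hball⟩ := Metric.isOpen_iff.1 (T.isClosed_critSet hr).isOpen_compl w hw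
  set κ := κ' / 2 with hκ
  have hκ0 : 0 < κ := by positivity
  have hdist : ∀ y ∈ Metric.closedBall w κ, y ∉ critSet g B r x := fun y hy =>
    hball (Metric.closedBall_subset_ball (by linarith) hy)
  obtain ⟨c, hc, δ, hδ, hdec⟩ := h.exists_inner_ge_far T hr (κ := κ) hκ0
  have hη := h.continuous T hr
  have hS := (((isCompact_Icc (a := (0 : ℝ)) (b := δ₀ / 2)).prod
    (isCompact_closedBall w κ)).image (f := fun p : ℝ × RSp d =>
      pt (x + (p.1 • u + ε • η p.2)) p.2) (Continuous.pt (by fun_prop) (by fun_prop)))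
  obtain ⟨K, hK, hval⟩ := exists_isValue_bound_of_isCompact Q s hS (by
    rintro _ ⟨⟨σ, y⟩, ⟨hσ, hy⟩, rfl⟩
    rw [← hg]
    exact hfree y σ ⟨hσ.1, hσ.2.trans_lt (half_lt_self hδ₀)⟩ ε ⟨hε.1.le, hε.2⟩
      (Or.inr ⟨hε.1, hdist y hy⟩))
  obtain ⟨C, hC, hexp⟩ := exists_exp_neg_le_rpow (mul_pos hε.1 hc) ((d : ℝ) + m)
  refine ⟨κ, hκ0, δ, hδ, δ₀ / 2, by positivity, fun σ₀ hσ₀ =>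
    ⟨K * C * volume.real (Metric.ball w κ), by positivity, fun r' hr' hr1 V hV => ?_⟩⟩
  have hr0 : 0 < ‖r'‖ := by linarith
  have hvol : volume (Metric.ball w κ) ≠ ⊤ := measure_ball_lt_top.ne
  calc ∫⁻ y in Metric.ball w κ, ENNReal.ofReal (‖V y‖ * Real.exp (-inner ℝ r' (ε • η y)))
      ≤ ∫⁻ y in Metric.ball w κ, ENNReal.ofReal (K * (C * ‖r'‖ ^ (-((d : ℝ) + m)))) := by
        refine setLIntegral_mono' Metric.isOpen_ball.measurableSet fun y hy => ?_
        refine ENNReal.ofReal_le_ofReal ?_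
        have h1 := hval _ ⟨(σ₀ / ‖r'‖, y), ⟨⟨(div_pos hσ₀.1 hr0).le,
          (div_le_self hσ₀.1.le hr1).trans hσ₀.2.le⟩, Metric.ball_subset_closedBall hy⟩, rfl⟩
          (V y) (hV y)
        have h2 : Real.exp (-inner ℝ r' (ε • η y)) ≤ Real.exp (-(ε * c * ‖r'‖)) := by
          rw [Real.exp_le_exp, real_inner_smul_right]
          have h3 := hdec r' hr' y fun w' hw' => by
            by_contra! hlt
            refine hball ?_ hw'
            rw [Metric.mem_ball, dist_eq_norm] at hy ⊢
            have e : w' - w = (y - w) - (y - w') := by abel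
            rw [e]
            linarith [norm_sub_le (y - w) (y - w')]
          have := mul_le_mul_of_nonneg_left h3 hε.1.le
          linarith
        exact mul_le_mul h1 (h2.trans (hexp _ hr1)) (Real.exp_pos _).le hK.le
    _ = ENNReal.ofReal (K * C * volume.real (Metric.ball w κ) * ‖r'‖ ^ (-((d : ℝ) + m))) := by
        rw [setLIntegral_const, Measure.real, ← ENNReal.ofReal_toReal hvol,
          ← ENNReal.ofReal_mul (by positivity), ENNReal.toReal_ofReal ENNReal.toReal_nonneg]
        congr 1
        ring

/-- The bound of the Taylor coefficients: the estimates near the points of the fundamental cube are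
collected by compactness. -/
theorem exists_coeff_bound (hd : 0 < d) (hQ : ∀ j, Q j ≠ 0)
    (hg : g = expPull (singularPart Q s)) (T : TubeData g B x) (hr : r ≠ 0)
    (hfin : (critSet g B r x ∩ cube d).Finite) (h : IsLocProjField g B r x U η)
    (hB : ∃ c : RSp d, ∀ y : RSp d, (∀ i, y i < c i) → y ∈ B)
    {a : (Fin d → ℕ) → ℂ} (ha : IsTaylorCoeff Q s a) {m : ℝ}
    (hm : ∀ w ∈ critSet g B r x, m ≤ degF Q s (pt x w)) :
    ∃ δ > 0, ∃ C : ℝ, ∀ n : Fin d → ℕ, natVec n ∈ conicNhd r δ →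
      ‖a n‖ ≤ C * Real.exp (-inner ℝ (natVec n) x) * ‖natVec n‖ ^ (-((d : ℝ) + m)) := by
  obtain ⟨u, hu, δ₁, hδ₁, hcoeff⟩ := h.exists_coeff_le_lintegral hd hg T hr hfin hB ha
  obtain ⟨δ₂, hδ₂, hnear⟩ := h.exists_lintegral_le_near hd hQ hg T hr hfin hu
  obtain ⟨δ₃, hδ₃, hfar⟩ := h.exists_lintegral_le_far hg T hr hu (Q := Q) (s := s)
  obtain ⟨ε, hε0, hε⟩ := exists_between (show 0 < min δ₁ (min δ₂ δ₃) by positivity)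
  rw [lt_min_iff, lt_min_iff] at hε
  obtain ⟨D, hD, hcoeff⟩ := hcoeff ε ⟨hε0, hε.1⟩
  have hcube : ∃ δ > 0, ∃ σ₁ > (0 : ℝ), ∀ σ₀ ∈ Ioo 0 σ₁, ∃ C : ℝ, 0 ≤ C ∧
        ∀ r' ∈ conicNhd r δ, 1 ≤ ‖r'‖ → ∀ V : RSp d → ℂ,
          (∀ y, IsValue Q s (fun i => Complex.exp (pt (x + ((σ₀ / ‖r'‖) • u + ε • η y)) y i))
            (V y)) →
          ∫⁻ y in closedCube d, ENNReal.ofReal (‖V y‖ * Real.exp (-inner ℝ r' (ε • η y)))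
            ≤ ENNReal.ofReal (C * ‖r'‖ ^ (-((d : ℝ) + m))) := by
    refine isCompact_closedCube.induction_on
      (p := fun S => ∃ δ > 0, ∃ σ₁ > (0 : ℝ), ∀ σ₀ ∈ Ioo 0 σ₁, ∃ C : ℝ, 0 ≤ C ∧
        ∀ r' ∈ conicNhd r δ, 1 ≤ ‖r'‖ → ∀ V : RSp d → ℂ,
          (∀ y, IsValue Q s (fun i => Complex.exp (pt (x + ((σ₀ / ‖r'‖) • u + ε • η y)) y i))
            (V y)) →
          ∫⁻ y in S, ENNReal.ofReal (‖V y‖ * Real.exp (-inner ℝ r' (ε • η y)))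
            ≤ ENNReal.ofReal (C * ‖r'‖ ^ (-((d : ℝ) + m)))) ?_ ?_ ?_ ?_
    · exact ⟨1, one_pos, 1, one_pos, fun σ₀ _ => ⟨0, le_rfl, fun r' _ _ V _ => by simp⟩⟩
    · rintro S S' hSS' ⟨δ, hδ, σ₁, hσ₁, H⟩
      refine ⟨δ, hδ, σ₁, hσ₁, fun σ₀ hσ₀ => ?_⟩
      obtain ⟨C, hC, H⟩ := H σ₀ hσ₀
      exact ⟨C, hC, fun r' hr' hr1 V hV => (lintegral_mono_set hSS').trans (H r' hr' hr1 V hV)⟩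
    · rintro S S' ⟨δ, hδ, σ₁, hσ₁, H⟩ ⟨δ', hδ', σ₁', hσ₁', H'⟩
      refine ⟨min δ δ', by positivity, min σ₁ σ₁', by positivity, fun σ₀ hσ₀ => ?_⟩
      obtain ⟨C, hC, H⟩ := H σ₀ ⟨hσ₀.1, hσ₀.2.trans_le (min_le_left _ _)⟩
      obtain ⟨C', hC', H'⟩ := H' σ₀ ⟨hσ₀.1, hσ₀.2.trans_le (min_le_right _ _)⟩
      refine ⟨C + C', by positivity, fun r' hr' hr1 V hV => ?_⟩
      rw [add_mul, ENNReal.ofReal_add (by positivity) (by positivity)]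
      exact (lintegral_union_le _ _ _).trans (add_le_add
        (H r' (conicNhd_mono (min_le_left _ _) hr') hr1 V hV)
        (H' r' (conicNhd_mono (min_le_right _ _) hr') hr1 V hV))
    · intro w _
      by_cases hw : w ∈ critSet g B r x
      · obtain ⟨κ, hκ, H⟩ := hnear ε ⟨hε0, hε.2.1⟩ w hw m (hm w hw)
        exact ⟨_, mem_nhdsWithin_of_mem_nhds (Metric.ball_mem_nhds w hκ), H⟩
      · obtain ⟨κ, hκ, H⟩ := hfar ε ⟨hε0, hε.2.2⟩ w hw m
        exact ⟨_, mem_nhdsWithin_of_mem_nhds (Metric.ball_mem_nhds w hκ), H⟩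
  obtain ⟨δ, hδ, σ₁, hσ₁, H⟩ := hcube
  obtain ⟨σ₀, hσ₀, hσ₀'⟩ := exists_between (show 0 < min σ₁ 1 by positivity)
  rw [lt_min_iff] at hσ₀'
  obtain ⟨C, hC, H⟩ := H σ₀ ⟨hσ₀, hσ₀'.1⟩
  refine ⟨δ, hδ, D * Real.exp (σ₀ * ‖u‖) * C, fun n hn => ?_⟩
  have hn1 : 1 ≤ ‖natVec n‖ := by
    obtain ⟨i, hi⟩ : ∃ i, n i ≠ 0 := by
      by_contra! h0
      exact hn.1 (by ext i; simp [natVec, h0 i])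
    have h1 : (1 : ℝ) ≤ n i := by exact_mod_cast Nat.one_le_iff_ne_zero.2 hi
    have h2 := PiLp.norm_apply_le (natVec n) i
    simp only [natVec, Real.norm_natCast] at h2
    exact h1.trans h2
  have hn0 : 0 < ‖natVec n‖ := by linarith
  have hσ : σ₀ / ‖natVec n‖ ∈ Ioo (0 : ℝ) 1 :=
    ⟨div_pos hσ₀ hn0, (div_le_self hσ₀.le hn1).trans_lt hσ₀'.2⟩
  obtain ⟨V, hV, hle⟩ := hcoeff _ hσ
  have h1 := H (natVec n) hn hn1 V hV
  set E := Real.exp (σ₀ * ‖u‖) * Real.exp (-inner ℝ (natVec n) x) with hE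
  have h2 : ENNReal.ofReal ‖a n‖ ≤ ENNReal.ofReal
      (D * (E * (C * ‖natVec n‖ ^ (-((d : ℝ) + m))))) := by
    refine (hle n).trans ?_
    rw [ENNReal.ofReal_mul hD, ENNReal.ofReal_mul (p := E) (by positivity)]
    gcongr
    refine le_trans ?_ (mul_le_mul_right h1 (ENNReal.ofReal E))
    rw [← lintegral_const_mul' _ _ ENNReal.ofReal_ne_top]
    refine lintegral_mono fun y => ?_
    rw [← ENNReal.ofReal_mul (by positivity)]
    refine ENNReal.ofReal_le_ofReal ?_
    rw [mul_left_comm]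
    refine mul_le_mul_of_nonneg_left ?_ (norm_nonneg _)
    rw [hE, ← Real.exp_add, ← Real.exp_add, Real.exp_le_exp, inner_add_right, inner_add_right,
      real_inner_smul_right _ u]
    -- the displacement by `σ u` changes the exponential by a bounded factor only
    have h3 : -(σ₀ * ‖u‖) ≤ σ₀ / ‖natVec n‖ * inner ℝ (natVec n) u := by
      have h4 := neg_abs_le (inner ℝ (natVec n) u)
      have h5 := abs_real_inner_le_norm (natVec n) u
      calc -(σ₀ * ‖u‖) = σ₀ / ‖natVec n‖ * (-(‖natVec n‖ * ‖u‖)) := by field_simp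
        _ ≤ _ := mul_le_mul_of_nonneg_left (by linarith) hσ.1.le
    linarith
  have h3 := (ENNReal.ofReal_le_ofReal_iff (by positivity)).1 h2
  calc ‖a n‖ ≤ _ := h3
    _ = _ := by rw [hE]; ring

end IsLocProjField

/-! ### Synthesis -/

/-- The direction of a dual point is nonzero, because the component is not a single point. -/
theorem IsDualPoint.ne_zero (hd : 0 < d) {B : Set (RSp d)} {r x : RSp d}
    (hB : ∃ c : RSp d, ∀ y : RSp d, (∀ i, y i < c i) → y ∈ B) (hx : IsDualPoint B r x) :
    r ≠ 0 := by
  rintro rfl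
  obtain ⟨c, hc⟩ := hB
  have h : ∀ t : ℝ, 0 < t → WithLp.toLp 2 (fun i => c i - t) = x := fun t ht => by
    by_contra hne
    have h1 := hx.2 _ (subset_closure (hc (WithLp.toLp 2 fun i => c i - t) fun i => by
      simpa using ht)) hne
    simp at h1
  have h1 := congrArg (fun y : RSp d => y ⟨0, hd⟩) ((h 1 one_pos).trans (h 2 two_pos).symm)
  simp at h1

end LocProj

end

theorem lemma4p7 {d k : ℕ} (hd : 0 < d)
    (Q : Fin k → MvPolynomial (Fin d) ℂ) (hQ : ∀ j, Q j ≠ 0) (s : Fin k → ℝ)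
    (g : CSp d → ℂ) (hg : g = expPull (singularPart Q s))
    (B : Set (RSp d)) (hB : IsPowerSeriesComponent (singularPart Q s) B)
    (r x : RSp d) (hr : r ∈ interior (barrier B)) (hx : IsDualPoint B r x)
    (W : Set (RSp d)) (hW : W = critSet g B r x)
    (hfin : (W ∩ {y | ∀ i, y i ∈ Set.Ico 0 (2 * Real.pi)}).Finite)
    (hobs : NonObstructed g B r x) :
    -- The locally projective homotopies exist, and for each of them the following holds as soon
    -- as `ε` is small enough: the homotopy avoids the zeros of `g`, and the estimates hold on the
    -- chains `C_w`, the restrictions to `closure (U w)` of the end of the homotopy.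
    (∀ U : RSp d → Set (RSp d), IsNhdFamily W U →
      (∃ η : RSp d → RSp d, IsLocProjField g B r x U η) ∧
      ∀ η : RSp d → RSp d, IsLocProjField g B r x U η → ∀ u ∈ tanCone B x,
        ∃ ε₀ > 0, ∀ ε : ℝ, 0 < ε → ε < ε₀ →
          (∀ t ∈ Set.Icc (0 : ℝ) 1, ∀ y : RSp d, ¬ (t = 1 ∧ y ∈ W) →
            g (homotopy x u η ε t y) ≠ 0) ∧
          ∃ δ > 0, ∀ w ∈ W,
            (∀ β : ℝ, 0 < β + d → ∃ C : ℝ, ∀ (φ : CSp d → ℂ) (M : ℝ),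
              AEStronglyMeasurable (fun y => φ (homotopy x u η ε 1 y))
                (volume.restrict (closure (U w))) →
              (∀ y ∈ closure (U w), y ≠ w →
                ‖φ (homotopy x u η ε 1 y)‖ ≤ M * ‖homotopy x u η ε 1 y - pt x w‖ ^ β) →
              ∀ r' ∈ conicNhd r δ,
                ChainIntegrable (homotopy x u η ε 1) (closure (U w))
                  (fun z => Complex.exp (-pair r' z) * φ z) ∧
                Real.exp (inner ℝ r' x) *
                    ‖chainIntegral (homotopy x u η ε 1) (closure (U w))
                      (fun z => Complex.exp (-pair r' z) * φ z)‖
                  ≤ C * M * ‖r'‖ ^ (-(d : ℝ) - β)) ∧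
            (0 < degF Q s (pt x w) + d → ∃ C : ℝ, ∀ (ψ f : CSp d → ℂ) (M : ℝ),
              AEStronglyMeasurable (fun y => ψ (homotopy x u η ε 1 y))
                (volume.restrict (closure (U w))) →
              (∀ y ∈ closure (U w), ‖ψ (homotopy x u η ε 1 y)‖ ≤ M) →
              AEStronglyMeasurable (fun y => f (homotopy x u η ε 1 y))
                (volume.restrict (closure (U w))) →
              (∀ y ∈ closure (U w), y ≠ w →
                IsValue Q s (fun i => Complex.exp (homotopy x u η ε 1 y i))
                  (f (homotopy x u η ε 1 y))) →
              ∀ r' ∈ conicNhd r δ,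
                ChainIntegrable (homotopy x u η ε 1) (closure (U w))
                  (fun z => Complex.exp (-pair r' z) * ψ z * f z) ∧
                Real.exp (inner ℝ r' x) *
                    ‖chainIntegral (homotopy x u η ε 1) (closure (U w))
                      (fun z => Complex.exp (-pair r' z) * ψ z * f z)‖
                  ≤ C * M * ‖r'‖ ^ (-((d : ℝ) + degF Q s (pt x w))))) ∧
    -- The bound on the Taylor coefficients.
    (∀ a : (Fin d → ℕ) → ℂ, IsTaylorCoeff Q s a →
      ∀ m : ℝ, IsLeast ((fun w => degF Q s (pt x w)) '' W) m →
        ∃ δ > 0, ∃ C : ℝ, ∀ n : Fin d → ℕ, natVec n ∈ conicNhd r δ →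
          ‖a n‖ ≤ C * Real.exp (-inner ℝ (natVec n) x) * ‖natVec n‖ ^ (-((d : ℝ) + m))) := by
  subst hW
  have T : TubeData g B x := hg ▸ hB.tubeData hx.1
  have hr0 : r ≠ 0 := hx.ne_zero hd hB.2
  refine ⟨fun U hU => ⟨T.exists_isLocProjField hr0 hfin hobs hU, fun η hη u hu => ?_⟩, ?_⟩
  · obtain ⟨δ₁, hδ₁, hfree⟩ := hη.homotopy_ne_zero T hr0 hu
    obtain ⟨δ₂, hδ₂, hval⟩ := hη.exists_isValue_bound hQ hg T hr0 hfin hU hu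
    refine ⟨min δ₁ δ₂, lt_min hδ₁ hδ₂, fun ε hε0 hε => ?_⟩
    rw [lt_min_iff] at hε
    refine ⟨hfree ε ⟨hε0, hε.1⟩, ?_⟩
    obtain ⟨δ, hδ, H⟩ := hη.exists_chainIntegral_bound hd T hr0 hfin hU u hε0
    obtain ⟨δ', hδ', H'⟩ := hη.exists_chainIntegral_bound_dist hd T hr0 hfin hU u hε0
    refine ⟨min δ δ', lt_min hδ hδ', fun w hw => ⟨fun β hβ => ?_, fun hdeg => ?_⟩⟩
    · obtain ⟨C, -, hC⟩ := H' w hw β hβ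
      exact ⟨C, fun φ M hφ hM r' hr' =>
        hC φ M hφ hM r' (conicNhd_mono (min_le_right _ _) hr')⟩
    · obtain ⟨C, -, hC⟩ := H w hw _ hdeg
      obtain ⟨K, hK, hval⟩ := hval w hw ε ⟨hε0, hε.2⟩
      refine ⟨C * K, fun ψ f M hψ hM hf hfv r' hr' => ?_⟩
      have h := hC (fun z => ψ z * f z) (M * K) (hψ.mul hf) (fun y hy hyw => by
        have h1 := hM y hy
        have h2 := hval y hy hyw (f (homotopy x u η ε 1 y)) (by
          simpa only [homotopy_one] using hfv y hy hyw)
        rw [norm_mul, mul_assoc]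
        exact mul_le_mul h1 h2 (norm_nonneg _) ((norm_nonneg _).trans h1))
        r' (conicNhd_mono (min_le_left _ _) hr')
      rw [show C * K * M = C * (M * K) by ring, neg_add']
      simpa only [mul_assoc] using h
  · intro a ha m hm
    obtain ⟨U, hU⟩ := T.exists_isNhdFamily hr0 hfin hobs
    obtain ⟨η, hη⟩ := T.exists_isLocProjField hr0 hfin hobs hU
    exact hη.exists_coeff_bound hd hQ hg T hr0 hfin hB.2 ha fun w hw => hm.2 ⟨w, hw, rfl⟩
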